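/- \textbf{Setting.} A linear representation of size $m$ is a 4-tuple $(\xi,A,B,\eta)$ with $\xi,\eta\in\mathbb{R}_+^m$ and $A,B\in\mathbb{R}_+^{m\times m}$ ($\mathbb{R}_+=[0,\infty)$). Let $\mu:\{a,b\}^*\to\mathbb{R}_+^{m\times m}$ be the monoid morphism with $\mu(a)=A$, $\mu(b)=B$, put $(r,w)=\xi'\mu(w)\eta$ for each word $w$, and assume that $A\neq 0\neq B$ and that for every $n\ge 1$ some word $w$ of length $n$ has $(r,w)>0$. Let $w$ be drawn from $\{a,b\}^n$ with probability $\Pr(w)=(r,w)/\sum_{x\in\{a,b\}^n}(r,x)$, and let $Y_n=|w|_a$ be the number of occurrences of $a$ in $w$. The pair $(A,B)$ is \emph{aperiodic} if $\gcd\{|\ell(\mathcal C_1)|_a-|\ell(\mathcal C_2)|_a\}=1$, where $\mathcal C_1,\mathcal C_2$ range over the pairs of cycles (closed paths) of equal length in the labelled graph having an edge $i\to j$ with label $a$ (resp. $b$) whenever $A_{ij}>0$ (resp. $B_{ij}>0$), and $\ell(\mathcal C)$ is the word labelling $\mathcal C$. A nonnegative square matrix is aperiodic if the gcd of the lengths of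 the cycles in its graph is $1$. When $M=A+B$ is irreducible and aperiodic (hence primitive), with Perron--Frobenius eigenvalue $\lambda$, let $u(z)$ be the function analytic near $z=0$ with $\det(u(z)I-Ae^z-B)=0$ and $u(0)=\lambda$, and set $$\beta=\frac{u'(0)}{\lambda},\qquad \gamma=\frac{u''(0)}{\lambda}-\left(\frac{u'(0)}{\lambda}\right)^2 .$$ $\{Y_n\}$ is defined in an \emph{equipotent communicating bicomponent model} if it is given by a linear representation as above of the form $$\xi'=(\xi_1',\xi_2'),\quad A=\begin{pmatrix}A_1&A_0\\0&A_2\end{pmatrix},\quad B=\begin{pmatrix}B_1&B_0\\0&B_2\end{pmatrix},\quad \eta=\begin{pmatrix}\eta_1\\ \eta_2\end{pmatrix},$$ where $(\xi_j,A_j,B_j,\eta_j)$ ($j=1,2$) are linear representations and $A_0,B_0$ are nonnegative matrices, such that $M_1=A_1+B_1$ and $M_2=A_2+B_2$ are irreducible and aperiodic, $\xi_1\ne0\ne\eta_2$, $A_0+B_0\neq0$, and the Perron--Frobenius eigenvalues of $M_1$ and $M_2$ coincide. Let $\beta_j,\gamma_j$ be the constants $\beta,\gamma$ associated with $(A_j,B_j)$.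 \textbf{Theorem.} Let $\{Y_n\}$ be defined in an equipotent communicating bicomponent model with $\beta_1=\beta_2=\beta$ and $\gamma_1=\gamma_2=\gamma$, and assume that both pairs $(A_1,B_1)$ and $(A_2,B_2)$ are aperiodic. Then $\gamma>0$ and, as $n\to+\infty$, $$\left|\sqrt n\,\Pr(Y_n=k)-\frac{e^{-\frac{(k-\beta n)^2}{2\gamma n}}}{\sqrt{2\pi\gamma}}\right|=O\!\left(n^{-1/2}\right)$$ uniformly for $k\in\{0,1,\dots,n\}$; that is, there are a constant $C$ and an integer $N$ such that the left-hand side is at most $C\,n^{-1/2}$ for all $n\ge N$ and all $k\in\{0,\dots,n\}$. -/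

import Mathlib

open scoped Topology

namespace RationalModel

noncomputable section

/-- The binary alphabet `{a, b}`. -/
inductive Letter
  | a
  | b
  deriving DecidableEq

instance : Fintype Letter := ⟨{Letter.a, Letter.b}, fun x => by cases x <;> decide⟩

/-- A linear representation `(ξ, A, B, η)` with nonnegative real entries, over the index set `ι`;
its size is the cardinality of `ι`. -/
structure LinearRep (ι : Type) where
  ξ : ι → ℝ
  A : Matrix ι ι ℝ
  B : Matrix ι ι ℝ
  η : ι → ℝ
  ξ_nonneg : ∀ i, 0 ≤ ξ i
  A_nonneg : ∀ i j, 0 ≤ A i j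
  B_nonneg : ∀ i j, 0 ≤ B i j
  η_nonneg : ∀ i, 0 ≤ η i

namespace LinearRep

variable {ι : Type}

/-- The matrix attached to a letter: `μ(a) = A` and `μ(b) = B`. -/
def letterMatrix (R : LinearRep ι) : Letter → Matrix ι ι ℝ
  | Letter.a => R.A
  | Letter.b => R.B

/-- The matrix `M = A + B`. -/
def M (R : LinearRep ι) : Matrix ι ι ℝ := R.A + R.B

section Series

variable [Fintype ι] [DecidableEq ι]

/-- The monoid morphism `μ : {a,b}* → ℝ₊^{m × m}` generated by `A = μ(a)` and `B = μ(b)`. -/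
def μ (R : LinearRep ι) : FreeMonoid Letter →* Matrix ι ι ℝ :=
  FreeMonoid.lift R.letterMatrix

/-- The rational formal series `r` with `(r, w) = ξ' μ(w) η`. -/
def series (R : LinearRep ι) (w : FreeMonoid Letter) : ℝ :=
  R.ξ ⬝ᵥ (R.μ w).mulVec R.η

/-- `Pr(w) = (r, w) / ∑_{x ∈ {a,b}^n} (r, x)`, for a word `w` of length `n`. -/
def wordProb (R : LinearRep ι) (n : ℕ) (w : List.Vector Letter n) : ℝ :=
  R.series (FreeMonoid.ofList w.toList) /
    ∑ x : List.Vector Letter n, R.series (FreeMonoid.ofList x.toList)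

/-- `Pr(Y_n = k)`, where `Y_n = |w|_a` and `w` is drawn from `{a,b}^n` according to `wordProb`. -/
def prob (R : LinearRep ι) (n k : ℕ) : ℝ :=
  ∑ w : List.Vector Letter n with w.toList.count Letter.a = k, R.wordProb n w

/-- The standing assumptions on a linear representation: `A` and `B` are not null, and for every
positive `n` some word of length `n` has positive weight (so that `Pr` is a probability). -/
structure Standing (R : LinearRep ι) : Prop where
  A_ne_zero : R.A ≠ 0
  B_ne_zero : R.B ≠ 0
  support_nonempty : ∀ n : ℕ, 0 < n →
    ∃ w : List.Vector Letter n, 0 < R.series (FreeMonoid.ofList w.toList)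

end Series

section Graph

/-- `R.IsPath i w j`: in the transition graph of the automaton, which has an edge from `i` to `j`
labelled `a` (resp. `b`) whenever `A i j > 0` (resp. `B i j > 0`), there is a path from `i` to `j`
with label `w`. -/
inductive IsPath (R : LinearRep ι) : ι → List Letter → ι → Prop
  | nil (i : ι) : IsPath R i [] i
  | cons {i j k : ι} {x : Letter} {w : List Letter} (hx : 0 < R.letterMatrix x i j)
      (hw : IsPath R j w k) : IsPath R i (x :: w) k

/-- `w` is the label of a cycle (closed path of positive length) of the transition graph. -/
def IsCycleLabel (R : LinearRep ι) (w : List Letter) : Prop :=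
  w ≠ [] ∧ ∃ i, R.IsPath i w i

/-- The number `d`: the GCD of the differences of the numbers of occurrences of `a` in the labels
of two cycles of equal length (`natAbs` does not affect the GCD). -/
def cycleGCD (R : LinearRep ι) : ℕ :=
  Nat.setGcd {e | ∃ w₁ w₂ : List Letter, R.IsCycleLabel w₁ ∧ R.IsCycleLabel w₂ ∧
    w₁.length = w₂.length ∧
    e = ((w₁.count Letter.a : ℤ) - (w₂.count Letter.a : ℤ)).natAbs}

/-- The pair `(A, B)` is aperiodic. -/
def IsAperiodicPair (R : LinearRep ι) : Prop := R.cycleGCD = 1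

end Graph

section Spectral

variable [Fintype ι] [DecidableEq ι]

/-- The Perron-Frobenius eigenvalue `lam` of the nonnegative matrix `M = A + B`: the largest
modulus of a complex eigenvalue of `M`. -/
def lam (R : LinearRep ι) : ℝ :=
  (spectralRadius ℂ (R.M.map (algebraMap ℝ ℂ))).toReal

/-- `u` is analytic at `0`, solves `Det(I u(z) - A e^z - B) = 0` near `z = 0`, and `u(0) = lam`. -/
def IsPerronBranch (R : LinearRep ι) (u : ℂ → ℂ) : Prop :=
  AnalyticAt ℂ u 0 ∧ u 0 = (R.lam : ℂ) ∧
    ∀ᶠ z in 𝓝 (0 : ℂ),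
      (u z • (1 : Matrix ι ι ℂ) - Complex.exp z • R.A.map (algebraMap ℝ ℂ)
        - R.B.map (algebraMap ℝ ℂ)).det = 0

/-- The function `u(z)` implicitly defined by `Det(I u - A e^z - B) = 0` and `u(0) = lam`.
If `M` is primitive, `lam` is a simple root of the characteristic polynomial of `M`, so that such
a function exists and is unique in a neighbourhood of `0`. -/
def u (R : LinearRep ι) : ℂ → ℂ := Classical.epsilon R.IsPerronBranch

/-- `β = u'(0) / lam` (a real number). -/
def β (R : LinearRep ι) : ℝ := (deriv R.u 0 / (R.lam : ℂ)).re

/-- `γ = u''(0) / lam - (u'(0) / lam)²` (a real number). -/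
def γ (R : LinearRep ι) : ℝ :=
  (iteratedDeriv 2 R.u 0 / (R.lam : ℂ) - (deriv R.u 0 / (R.lam : ℂ)) ^ 2).re

end Spectral

end LinearRep

/-- A square matrix with nonnegative entries is aperiodic if the GCD of the lengths of all the
cycles of its graph is `1`; here `(M ^ n) i i > 0` says that there is a cycle of length `n`
through `i`. -/
def IsAperiodicMatrix {ι : Type} [Fintype ι] [DecidableEq ι] (M : Matrix ι ι ℝ) : Prop :=
  Nat.setGcd {n | 0 < n ∧ ∃ i, 0 < (M ^ n) i i} = 1

/-- The data of a linear representation in block form: two linear representations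
`(ξ₁, A₁, B₁, η₁)`, `(ξ₂, A₂, B₂, η₂)` and nonnegative matrices `A₀`, `B₀`. -/
structure BlockRep (ι₁ ι₂ : Type) where
  R₁ : LinearRep ι₁
  R₂ : LinearRep ι₂
  A₀ : Matrix ι₁ ι₂ ℝ
  B₀ : Matrix ι₁ ι₂ ℝ
  A₀_nonneg : ∀ i j, 0 ≤ A₀ i j
  B₀_nonneg : ∀ i j, 0 ≤ B₀ i j

namespace BlockRep

variable {ι₁ ι₂ : Type}

/-- The linear representation `ξ' = (ξ₁', ξ₂')`, `A = (A₁ A₀; 0 A₂)`, `B = (B₁ B₀; 0 B₂)`,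
`η = (η₁; η₂)`. -/
def toLinearRep (R : BlockRep ι₁ ι₂) : LinearRep (ι₁ ⊕ ι₂) where
  ξ := Sum.elim R.R₁.ξ R.R₂.ξ
  A := Matrix.fromBlocks R.R₁.A R.A₀ 0 R.R₂.A
  B := Matrix.fromBlocks R.R₁.B R.B₀ 0 R.R₂.B
  η := Sum.elim R.R₁.η R.R₂.η
  ξ_nonneg := by
    rintro (i | i)
    · exact R.R₁.ξ_nonneg i
    · exact R.R₂.ξ_nonneg i
  A_nonneg := by
    rintro (i | i) (j | j)
    · exact R.R₁.A_nonneg i j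
    · exact R.A₀_nonneg i j
    · exact le_refl _
    · exact R.R₂.A_nonneg i j
  B_nonneg := by
    rintro (i | i) (j | j)
    · exact R.R₁.B_nonneg i j
    · exact R.B₀_nonneg i j
    · exact le_refl _
    · exact R.R₂.B_nonneg i j
  η_nonneg := by
    rintro (i | i)
    · exact R.R₁.η_nonneg i
    · exact R.R₂.η_nonneg i

/-- The equipotent communicating bicomponent model. -/
structure IsEquipotentCommunicating [Fintype ι₁] [DecidableEq ι₁] [Fintype ι₂] [DecidableEq ι₂]
    (R : BlockRep ι₁ ι₂) : Prop where
  standing : R.toLinearRep.Standing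
  irreducible₁ : R.R₁.M.IsIrreducible
  irreducible₂ : R.R₂.M.IsIrreducible
  ξ₁_ne_zero : R.R₁.ξ ≠ 0
  η₂_ne_zero : R.R₂.η ≠ 0
  M₀_ne_zero : R.A₀ + R.B₀ ≠ 0
  equipotent : R.R₁.lam = R.R₂.lam
  aperiodic₁ : IsAperiodicMatrix R.R₁.M
  aperiodic₂ : IsAperiodicMatrix R.R₂.M

end BlockRep

end

end RationalModel

/-! The proof is by characteristic functions. Let M(z) = A e^z + B and let ψ be the characteristic
function of the normal law with mean β and variance γ (`gaussChar`). The weights of the words of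
length n form a polynomial in a variable marking `a`. Its value at e^{iθ} is ξ' M(iθ)^n η, and
Pr(Y_n = k) is a Fourier coefficient of the normalized polynomial on the circle.

For one primitive block there are two sources of control. Near θ = 0 the Perron root is simple and
separated by a spectral gap, so M(z)^n is u(z)^n times an analytic rank-one projection plus a
geometrically small term (`exists_pow_expansion`), and u(iθ)/λ = ψ(θ) + O(|θ|³). On all of [-π, π],
aperiodicity of the pair makes two different exponents of `a` occur in the same entry of a power of
M. This costs a factor e^{-cθ²} per step (`exists_decay`). Comparing the two near 0 forces γ > 0,
and combining them gives M(iθ)^n / λ^n = ψ^n v w' up to |θ| e^{-cnθ²} + ρ^n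
(`exists_gaussian_estimate`). The factor n|θ|³ from the eigenvalue error becomes |θ| when part of
the Gaussian decay is given up, so no splitting of scales in n is needed.

For two blocks, a path crosses from the first to the second at some time k, so the transform is a
convolution of the two power sequences plus the transforms of the separate blocks, which are O(λ^n).
Because β and γ agree, every term of the convolution has main part ψ^{n-1} times one positive
constant, whatever the crossing time. The sum is therefore of exact order n λ^{n-1} at θ = 0 and
dominates the rest (`PowEst.conv`). After normalization the characteristic function is ψ^n + O(|θ|
e^{-cnθ²} + 1/n) (`ConvEst.normalized`). This error integrates to O(1/n), and multiplication by √n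
gives the claimed rate (`local_limit_of_charFun`). -/

open scoped Topology

/-! ### Primitivity and Perron vectors -/

namespace RationalModel

noncomputable section

variable {ι : Type} [Fintype ι] [DecidableEq ι]

/-- A matrix is eventually positive if all its large powers have positive entries. -/
def EventuallyPos (M : Matrix ι ι ℝ) : Prop :=
  ∃ s₀ : ℕ, ∀ s ≥ s₀, ∀ i j, 0 < (M ^ s) i j

theorem pow_add_apply_pos {M : Matrix ι ι ℝ} (hM : ∀ i j, 0 ≤ M i j) {m n : ℕ} {i j k : ι}
    (h₁ : 0 < (M ^ m) i j) (h₂ : 0 < (M ^ n) j k) : 0 < (M ^ (m + n)) i k := by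
  rw [pow_add, Matrix.mul_apply]
  exact Finset.sum_pos' (fun x _ => mul_nonneg (Matrix.pow_apply_nonneg hM m i x)
    (Matrix.pow_apply_nonneg hM n x k)) ⟨j, Finset.mem_univ j, mul_pos h₁ h₂⟩

/-- A cycle of length n at j yields two return times at i that differ by n: go to j and back, with
or without the cycle. Hence the return times at each single state already have gcd 1, and the
additive monoid they generate contains all large integers. -/
theorem eventuallyPos_of_irreducible {M : Matrix ι ι ℝ} (hM : M.IsIrreducible)
    (ha : IsAperiodicMatrix M) : EventuallyPos M := by
  have h0 := hM.nonneg
  have hc := (Matrix.isIrreducible_iff_exists_pow_pos h0).1 hM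
  have key : ∀ i, ∃ s₀, ∀ s ≥ s₀, 0 < (M ^ s) i i := by
    intro i
    have hg : Nat.setGcd {n | 0 < (M ^ n) i i} = 1 := by
      have h1 : Nat.setGcd {n | 0 < (M ^ n) i i} ∣
          Nat.setGcd {n | 0 < n ∧ ∃ i, 0 < (M ^ n) i i} := by
        rw [Nat.dvd_setGcd_iff]
        rintro n ⟨-, j, hj⟩
        obtain ⟨a, -, hij⟩ := hc i j
        obtain ⟨b, -, hji⟩ := hc j i
        have e1 : Nat.setGcd {n | 0 < (M ^ n) i i} ∣ a + b :=
          Nat.setGcd_dvd_of_mem (pow_add_apply_pos h0 hij hji)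
        have e2 : Nat.setGcd {n | 0 < (M ^ n) i i} ∣ (a + b) + n := by
          have : (a + b) + n = (a + n) + b := by ring
          rw [this]
          exact Nat.setGcd_dvd_of_mem (pow_add_apply_pos h0 (pow_add_apply_pos h0 hij hj) hji)
        exact (Nat.dvd_add_right e1).1 e2
      unfold IsAperiodicMatrix at ha
      rw [ha] at h1
      exact Nat.dvd_one.1 h1
    obtain ⟨n, hn⟩ := Nat.exists_mem_closure_of_ge {n | 0 < (M ^ n) i i}
    refine ⟨n, fun s hs => ?_⟩
    have hs' := hn s hs (by rw [hg]; exact one_dvd _)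
    refine AddSubmonoid.closure_induction (motive := fun s _ => 0 < (M ^ s) i i)
      (fun _ h => h) (by simp) (fun a b _ _ h1 h2 => pow_add_apply_pos h0 h1 h2) hs'
  choose s₀ hs₀ using key
  choose a _ ha' using hc
  -- The sums are crude common upper bounds; a long walk from i to j is a long loop at i followed by
  -- a fixed walk to j.
  refine ⟨∑ i, s₀ i + ∑ i, ∑ j, a i j, fun s hs i j => ?_⟩
  have h1 : s₀ i ≤ ∑ i, s₀ i := Finset.single_le_sum (fun _ _ => Nat.zero_le _) (Finset.mem_univ i)
  have h2 : a i j ≤ ∑ i, ∑ j, a i j :=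
    (Finset.single_le_sum (f := fun j => a i j) (fun _ _ => Nat.zero_le _)
      (Finset.mem_univ j)).trans
      (Finset.single_le_sum (f := fun i => ∑ j, a i j) (fun _ _ => Nat.zero_le _)
      (Finset.mem_univ i))
  have : s = (s - a i j) + a i j := by omega
  rw [this]
  exact pow_add_apply_pos h0 (hs₀ i _ (by omega)) (ha' i j)

/-- Collatz-Wielandt: a nonnegative matrix with a positive power has a positive eigenvector. -/
theorem exists_pos_eigenvector [Nonempty ι] {M : Matrix ι ι ℝ} {p : ℕ}
    (hp : ∀ i j, 0 < (M ^ p) i j) (hp0 : ∀ i j, 0 < (M ^ (p + 1)) i j) :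
    ∃ l : ℝ, 0 < l ∧ ∃ v : ι → ℝ, (∀ i, 0 < v i) ∧ M.mulVec v = l • v := by
  classical
  have posM : ∀ (q : ℕ), (∀ i j, 0 < (M ^ q) i j) → ∀ x : ι → ℝ, (∀ i, 0 ≤ x i) →
      (∃ i, 0 < x i) → ∀ i, 0 < (M ^ q).mulVec x i := by
    intro q hq x hx ⟨j, hj⟩ i
    exact Finset.sum_pos' (fun k _ => mul_nonneg (hq i k).le (hx k))
      ⟨j, Finset.mem_univ j, mul_pos (hq i j) hj⟩
  have simplex_pos : ∀ x ∈ stdSimplex ℝ ι, ∃ i, 0 < x i := by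
    intro x hx
    by_contra! h
    have : ∑ i, x i ≤ 0 := Finset.sum_nonpos fun i _ => h i
    rw [hx.2] at this
    linarith
  -- The quotient is evaluated at M^p x instead of x: M^p x is strictly positive, so `f` is
  -- continuous on the whole simplex, boundary included.
  let f : (ι → ℝ) → ℝ := fun x => Finset.univ.inf' Finset.univ_nonempty
    fun i => (M ^ (p + 1)).mulVec x i / (M ^ p).mulVec x i
  have hf : ContinuousOn f (stdSimplex ℝ ι) := by
    apply ContinuousOn.finset_inf'_apply
    intro i _
    apply ContinuousOn.div
    · exact ((continuous_apply i).comp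
          ((M ^ (p + 1)).mulVecLin.continuous_of_finiteDimensional)).continuousOn
    · exact ((continuous_apply i).comp
          ((M ^ p).mulVecLin.continuous_of_finiteDimensional)).continuousOn
    · exact fun x hx => (posM p hp x hx.1 (simplex_pos x hx) i).ne'
  obtain ⟨x, hx, hmax⟩ := (isCompact_stdSimplex ℝ ι).exists_isMaxOn
    ⟨_, single_mem_stdSimplex ℝ (Classical.arbitrary ι)⟩ hf
  set l := f x with hl
  set y := (M ^ p).mulVec x with hy
  have hypos : ∀ i, 0 < y i := posM p hp x hx.1 (simplex_pos x hx)
  have hMy : (M ^ (p + 1)).mulVec x = M.mulVec y := by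
    rw [hy, Matrix.mulVec_mulVec, pow_succ']
  have hMypos : ∀ i, 0 < M.mulVec y i := by
    rw [← hMy]; exact posM _ hp0 x hx.1 (simplex_pos x hx)
  have hle : ∀ i, l * y i ≤ M.mulVec y i := by
    intro i
    have : l ≤ M.mulVec y i / y i := by
      rw [hl, ← hMy]
      exact Finset.inf'_le (fun i => (M ^ (p + 1)).mulVec x i / (M ^ p).mulVec x i)
        (Finset.mem_univ i)
    rwa [le_div_iff₀ (hypos i)] at this
  have hlpos : 0 < l := by
    rw [hl]
    simp only [f]
    rw [Finset.lt_inf'_iff]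
    intro i _
    rw [hMy]
    exact div_pos (hMypos i) (hypos i)
  refine ⟨l, hlpos, y, hypos, ?_⟩
  -- Otherwise the excess e = M y - l y is nonnegative and nonzero, so M^p e is strictly positive.
  -- Then the normalized y has a larger value of `f` than the maximum.
  by_contra hne
  let e : ι → ℝ := M.mulVec y - l • y
  have he : ∀ i, 0 ≤ e i := fun i => by simpa [e] using hle i
  have he' : ∃ i, 0 < e i := by
    by_contra! h
    apply hne
    ext i
    have h1 := h i
    have h2 := hle i
    simp only [e, Pi.sub_apply, Pi.smul_apply, smul_eq_mul] at h1 ⊢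
    linarith
  have hMe := posM p hp e he he'
  set s := ∑ i, y i with hs
  have hspos : 0 < s := Finset.sum_pos (fun i _ => hypos i) Finset.univ_nonempty
  have hz : s⁻¹ • y ∈ stdSimplex ℝ ι := by
    refine ⟨fun i => mul_nonneg (inv_nonneg.2 hspos.le) (hypos i).le, ?_⟩
    simp only [Pi.smul_apply, smul_eq_mul, ← Finset.mul_sum]
    exact inv_mul_cancel₀ hspos.ne'
  have hlt : l < f (s⁻¹ • y) := by
    simp only [f]
    rw [Finset.lt_inf'_iff]
    intro i _
    rw [Matrix.mulVec_smul, Matrix.mulVec_smul, Pi.smul_apply, Pi.smul_apply, smul_eq_mul,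
      smul_eq_mul, mul_div_mul_left _ _ (inv_ne_zero hspos.ne'),
      lt_div_iff₀ (posM p hp y (fun i => (hypos i).le) ⟨Classical.arbitrary ι, hypos _⟩ i)]
    have := hMe i
    simp only [e, Matrix.mulVec_sub, Matrix.mulVec_smul, Matrix.mulVec_mulVec, Pi.sub_apply,
      Pi.smul_apply, smul_eq_mul] at this
    rw [pow_succ]
    linarith
  exact absurd (hmax hz) (not_le.2 hlt)

/-- Perron data of a nonnegative matrix: the dominant eigenvalue with normalized positive right
and left eigenvectors. -/
structure Perron (M : Matrix ι ι ℝ) (l : ℝ) (v w : ι → ℝ) : Prop where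
  l_pos : 0 < l
  v_pos : ∀ i, 0 < v i
  w_pos : ∀ i, 0 < w i
  mulVec_v : M.mulVec v = l • v
  vecMul_w : Matrix.vecMul w M = l • w
  dot : w ⬝ᵥ v = 1

/-- The left vector comes from the transpose. The two eigenvalues agree because w' M v can be
computed on either side and w · v > 0. -/
theorem exists_perron [Nonempty ι] {M : Matrix ι ι ℝ} (hM : EventuallyPos M) : ∃ l v w, Perron M l v w := by
  obtain ⟨p, hp⟩ := hM
  obtain ⟨l, hl, v, hv, hMv⟩ := exists_pos_eigenvector (hp p le_rfl) (hp (p + 1) (by omega))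
  obtain ⟨l', hl', w, hw, hMw⟩ := exists_pos_eigenvector (M := M.transpose) (p := p)
    (fun i j => by rw [← Matrix.transpose_pow]; exact hp p le_rfl j i)
    (fun i j => by rw [← Matrix.transpose_pow]; exact hp (p + 1) (by omega) j i)
  have hd : 0 < w ⬝ᵥ v :=
    Finset.sum_pos (fun i _ => mul_pos (hw i) (hv i)) Finset.univ_nonempty
  rw [Matrix.mulVec_transpose] at hMw
  have h1 : l = l' := by
    have := Matrix.dotProduct_mulVec w M v
    rw [hMv, hMw, dotProduct_smul, smul_dotProduct, smul_eq_mul, smul_eq_mul] at this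
    exact mul_right_cancel₀ hd.ne' this
  refine ⟨l, v, (w ⬝ᵥ v)⁻¹ • w, hl, hv, fun i => mul_pos (inv_pos.2 hd) (hw i), hMv, ?_, ?_⟩
  · rw [Matrix.smul_vecMul, hMw, h1, smul_comm]
  · rw [smul_dotProduct, smul_eq_mul, inv_mul_cancel₀ hd.ne']

end

end RationalModel

/-! ### Weighted norms and the spectral gap -/

namespace RationalModel

noncomputable section

variable {ι : Type} [Fintype ι] [DecidableEq ι]

/-- `X` has operator norm at most `t` for the supremum norm weighted by `v`. -/
def WBound {𝕜 : Type*} [NormedField 𝕜] (v : ι → ℝ) (X : Matrix ι ι 𝕜) (t : ℝ) : Prop :=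
  ∀ i, ∑ j, ‖X i j‖ * v j ≤ t * v i

section WBound

variable {𝕜 : Type*} [NormedField 𝕜] {v : ι → ℝ} {X Y : Matrix ι ι 𝕜} {s t : ℝ}

omit [DecidableEq ι] in
theorem WBound.mono (hv : ∀ i, 0 < v i) (h : WBound v X s) (hst : s ≤ t) : WBound v X t :=
  fun i => (h i).trans (mul_le_mul_of_nonneg_right hst (hv i).le)

omit [DecidableEq ι] in
theorem WBound.nonneg [Nonempty ι] (hv : ∀ i, 0 < v i) (h : WBound v X s) : 0 ≤ s := by
  obtain ⟨i⟩ := ‹Nonempty ι›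
  have h1 : 0 ≤ s * v i :=
    (Finset.sum_nonneg fun j _ => mul_nonneg (norm_nonneg _) (hv j).le).trans (h i)
  exact nonneg_of_mul_nonneg_left h1 (hv i)

omit [DecidableEq ι] in
theorem WBound.mul (hv : ∀ i, 0 < v i) (hs : 0 ≤ t) (hX : WBound v X s) (hY : WBound v Y t) :
    WBound v (X * Y) (s * t) := by
  intro i
  calc ∑ j, ‖(X * Y) i j‖ * v j ≤ ∑ j, ∑ k, ‖X i k‖ * (‖Y k j‖ * v j) := by
        refine Finset.sum_le_sum fun j _ => ?_
        rw [Matrix.mul_apply]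
        calc ‖∑ k, X i k * Y k j‖ * v j ≤ (∑ k, ‖X i k * Y k j‖) * v j :=
              mul_le_mul_of_nonneg_right (norm_sum_le _ _) (hv j).le
          _ = _ := by
              rw [Finset.sum_mul]
              refine Finset.sum_congr rfl fun k _ => ?_
              rw [norm_mul, mul_assoc]
    _ = ∑ k, ‖X i k‖ * ∑ j, ‖Y k j‖ * v j := by
        rw [Finset.sum_comm]
        simp_rw [Finset.mul_sum]
    _ ≤ ∑ k, ‖X i k‖ * (t * v k) :=
        Finset.sum_le_sum fun k _ => mul_le_mul_of_nonneg_left (hY k) (norm_nonneg _)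
    _ = t * ∑ k, ‖X i k‖ * v k := by
        rw [Finset.mul_sum]
        exact Finset.sum_congr rfl fun k _ => by ring
    _ ≤ t * (s * v i) := mul_le_mul_of_nonneg_left (hX i) hs
    _ = s * t * v i := by ring

theorem WBound.one : WBound v (1 : Matrix ι ι 𝕜) 1 := by
  intro i
  rw [Finset.sum_eq_single i]
  · simp
  · intro j _ hj
    simp [Matrix.one_apply_ne hj.symm]
  · simp

theorem WBound.pow (hv : ∀ i, 0 < v i) (hs : 0 ≤ s) (hX : WBound v X s) (n : ℕ) :
    WBound v (X ^ n) (s ^ n) := by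
  induction n with
  | zero => simpa using WBound.one
  | succ n ih => rw [pow_succ, pow_succ]; exact ih.mul hv hs hX

omit [DecidableEq ι] in
theorem WBound.sub (hX : WBound v X s) (hY : WBound v Y t) (hv : ∀ i, 0 < v i) :
    WBound v (X - Y) (s + t) := by
  intro i
  calc ∑ j, ‖(X - Y) i j‖ * v j ≤ ∑ j, (‖X i j‖ * v j + ‖Y i j‖ * v j) := by
        refine Finset.sum_le_sum fun j _ => ?_
        rw [← add_mul]
        exact mul_le_mul_of_nonneg_right (norm_sub_le _ _) (hv j).le
    _ ≤ s * v i + t * v i := by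
        rw [Finset.sum_add_distrib]
        exact add_le_add (hX i) (hY i)
    _ = (s + t) * v i := by ring

omit [DecidableEq ι] in
theorem WBound.apply_le (hv : ∀ i, 0 < v i) (hX : WBound v X s) (i j : ι) :
    ‖X i j‖ ≤ s * (v i / v j) := by
  have h1 : ‖X i j‖ * v j ≤ s * v i :=
    (Finset.single_le_sum (f := fun j => ‖X i j‖ * v j)
      (fun k _ => mul_nonneg (norm_nonneg _) (hv k).le) (Finset.mem_univ j)).trans (hX i)
  rw [← mul_div_assoc, le_div_iff₀ (hv j)]
  exact h1

omit [DecidableEq ι] in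
theorem WBound.of_le {T : Matrix ι ι ℝ} (hv : ∀ i, 0 < v i) (h : ∀ i j, ‖X i j‖ ≤ T i j)
    (hT : T.mulVec v = t • v) : WBound v X t := by
  intro i
  calc ∑ j, ‖X i j‖ * v j ≤ ∑ j, T i j * v j :=
        Finset.sum_le_sum fun j _ => mul_le_mul_of_nonneg_right (h i j) (hv j).le
    _ = t * v i := congrFun hT i

-- Evaluate the eigenvalue equation at the coordinate where ‖x i‖ / v i is largest.
omit [DecidableEq ι] in
theorem WBound.eigenvalue_le (hv : ∀ i, 0 < v i) (hX : WBound v X s) {x : ι → 𝕜} (hx : x ≠ 0)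
    {c : 𝕜} (hc : X.mulVec x = c • x) : ‖c‖ ≤ s := by
  obtain ⟨j, hj⟩ := Function.ne_iff.1 hx
  have : Nonempty ι := ⟨j⟩
  obtain ⟨i, -, hi⟩ := Finset.exists_max_image Finset.univ (fun i => ‖x i‖ / v i)
    Finset.univ_nonempty
  set m := ‖x i‖ / v i with hm
  have hle : ∀ k, ‖x k‖ ≤ m * v k := fun k => by
    have := hi k (Finset.mem_univ k)
    rwa [div_le_iff₀ (hv k)] at this
  have hmpos : 0 < m :=
    (div_pos (norm_pos_iff.2 hj) (hv j)).trans_le (hi j (Finset.mem_univ j))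
  have h1 : ‖c‖ * (m * v i) ≤ s * (m * v i) := by
    calc ‖c‖ * (m * v i) = ‖(X.mulVec x) i‖ := by
          rw [hc, Pi.smul_apply, smul_eq_mul, norm_mul, hm, div_mul_cancel₀ _ (hv i).ne']
      _ ≤ ∑ k, ‖X i k * x k‖ := norm_sum_le _ _
      _ ≤ ∑ k, m * (‖X i k‖ * v k) := by
          refine Finset.sum_le_sum fun k _ => ?_
          rw [norm_mul]
          calc ‖X i k‖ * ‖x k‖ ≤ ‖X i k‖ * (m * v k) :=
                mul_le_mul_of_nonneg_left (hle k) (norm_nonneg _)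
            _ = _ := by ring
      _ ≤ m * (s * v i) := by
          rw [← Finset.mul_sum]
          exact mul_le_mul_of_nonneg_left (hX i) hmpos.le
      _ = _ := by ring
  exact le_of_mul_le_mul_right h1 (mul_pos hmpos (hv i))

/-- A bound on one power of a matrix gives a geometric bound on all powers. -/
theorem WBound.pow_le_of_pow (hv : ∀ i, 0 < v i) {K : ℝ} {p : ℕ} (hp : 0 < p) (ht : 0 < t)
    (hK : 0 ≤ K) (hX : WBound v X (K * t)) (hXp : WBound v (X ^ p) (t ^ p)) (n : ℕ) :
    WBound v (X ^ n) (max 1 K ^ p * t ^ n) := by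
  -- Division of n by p: full blocks of length p cost exactly t^p, and fewer than p leftover factors
  -- each cost at most K t.
  have h1 := (hXp.pow hv (pow_nonneg ht.le _) (n / p)).mul hv (by positivity)
    (hX.pow hv (by positivity) (n % p))
  rw [← pow_mul, ← pow_add, Nat.div_add_mod, ← pow_mul, mul_pow, ] at h1
  refine h1.mono hv ?_
  rw [mul_left_comm, ← pow_add, Nat.div_add_mod]
  refine mul_le_mul_of_nonneg_right ?_ (by positivity)
  calc K ^ (n % p) ≤ max 1 K ^ (n % p) := pow_le_pow_left₀ hK (le_max_right _ _) _
    _ ≤ max 1 K ^ p := pow_le_pow_right₀ (le_max_left _ _) (Nat.mod_lt _ hp).le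

end WBound

omit [DecidableEq ι] in
theorem Perron.wBound {M : Matrix ι ι ℝ} {l : ℝ} {v w : ι → ℝ} (h : Perron M l v w)
    (h0 : ∀ i j, 0 ≤ M i j) : WBound v M l :=
  WBound.of_le h.v_pos (fun i j => (Real.norm_of_nonneg (h0 i j)).le) h.mulVec_v

theorem Perron.pow_mulVec {M : Matrix ι ι ℝ} {l : ℝ} {v w : ι → ℝ} (h : Perron M l v w)
    (n : ℕ) : (M ^ n).mulVec v = l ^ n • v := by
  induction n with
  | zero => simp
  | succ n ih =>
    rw [pow_succ, ← Matrix.mulVec_mulVec, h.mulVec_v, Matrix.mulVec_smul, ih, smul_smul, pow_succ']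

/-- If `P` is idempotent and `M P = c P = P M`, then `M = c P + N` with `N` a complement. -/
theorem sub_smul_pow {𝕜 : Type*} [Field 𝕜] {M P : Matrix ι ι 𝕜} {c : 𝕜} (hP : P * P = P)
    (h1 : M * P = c • P) (h2 : P * M = c • P) {n : ℕ} (hn : 0 < n) :
    (M - c • P) ^ n = M ^ n - c ^ n • P := by
  have h3 : ∀ n, M ^ n * P = c ^ n • P := by
    intro n
    induction n with
    | zero => simp
    | succ n ih => rw [pow_succ, mul_assoc, h1, mul_smul_comm, ih, smul_smul, pow_succ']
  induction n, hn using Nat.le_induction with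
  | base => simp
  | succ n _ ih =>
    rw [pow_succ, ih, sub_mul, mul_sub, mul_sub, ← pow_succ, mul_smul_comm, h3, smul_mul_assoc,
      h2, smul_mul_assoc, mul_smul_comm, hP, smul_smul, smul_smul]
    rw [pow_succ c, mul_comm c (c ^ n)]
    abel

omit [DecidableEq ι] in
theorem Perron.proj_mul_proj {M : Matrix ι ι ℝ} {l : ℝ} {v w : ι → ℝ} (h : Perron M l v w) :
    Matrix.vecMulVec v w * Matrix.vecMulVec v w = Matrix.vecMulVec v w := by
  rw [Matrix.vecMulVec_mul_vecMulVec, h.dot]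
  simp

/-- Spectral gap: the part of `M` complementary to the Perron projection contracts. -/
theorem Perron.gap [Nonempty ι] {M : Matrix ι ι ℝ} {l : ℝ} {v w : ι → ℝ} (h : Perron M l v w)
    (hM : EventuallyPos M) :
    ∃ p > 0, WBound v ((M - l • Matrix.vecMulVec v w) ^ p) (l ^ p / 4) := by
  obtain ⟨s₀, hs⟩ := hM
  set P := Matrix.vecMulVec v w with hP
  have hPP : P * P = P := h.proj_mul_proj
  have hMP : M * P = l • P := by
    rw [hP, Matrix.mul_vecMulVec, h.mulVec_v, Matrix.smul_vecMulVec]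
  have hPM : P * M = l • P := by
    rw [hP, Matrix.vecMulVec_mul, h.vecMul_w, Matrix.vecMulVec_smul]
  set p := s₀ + 1 with hp
  have hpos := hs p (by omega)
  have hlp : 0 < l ^ p := pow_pos h.l_pos _
  have hPpos : ∀ i j, 0 < P i j := fun i j => mul_pos (h.v_pos i) (h.w_pos j)
  -- `ε` with `ε l^p P ≤ M^p`
  obtain ⟨ε, hε, hε1, hεle⟩ : ∃ ε : ℝ, 0 < ε ∧ ε < 1 ∧ ∀ i j, ε * l ^ p * P i j ≤ (M ^ p) i j := by
    obtain ⟨⟨i₀, j₀⟩, -, hm⟩ := Finset.exists_min_image Finset.univ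
      (fun q : ι × ι => (M ^ p) q.1 q.2 / (l ^ p * P q.1 q.2)) Finset.univ_nonempty
    set m := (M ^ p) i₀ j₀ / (l ^ p * P i₀ j₀) with hmdef
    have hmpos : 0 < m := div_pos (hpos _ _) (mul_pos hlp (hPpos _ _))
    refine ⟨min m (1 / 2), by positivity, (min_le_right _ _).trans_lt (by norm_num), ?_⟩
    intro i j
    have h1 := hm (i, j) (Finset.mem_univ _)
    rw [le_div_iff₀ (mul_pos hlp (hPpos _ _))] at h1
    calc min m (1 / 2) * l ^ p * P i j ≤ m * (l ^ p * P i j) := by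
          rw [mul_assoc]
          exact mul_le_mul_of_nonneg_right (min_le_left _ _) (mul_pos hlp (hPpos _ _)).le
      _ ≤ _ := h1
  -- Doeblin minorization: `Q` is still entrywise nonnegative and v is an eigenvector for (1 - ε)
  -- l^p, which is therefore a bound for its weighted norm.
  set Q := M ^ p - (ε * l ^ p) • P with hQ
  have hPv : P.mulVec v = v := by
    rw [hP, Matrix.vecMulVec_mulVec, h.dot]; simp
  have hQv : Q.mulVec v = ((1 - ε) * l ^ p) • v := by
    rw [hQ, Matrix.sub_mulVec, h.pow_mulVec, Matrix.smul_mulVec, hPv, ← sub_smul]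
    congr 1; ring
  have hQb : WBound v Q ((1 - ε) * l ^ p) := WBound.of_le h.v_pos (fun i j => by
    rw [Real.norm_of_nonneg]
    simpa [hQ] using hεle i j) hQv
  have hPb : WBound v P 1 := WBound.of_le h.v_pos (fun i j =>
    (Real.norm_of_nonneg (hPpos i j).le).le) (by rw [hPv, one_smul])
  have hIP : WBound v (1 - P) (1 + 1) := WBound.one.sub hPb h.v_pos
  -- The norm bound 2 for 1 - P turns 1/8 into the required 1/4.
  obtain ⟨k, hk⟩ := exists_pow_lt_of_lt_one (show (0 : ℝ) < 1 / 8 by norm_num)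
    (show 1 - ε < 1 by linarith)
  have hk0 : 0 < k := by
    rcases Nat.eq_zero_or_pos k with rfl | h
    · norm_num at hk
    · exact h
  have hMpP : M ^ p * P = l ^ p • P := by
    rw [hP, Matrix.mul_vecMulVec, h.pow_mulVec, Matrix.smul_vecMulVec]
  have hPMn : ∀ n, P * M ^ n = l ^ n • P := by
    intro n
    induction n with
    | zero => simp
    | succ n ih => rw [pow_succ, ← mul_assoc, ih, smul_mul_assoc, hPM, smul_smul, pow_succ]
  -- `Q` and M^p differ by a multiple of P, so their powers agree on the complement of P.
  have hQk : ∀ n, Q ^ n * (1 - P) = M ^ (p * n) - l ^ (p * n) • P := by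
    intro n
    induction n with
    | zero => simp
    | succ n ih =>
      rw [pow_succ', mul_assoc, ih, hQ, sub_mul, mul_sub, mul_sub, mul_smul_comm, hMpP,
        smul_mul_assoc, smul_mul_assoc, mul_smul_comm, hPP]
      rw [hPMn, sub_self, sub_zero, smul_smul, ← pow_add, ← pow_add]
      congr 2; ring
  refine ⟨p * k, by positivity, ?_⟩
  rw [sub_smul_pow hPP hMP hPM (by positivity), ← hQk]
  refine ((hQb.pow h.v_pos (mul_nonneg (by linarith) hlp.le) k).mul h.v_pos (by norm_num)
    hIP).mono h.v_pos ?_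
  rw [mul_pow, ← pow_mul]
  have : 0 < l ^ (p * k) := pow_pos h.l_pos _
  nlinarith

end

end RationalModel

/-! ### Simplicity of the Perron root and an analytic implicit function -/

namespace RationalModel

noncomputable section

variable {ι : Type} [Fintype ι] [DecidableEq ι]

section Analytic

variable {E : Type*} [NormedAddCommGroup E] [NormedSpace ℂ E] {X : E → Matrix ι ι ℂ} {x : E}

theorem analyticAt_det (h : ∀ i j, AnalyticAt ℂ (fun y => X y i j) x) :
    AnalyticAt ℂ (fun y => (X y).det) x := by
  simp_rw [Matrix.det_apply']
  exact Finset.analyticAt_fun_sum _ fun σ _ =>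
    analyticAt_const.mul (Finset.analyticAt_fun_prod _ fun i _ => h _ _)

theorem analyticAt_adjugate (h : ∀ i j, AnalyticAt ℂ (fun y => X y i j) x) (i j : ι) :
    AnalyticAt ℂ (fun y => (X y).adjugate i j) x := by
  simp_rw [Matrix.adjugate_apply]
  refine analyticAt_det fun k m => ?_
  by_cases hk : k = j
  · subst hk
    simp only [Matrix.updateRow_self]
    exact analyticAt_const
  · simp only [Matrix.updateRow_ne hk]
    exact h k m

omit [DecidableEq ι] in
theorem analyticAt_mulVec (h : ∀ i j, AnalyticAt ℂ (fun y => X y i j) x) (a : ι → ℂ) (i : ι) :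
    AnalyticAt ℂ (fun y => (X y).mulVec a i) x :=
  Finset.analyticAt_fun_sum _ fun j _ => (h i j).mul analyticAt_const

omit [DecidableEq ι] in
theorem analyticAt_vecMul (h : ∀ i j, AnalyticAt ℂ (fun y => X y i j) x) (a : ι → ℂ) (j : ι) :
    AnalyticAt ℂ (fun y => Matrix.vecMul a (X y) j) x :=
  Finset.analyticAt_fun_sum _ fun i _ => analyticAt_const.mul (h i j)

end Analytic

/-- The complex matrix with the same entries as a real matrix. -/
def toC (M : Matrix ι ι ℝ) : Matrix ι ι ℂ := M.map (algebraMap ℝ ℂ)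

/-- The complex vector with the same entries as a real vector. -/
def vecC (v : ι → ℝ) : ι → ℂ := fun i => (v i : ℂ)

omit [Fintype ι] [DecidableEq ι] in
@[simp] theorem toC_apply (M : Matrix ι ι ℝ) (i j : ι) : toC M i j = (M i j : ℂ) := rfl

omit [Fintype ι] [DecidableEq ι] in
@[simp] theorem vecC_apply (v : ι → ℝ) (i : ι) : vecC v i = (v i : ℂ) := rfl

theorem toC_pow (M : Matrix ι ι ℝ) (n : ℕ) : toC (M ^ n) = toC M ^ n :=
  map_pow (algebraMap ℝ ℂ).mapMatrix M n

omit [DecidableEq ι] in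
theorem WBound.toC {v : ι → ℝ} {X : Matrix ι ι ℝ} {t : ℝ} (h : WBound v X t) :
    WBound v (toC X) t := fun i => by simpa using h i

theorem det_one_sub_smul_vecMulVec (c : ℂ) (a b : ι → ℂ) :
    (1 - c • Matrix.vecMulVec a b).det = 1 - c * (b ⬝ᵥ a) := by
  have := Matrix.det_one_add_replicateCol_mul_replicateRow (ι := Unit) ((-c) • a) b
  rw [← Matrix.vecMulVec_eq, dotProduct_smul, Matrix.smul_vecMulVec] at this
  simpa [sub_eq_add_neg] using this

namespace Perron

variable {M : Matrix ι ι ℝ} {l : ℝ} {v w : ι → ℝ}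

omit [DecidableEq ι] in
theorem nonempty (h : Perron M l v w) : Nonempty ι := by
  by_contra hne
  rw [not_nonempty_iff] at hne
  have := h.dot
  simp [dotProduct] at this

omit [DecidableEq ι] in
theorem toC_mulVec (h : Perron M l v w) : (toC M).mulVec (vecC v) = (l : ℂ) • vecC v := by
  ext i
  have := congrFun h.mulVec_v i
  simp only [Matrix.mulVec, dotProduct, Pi.smul_apply, smul_eq_mul] at this
  simp only [Matrix.mulVec, dotProduct, Pi.smul_apply, smul_eq_mul, toC_apply, vecC_apply]
  exact_mod_cast congrArg (fun t : ℝ => (t : ℂ)) this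

omit [DecidableEq ι] in
theorem toC_vecMul (h : Perron M l v w) : Matrix.vecMul (vecC w) (toC M) = (l : ℂ) • vecC w := by
  ext i
  have := congrFun h.vecMul_w i
  simp only [Matrix.vecMul, dotProduct, Pi.smul_apply, smul_eq_mul] at this
  simp only [Matrix.vecMul, dotProduct, Pi.smul_apply, smul_eq_mul, toC_apply, vecC_apply]
  exact_mod_cast congrArg (fun t : ℝ => (t : ℂ)) this

omit [DecidableEq ι] in
theorem dotC (h : Perron M l v w) : vecC w ⬝ᵥ vecC v = 1 := by
  have := h.dot
  simp only [dotProduct, vecC_apply] at this ⊢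
  exact_mod_cast congrArg (fun t : ℝ => (t : ℂ)) this

omit [DecidableEq ι] in
theorem vecC_ne_zero (h : Perron M l v w) : vecC v ≠ 0 := by
  obtain ⟨i⟩ := h.nonempty
  intro h0
  have := congrFun h0 i
  simp only [vecC_apply, Pi.zero_apply, Complex.ofReal_eq_zero] at this
  exact (h.v_pos i).ne' this

/-- The Perron root is the spectral radius. -/
theorem spectralRadius_eq (h : Perron M l v w) (h0 : ∀ i j, 0 ≤ M i j) :
    (spectralRadius ℂ (toC M)).toReal = l := by
  have hiff : ∀ k : ℂ, k ∈ spectrum ℂ (toC M) ↔ ∃ x ≠ 0, (toC M).mulVec x = k • x := by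
    intro k
    rw [spectrum.mem_iff, Matrix.isUnit_iff_isUnit_det, isUnit_iff_ne_zero, not_not,
      ← Matrix.exists_mulVec_eq_zero_iff]
    refine exists_congr fun x => and_congr_right fun _ => ?_
    rw [Matrix.sub_mulVec, Algebra.algebraMap_eq_smul_one, Matrix.smul_mulVec, Matrix.one_mulVec,
      sub_eq_zero, eq_comm]
  have : spectralRadius ℂ (toC M) = ENNReal.ofReal l := by
    apply le_antisymm
    · refine iSup₂_le fun k hk => ?_
      obtain ⟨x, hx, hkx⟩ := (hiff k).1 hk
      have := (h.wBound h0).toC.eigenvalue_le h.v_pos hx hkx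
      rw [← enorm_eq_nnnorm, ← ofReal_norm]
      exact ENNReal.ofReal_le_ofReal this
    · have hl : (l : ℂ) ∈ spectrum ℂ (toC M) := (hiff _).2 ⟨vecC v, h.vecC_ne_zero, h.toC_mulVec⟩
      refine le_trans ?_ (le_iSup₂ (f := fun k (_ : k ∈ spectrum ℂ (toC M)) => (‖k‖₊ : ENNReal))
        (l : ℂ) hl)
      rw [← enorm_eq_nnnorm, ← ofReal_norm, Complex.norm_real,
        Real.norm_of_nonneg h.l_pos.le]
  rw [this, ENNReal.toReal_ofReal h.l_pos.le]

/-- The Perron root is a simple root of the characteristic polynomial, and the adjugate acts on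
the Perron vectors by the derivative of the characteristic polynomial. -/
theorem exists_simple (h : Perron M l v w) (hM : EventuallyPos M) :
    ∃ κ : ℂ, κ ≠ 0 ∧
      HasDerivAt (fun x : ℂ => (x • (1 : Matrix ι ι ℂ) - toC M).det) κ (l : ℂ) ∧
      ((l : ℂ) • (1 : Matrix ι ι ℂ) - toC M).adjugate.mulVec (vecC v) = κ • vecC v ∧
      Matrix.vecMul (vecC w) ((l : ℂ) • (1 : Matrix ι ι ℂ) - toC M).adjugate = κ • vecC w := by
  have := h.nonempty
  set P := Matrix.vecMulVec (vecC v) (vecC w) with hP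
  set N := toC M - (l : ℂ) • P with hN
  have hPP : P * P = P := by
    rw [hP, Matrix.vecMulVec_mul_vecMulVec, h.dotC]; simp
  have hNP : N * P = 0 := by
    rw [hN, sub_mul, smul_mul_assoc, hPP, hP, Matrix.mul_vecMulVec, h.toC_mulVec,
      Matrix.smul_vecMulVec, sub_self]
  have hl : (l : ℂ) ≠ 0 := by exact_mod_cast h.l_pos.ne'
  set q : ℂ → ℂ := fun x => (x • (1 : Matrix ι ι ℂ) - N).det with hq
  have hentry : ∀ (Y : Matrix ι ι ℂ) (x : ℂ) i j,
      AnalyticAt ℂ (fun x : ℂ => (x • (1 : Matrix ι ι ℂ) - Y) i j) x := by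
    intro Y x i j
    simp only [Matrix.sub_apply, Matrix.smul_apply, smul_eq_mul]
    fun_prop
  -- Since N P = 0, the matrix x - M factors as (x - N)(1 - (l/x) P), and the rank-one factor has
  -- determinant 1 - l/x.
  have hfac : ∀ x : ℂ, x ≠ 0 → (x • (1 : Matrix ι ι ℂ) - toC M).det = (x - l) * (q x / x) := by
    intro x hx
    have e : x • (1 : Matrix ι ι ℂ) - toC M = (x • (1 : Matrix ι ι ℂ) - N) * (1 - (l / x) • P) := by
      rw [sub_mul, mul_sub, mul_sub, mul_one, mul_one, mul_smul_comm, mul_smul_comm, hNP, smul_zero,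
        sub_zero, smul_mul_assoc, one_mul, smul_smul, div_mul_cancel₀ _ hx, hN]
      abel
    rw [e, Matrix.det_mul, hP, det_one_sub_smul_vecMulVec, h.dotC]
    field_simp
    exact mul_comm _ _
  have hNpow : ∀ n > 0, N ^ n = toC ((M - l • Matrix.vecMulVec v w) ^ n) := by
    intro n _
    rw [toC_pow]
    congr 1
    ext i j
    simp [hN, hP, Matrix.vecMulVec_apply]
  -- If l were an eigenvalue of `N`, then l^p would be an eigenvalue of N^p, whose weighted norm is
  -- at most l^p / 4.
  have hq0 : q l ≠ 0 := by
    intro h0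
    obtain ⟨x, hx, hx0⟩ := Matrix.exists_mulVec_eq_zero_iff.2 h0
    rw [Matrix.sub_mulVec, Matrix.smul_mulVec, Matrix.one_mulVec, sub_eq_zero] at hx0
    obtain ⟨p, hp, hb⟩ := h.gap hM
    have hpow : ∀ n, (N ^ n).mulVec x = (l : ℂ) ^ n • x := by
      intro n
      induction n with
      | zero => simp
      | succ n ih => rw [pow_succ, ← Matrix.mulVec_mulVec, ← hx0, Matrix.mulVec_smul, ih,
          smul_smul, pow_succ']
    have h1 := hb.toC.eigenvalue_le h.v_pos hx (by rw [← hNpow p hp]; exact hpow p)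
    rw [norm_pow, Complex.norm_real, Real.norm_of_nonneg h.l_pos.le] at h1
    have := pow_pos h.l_pos p
    linarith
  have hqd : DifferentiableAt ℂ q l := (analyticAt_det (hentry N l)).differentiableAt
  have hκ : HasDerivAt (fun x : ℂ => (x • (1 : Matrix ι ι ℂ) - toC M).det) (q l / l) (l : ℂ) := by
    have h1 : HasDerivAt (fun x : ℂ => (x - l) * (q x / x)) (q l / l) (l : ℂ) := by
      have h2 := ((hasDerivAt_id (l : ℂ)).sub_const (l : ℂ)).fun_mul
        ((hqd.fun_div differentiableAt_fun_id hl).hasDerivAt)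
      simpa using h2
    refine h1.congr_of_eventuallyEq ?_
    filter_upwards [eventually_ne_nhds hl] with x hx using hfac x hx
  -- Both sides of (x - l) G x = det · a vanish at l; comparing derivatives gives the value of the
  -- adjugate on a Perron vector at the singular point.
  have huniq : ∀ (a : ι → ℂ) (G : ℂ → ι → ℂ), (∀ i, DifferentiableAt ℂ (fun x => G x i) l) →
      (∀ x : ℂ, (x - l) • G x = (x • (1 : Matrix ι ι ℂ) - toC M).det • a) →
      G l = (q l / l) • a := by
    intro a G hG hGa
    ext i
    have h1 := ((hasDerivAt_id (l : ℂ)).sub_const (l : ℂ)).fun_mul (hG i).hasDerivAt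
    have h2 := hκ.mul_const (a i)
    have h3 : (fun x : ℂ => (x - l) * G x i)
        = fun x : ℂ => (x • (1 : Matrix ι ι ℂ) - toC M).det * a i := by
      ext x
      simpa using congrFun (hGa x) i
    have h1' : HasDerivAt (fun x : ℂ => (x - l) * G x i) (G l i) l := by simpa using h1
    rw [h3] at h1'
    simpa using h1'.unique h2
  have hadj : ∀ i j, AnalyticAt ℂ (fun x : ℂ => (x • (1 : Matrix ι ι ℂ) - toC M).adjugate i j) l :=
    analyticAt_adjugate (hentry (toC M) l)
  refine ⟨q l / l, div_ne_zero hq0 hl, hκ, ?_, ?_⟩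
  · refine huniq (vecC v) (fun x => (x • (1 : Matrix ι ι ℂ) - toC M).adjugate.mulVec (vecC v))
      (fun i => (analyticAt_mulVec hadj _ i).differentiableAt) fun x => ?_
    rw [← Matrix.mulVec_smul]
    have : (x - l) • vecC v = (x • (1 : Matrix ι ι ℂ) - toC M).mulVec (vecC v) := by
      rw [Matrix.sub_mulVec, h.toC_mulVec, Matrix.smul_mulVec, Matrix.one_mulVec, sub_smul]
    rw [this, Matrix.mulVec_mulVec, Matrix.adjugate_mul, Matrix.smul_mulVec, Matrix.one_mulVec]
  · refine huniq (vecC w) (fun x => Matrix.vecMul (vecC w)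
      (x • (1 : Matrix ι ι ℂ) - toC M).adjugate)
      (fun i => (analyticAt_vecMul hadj _ i).differentiableAt) fun x => ?_
    rw [← Matrix.smul_vecMul]
    have : (x - l) • vecC w = Matrix.vecMul (vecC w) (x • (1 : Matrix ι ι ℂ) - toC M) := by
      rw [Matrix.vecMul_sub, h.toC_vecMul, Matrix.vecMul_smul, Matrix.vecMul_one, sub_smul]
    rw [this, Matrix.vecMul_vecMul, Matrix.mul_adjugate, Matrix.vecMul_smul, Matrix.vecMul_one]

end Perron

/-- Analytic implicit function theorem for an equation `F (z, x) = 0` in two complex variables. -/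
theorem exists_analytic_branch {F : ℂ × ℂ → ℂ} {p : ℂ × ℂ} {κ : ℂ} (hF : AnalyticAt ℂ F p)
    (h0 : F p = 0) (hκ : κ ≠ 0) (hd : HasDerivAt (fun x => F (p.1, x)) κ p.2) :
    ∃ U : ℂ → ℂ, AnalyticAt ℂ U p.1 ∧ U p.1 = p.2 ∧ (∀ᶠ z in 𝓝 p.1, F (z, U z) = 0) ∧
      ∀ᶠ q in 𝓝 p, F q = 0 → q.2 = U q.1 := by
  set F' := fderiv ℂ F p with hF'
  have hFd : HasFDerivAt F F' p := hF.differentiableAt.hasFDerivAt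
  set a := F' (1, 0)
  have hκ' : F' (0, 1) = κ := by
    have h1 : HasDerivAt (fun x : ℂ => (p.1, x)) ((0 : ℂ), (1 : ℂ)) p.2 :=
      (hasDerivAt_const _ _).prodMk (hasDerivAt_id _)
    have h2 : HasDerivAt (F ∘ fun x : ℂ => (p.1, x)) (F' (0, 1)) p.2 :=
      HasFDerivAt.comp_hasDerivAt p.2 (f := fun x : ℂ => (p.1, x)) hFd h1
    exact h2.unique hd
  have hF'app : ∀ y : ℂ × ℂ, F' y = y.1 * a + y.2 * κ := by
    intro y
    have : y = y.1 • ((1 : ℂ), (0 : ℂ)) + y.2 • ((0 : ℂ), (1 : ℂ)) := by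
      ext <;> simp
    conv_lhs => rw [this]
    rw [map_add, map_smul, map_smul, hκ']
    simp [a]
  -- The derivative of `G` is triangular with diagonal 1, κ, hence invertible; the branch is the
  -- second coordinate of the local inverse at (z, 0).
  let G : ℂ × ℂ → ℂ × ℂ := fun y => (y.1, F y)
  let G' : (ℂ × ℂ) ≃L[ℂ] (ℂ × ℂ) := ContinuousLinearEquiv.equivOfInverse
    ((ContinuousLinearMap.fst ℂ ℂ ℂ).prod F')
    ((ContinuousLinearMap.fst ℂ ℂ ℂ).prod
      (κ⁻¹ • (ContinuousLinearMap.snd ℂ ℂ ℂ - a • ContinuousLinearMap.fst ℂ ℂ ℂ)))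
    (fun y => by
      ext
      · simp
      · simp [hF'app]; field_simp; ring)
    (fun y => by
      ext
      · simp
      · simp [hF'app]; field_simp; ring)
  have hG : ContDiffAt ℂ ⊤ G p := (analyticAt_fst.prod hF).contDiffAt
  have hGd : HasFDerivAt G (G' : (ℂ × ℂ) →L[ℂ] (ℂ × ℂ)) p :=
    (hasFDerivAt_fst (𝕜 := ℂ) (p := p)).prodMk hFd
  have hGs : HasStrictFDerivAt G (G' : (ℂ × ℂ) →L[ℂ] (ℂ × ℂ)) p :=
    hG.hasStrictFDerivAt' hGd (by simp)
  have hGp : G p = (p.1, 0) := by simp [G, h0]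
  set L := hG.localInverse hGd (by simp) with hL
  have hLa : AnalyticAt ℂ L (p.1, 0) := by
    rw [← hGp]
    exact (hG.to_localInverse hGd (by simp)).analyticAt
  have hLp : L (p.1, 0) = p := by
    rw [← hGp]
    exact hG.localInverse_apply_image hGd (by simp)
  have hi : AnalyticAt ℂ (fun z : ℂ => (z, (0 : ℂ))) p.1 := analyticAt_id.prod analyticAt_const
  refine ⟨fun z => (L (z, 0)).2, ?_, by simp [hLp], ?_, ?_⟩
  · exact analyticAt_snd.comp (AnalyticAt.fun_comp (f := fun z : ℂ => (z, (0 : ℂ))) hLa hi)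
  · have h1 : ∀ᶠ y in 𝓝 (p.1, (0 : ℂ)), G (L y) = y := by
      rw [← hGp]; exact hGs.eventually_right_inverse
    have h2 : Filter.Tendsto (fun z : ℂ => (z, (0 : ℂ))) (𝓝 p.1) (𝓝 (p.1, 0)) :=
      hi.continuousAt
    filter_upwards [h2.eventually h1] with z hz
    have e1 : (L (z, 0)).1 = z := congrArg Prod.fst hz
    have e2 : F (L (z, 0)) = 0 := congrArg Prod.snd hz
    have : (z, (L (z, 0)).2) = L (z, 0) := Prod.ext e1.symm rfl
    rw [this, e2]
  · filter_upwards [hGs.eventually_left_inverse] with y hy hy0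
    have : G y = (y.1, 0) := by simp [G, hy0]
    rw [this] at hy
    exact (congrArg Prod.snd hy).symm

end

end RationalModel

/-! ### The dominant eigenvalue near the origin and its projection -/

namespace RationalModel

noncomputable section

variable {ι : Type} [Fintype ι] [DecidableEq ι]

/-! ### Functions commuting with complex conjugation -/

/-- Iterated twice, this passes the conjugation symmetry of `u` to its first two derivatives, which
are therefore real at 0. -/
theorem conj_deriv_eventuallyEq {f : ℂ → ℂ}
    (h : ∀ᶠ z in 𝓝 (0 : ℂ), f z = starRingEnd ℂ (f (starRingEnd ℂ z))) :
    ∀ᶠ z in 𝓝 (0 : ℂ), deriv f z = starRingEnd ℂ (deriv f (starRingEnd ℂ z)) := by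
  filter_upwards [h.eventually_nhds] with z hz
  have : f =ᶠ[𝓝 z] (starRingEnd ℂ ∘ f ∘ starRingEnd ℂ) := hz
  rw [this.deriv_eq, deriv_conj_conj]
  rfl

theorem im_eq_zero_of_conj {f : ℂ → ℂ}
    (h : ∀ᶠ z in 𝓝 (0 : ℂ), f z = starRingEnd ℂ (f (starRingEnd ℂ z))) : (f 0).im = 0 := by
  have := h.self_of_nhds
  rw [map_zero] at this
  exact Complex.conj_eq_iff_im.1 this.symm

/-- Taylor expansion of order two at the origin, in exponential form. -/
theorem isBigO_sub_exp {f : ℂ → ℂ} (hf : AnalyticAt ℂ f 0) (h0 : f 0 = 1) :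
    (fun z => f z - Complex.exp (deriv f 0 * z
      + (iteratedDeriv 2 f 0 - deriv f 0 ^ 2) * z ^ 2 / 2)) =O[𝓝 0] fun z => z ^ 3 := by
  set b := deriv f 0 with hb
  -- The exponential has second derivative b² + c at 0, so this `c` makes f and the exponential
  -- agree to order two.
  set c := iteratedDeriv 2 f 0 - b ^ 2 with hc
  set e : ℂ → ℂ := fun z => Complex.exp (b * z + c * z ^ 2 / 2) with he
  have hed : ∀ z, HasDerivAt e (e z * (b + c * z)) z := by
    intro z
    have h1 : HasDerivAt (fun z : ℂ => b * z + c * z ^ 2 / 2) (b + c * z) z := by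
      have := ((hasDerivAt_id z).const_mul b).fun_add
        ((((hasDerivAt_id z).fun_pow 2).const_mul c).div_const 2)
      convert! this using 1
      simp; ring
    exact h1.cexp
  have hea : AnalyticAt ℂ e 0 := by
    simp only [he]; fun_prop
  have hde : deriv e = fun z => e z * (b + c * z) := by
    ext z; exact (hed z).deriv
  have he0 : e 0 = 1 := by simp [he]
  have hdde : deriv (deriv e) 0 = b ^ 2 + c := by
    rw [hde]
    have h2 : HasDerivAt (fun z : ℂ => b + c * z) c 0 := by
      simpa using ((hasDerivAt_id (0 : ℂ)).const_mul c).const_add b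
    have := ((hed 0).fun_mul h2).deriv
    rw [this, he0]; simp; ring
  have ha : AnalyticAt ℂ (fun z => f z - e z) 0 := hf.fun_sub hea
  have hd : deriv (fun z => f z - e z) =ᶠ[𝓝 0] fun z => deriv f z - deriv e z := by
    filter_upwards [hf.eventually_analyticAt, hea.eventually_analyticAt] with z h1 h2
    exact deriv_fun_sub h1.differentiableAt h2.differentiableAt
  have hord : (3 : ℕ) ≤ analyticOrderAt (fun z => f z - e z) 0 := by
    rw [natCast_le_analyticOrderAt_iff_iteratedDeriv_eq_zero ha]
    intro i hi
    interval_cases i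
    · simp [h0, he0]
    · rw [iteratedDeriv_one, hd.self_of_nhds, hde]
      simp [he0, hb]
    · rw [iteratedDeriv_succ, iteratedDeriv_one, hd.deriv_eq,
        deriv_fun_sub hf.deriv.differentiableAt hea.deriv.differentiableAt, hdde, hc,
        iteratedDeriv_succ, iteratedDeriv_one]
      ring
  obtain ⟨g, hg, hfg⟩ := (natCast_le_analyticOrderAt ha).1 hord
  have h1 : g =O[𝓝 0] fun _ => (1 : ℂ) := hg.continuousAt.isBigO_one ℂ
  have h2 := (Asymptotics.isBigO_refl (fun z : ℂ => z ^ 3) (𝓝 0)).mul h1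
  refine (h2.congr' ?_ ?_)
  · filter_upwards [hfg] with z hz
    rw [hz]; simp
  · exact Filter.Eventually.of_forall fun z => by simp

namespace LinearRep

variable (R : LinearRep ι)

/-- The matrix `A e^z + B`. -/
def Mz (z : ℂ) : Matrix ι ι ℂ := Complex.exp z • toC R.A + toC R.B

omit [Fintype ι] [DecidableEq ι] in
theorem Mz_zero : R.Mz 0 = toC R.M := by
  ext i j
  simp [Mz, M]

omit [Fintype ι] in
theorem sub_Mz (x z : ℂ) : x • (1 : Matrix ι ι ℂ) - Complex.exp z • R.A.map (algebraMap ℝ ℂ)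
    - R.B.map (algebraMap ℝ ℂ) = x • 1 - R.Mz z := by
  rw [Mz, toC, toC, sub_sub]

omit [Fintype ι] [DecidableEq ι] in
theorem M_nonneg (i j : ι) : 0 ≤ R.M i j := add_nonneg (R.A_nonneg i j) (R.B_nonneg i j)

omit [Fintype ι] [DecidableEq ι] in
theorem analyticAt_Mz (i j : ι) (z : ℂ) : AnalyticAt ℂ (fun z => R.Mz z i j) z := by
  simp only [Mz, Matrix.add_apply, Matrix.smul_apply, smul_eq_mul]
  fun_prop

variable {R} {l : ℝ} {v w : ι → ℝ}

theorem lam_eq (h : Perron R.M l v w) : R.lam = l := h.spectralRadius_eq R.M_nonneg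

/-- Simplicity of the Perron root is the nondegeneracy needed for the implicit function. The local
uniqueness clause identifies any other continuous branch through (0, l) with `U`, in particular the
chosen `u`. -/
theorem exists_branch (h : Perron R.M l v w) (hM : EventuallyPos R.M) :
    ∃ U : ℂ → ℂ, R.IsPerronBranch U ∧
      ∀ᶠ q in 𝓝 ((0 : ℂ), (l : ℂ)), (q.2 • (1 : Matrix ι ι ℂ) - R.Mz q.1).det = 0 →
        q.2 = U q.1 := by
  obtain ⟨κ, hκ, hd, -, -⟩ := h.exists_simple hM
  have hF : AnalyticAt ℂ (fun q : ℂ × ℂ => (q.2 • (1 : Matrix ι ι ℂ) - R.Mz q.1).det)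
      ((0 : ℂ), (l : ℂ)) := by
    refine analyticAt_det fun i j => ?_
    simp only [Matrix.sub_apply, Matrix.smul_apply, smul_eq_mul, Mz, Matrix.add_apply]
    exact (analyticAt_snd.fun_mul analyticAt_const).fun_sub
      ((analyticAt_fst.cexp.fun_mul analyticAt_const).fun_add analyticAt_const)
  have hF0 : ((l : ℂ) • (1 : Matrix ι ι ℂ) - R.Mz 0).det = 0 := by
    rw [← Matrix.exists_mulVec_eq_zero_iff]
    refine ⟨vecC v, h.vecC_ne_zero, ?_⟩
    rw [Matrix.sub_mulVec, Mz_zero, h.toC_mulVec, Matrix.smul_mulVec, Matrix.one_mulVec, sub_self]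
  obtain ⟨U, hU, hU0, hUF, huniq⟩ := exists_analytic_branch hF hF0 hκ (by
    simp only [Mz_zero]; exact hd)
  refine ⟨U, ⟨hU, by rw [hU0, lam_eq h], ?_⟩, huniq⟩
  filter_upwards [hUF] with z hz
  rw [sub_Mz]; exact hz

theorem isPerronBranch_u (h : Perron R.M l v w) (hM : EventuallyPos R.M) :
    R.IsPerronBranch R.u := by
  obtain ⟨U, hU, -⟩ := exists_branch h hM
  exact Classical.epsilon_spec (p := R.IsPerronBranch) ⟨U, hU⟩

theorem conj_det (x z : ℂ) : starRingEnd ℂ (x • (1 : Matrix ι ι ℂ) - R.Mz z).det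
    = (starRingEnd ℂ x • (1 : Matrix ι ι ℂ) - R.Mz (starRingEnd ℂ z)).det := by
  rw [RingHom.map_det]
  congr 1
  ext i j
  simp only [RingHom.mapMatrix_apply, Matrix.map_apply, Matrix.sub_apply, Matrix.smul_apply,
    smul_eq_mul, Mz, Matrix.add_apply, toC_apply, map_sub, map_mul, map_add, Complex.conj_ofReal,
    ← Complex.exp_conj]
  by_cases hij : i = j
  · subst hij; simp
  · simp [Matrix.one_apply_ne hij]

/-- A and B are real, so z ↦ conj (u (conj z)) is another root branch through l, and local
uniqueness applies. -/
theorem u_conj (h : Perron R.M l v w) (hM : EventuallyPos R.M) :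
    ∀ᶠ z in 𝓝 (0 : ℂ), R.u z = starRingEnd ℂ (R.u (starRingEnd ℂ z)) := by
  obtain ⟨U, -, huniq⟩ := exists_branch h hM
  obtain ⟨hu, hu0, hdet⟩ := isPerronBranch_u h hM
  rw [lam_eq h] at hu0
  have hc : Filter.Tendsto (starRingEnd ℂ) (𝓝 (0 : ℂ)) (𝓝 0) := by
    simpa using (Complex.continuous_conj.tendsto (0 : ℂ))
  have hut : Filter.Tendsto R.u (𝓝 0) (𝓝 (l : ℂ)) := by
    rw [← hu0]; exact hu.continuousAt
  have hut' : Filter.Tendsto (fun z => starRingEnd ℂ (R.u (starRingEnd ℂ z))) (𝓝 0)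
      (𝓝 (l : ℂ)) := by
    have := (Complex.continuous_conj.tendsto (l : ℂ)).comp (hut.comp hc)
    rwa [Complex.conj_ofReal] at this
  have h1 : Filter.Tendsto (fun z => (z, R.u z)) (𝓝 (0 : ℂ)) (𝓝 ((0 : ℂ), (l : ℂ))) :=
    Filter.tendsto_id.prodMk_nhds hut
  have h2 : Filter.Tendsto (fun z => (z, starRingEnd ℂ (R.u (starRingEnd ℂ z)))) (𝓝 (0 : ℂ))
      (𝓝 ((0 : ℂ), (l : ℂ))) := Filter.tendsto_id.prodMk_nhds hut'
  filter_upwards [h1.eventually huniq, h2.eventually huniq, hdet, hc.eventually hdet]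
    with z e1 e2 e3 e4
  rw [sub_Mz] at e3 e4
  rw [e1 e3]
  refine (e2 ?_).symm
  have := conj_det (R := R) (R.u (starRingEnd ℂ z)) (starRingEnd ℂ z)
  rw [e4, map_zero, Complex.conj_conj] at this
  exact this.symm

/-- The expansion of the dominant eigenvalue `u(z) / lam = exp (β z + γ z² / 2) + O(z³)`. -/
theorem u_expansion (h : Perron R.M l v w) (hM : EventuallyPos R.M) :
    (fun z => R.u z / l - Complex.exp (R.β * z + R.γ * z ^ 2 / 2)) =O[𝓝 0] fun z => z ^ 3 := by
  obtain ⟨hu, hu0, -⟩ := isPerronBranch_u h hM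
  have hl : (l : ℂ) ≠ 0 := by exact_mod_cast h.l_pos.ne'
  have hc1 := conj_deriv_eventuallyEq (u_conj h hM)
  have hc2 := conj_deriv_eventuallyEq hc1
  -- `β` and `γ` are defined as real parts; nothing is lost because the derivatives of `u` at 0 are
  -- real.
  have hβ : (R.β : ℂ) = deriv R.u 0 / l := by
    have h1 := im_eq_zero_of_conj hc1
    rw [β, lam_eq h]
    apply Complex.ext
    · simp
    · simp [Complex.div_ofReal_im, h1]
  have hγ : (R.γ : ℂ) = iteratedDeriv 2 R.u 0 / l - (deriv R.u 0 / l) ^ 2 := by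
    have h2 := im_eq_zero_of_conj hc2
    have e : iteratedDeriv 2 R.u 0 = deriv (deriv R.u) 0 := by
      rw [iteratedDeriv_succ, iteratedDeriv_one]
    rw [γ, lam_eq h, e, ← hβ]
    apply Complex.ext
    · simp
    · rw [Complex.ofReal_im, Complex.sub_im, Complex.div_ofReal_im, h2, ← Complex.ofReal_pow,
        Complex.ofReal_im]
      simp
  have h1 := isBigO_sub_exp (f := fun z => R.u z / l) (hu.div_const)
    (by simp only [hu0, lam_eq h, div_self hl])
  have e1 : deriv (fun z => R.u z / (l : ℂ)) = fun z => deriv R.u z / l := by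
    ext z; exact deriv_div_const _
  have e2 : iteratedDeriv 2 (fun z => R.u z / (l : ℂ)) 0 = iteratedDeriv 2 R.u 0 / l := by
    rw [iteratedDeriv_succ, iteratedDeriv_one, e1, iteratedDeriv_succ, iteratedDeriv_one]
    exact deriv_div_const _
  rw [e1, e2] at h1
  simpa only [hβ, hγ] using h1

/-- An analytic family of rank-one spectral projections of `A e^z + B` near `z = 0`. -/
theorem exists_projection (h : Perron R.M l v w) (hM : EventuallyPos R.M) :
    ∃ P : ℂ → Matrix ι ι ℂ, (∀ i j, AnalyticAt ℂ (fun z => P z i j) 0) ∧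
      P 0 = toC (Matrix.vecMulVec v w) ∧
      ∀ᶠ z in 𝓝 (0 : ℂ), P z * P z = P z ∧ R.Mz z * P z = R.u z • P z ∧
        P z * R.Mz z = R.u z • P z ∧ P z ≠ 0 := by
  obtain ⟨hu, hu0, hdet⟩ := isPerronBranch_u h hM
  rw [lam_eq h] at hu0
  obtain ⟨κ, hκ, -, hκv, hκw⟩ := h.exists_simple hM
  set D : ℂ → Matrix ι ι ℂ := fun z => R.u z • (1 : Matrix ι ι ℂ) - R.Mz z with hD
  have hDa : ∀ i j, AnalyticAt ℂ (fun z => D z i j) 0 := by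
    intro i j
    simp only [hD, Matrix.sub_apply, Matrix.smul_apply, smul_eq_mul]
    exact (hu.fun_mul analyticAt_const).fun_sub (R.analyticAt_Mz i j 0)
  have hJa := analyticAt_adjugate hDa
  -- Where det D = 0, the adjugate maps into the right kernel of D, and row vectors times it lie in
  -- the left kernel. Applied to the fixed Perron vectors it gives analytic eigenvectors, nonzero at
  -- 0 because κ ≠ 0.
  set x : ℂ → ι → ℂ := fun z => (D z).adjugate.mulVec (vecC v) with hx
  set y : ℂ → ι → ℂ := fun z => Matrix.vecMul (vecC w) (D z).adjugate with hy
  have hxa : ∀ i, AnalyticAt ℂ (fun z => x z i) 0 := analyticAt_mulVec hJa _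
  have hya : ∀ i, AnalyticAt ℂ (fun z => y z i) 0 := analyticAt_vecMul hJa _
  set s : ℂ → ℂ := fun z => y z ⬝ᵥ x z with hs
  have hsa : AnalyticAt ℂ s 0 :=
    Finset.analyticAt_fun_sum _ fun i _ => (hya i).fun_mul (hxa i)
  have hD0 : D 0 = (l : ℂ) • (1 : Matrix ι ι ℂ) - toC R.M := by
    simp only [hD, hu0, Mz_zero]
  have hx0 : x 0 = κ • vecC v := by simp only [hx, hD0]; exact hκv
  have hy0 : y 0 = κ • vecC w := by simp only [hy, hD0]; exact hκw
  have hs0 : s 0 = κ * κ := by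
    simp only [hs]
    rw [hx0, hy0, smul_dotProduct, dotProduct_smul, h.dotC]
    simp
  have hs0' : s 0 ≠ 0 := by rw [hs0]; exact mul_ne_zero hκ hκ
  refine ⟨fun z => (s z)⁻¹ • Matrix.vecMulVec (x z) (y z), fun i j => ?_, ?_, ?_⟩
  · simp only [Matrix.smul_apply, Matrix.vecMulVec_apply, smul_eq_mul]
    exact (hsa.fun_inv hs0').fun_mul ((hxa i).fun_mul (hya j))
  · ext i j
    simp only [hs0, hx0, hy0, Matrix.smul_apply, Matrix.vecMulVec_apply, smul_eq_mul,
      Pi.smul_apply, vecC_apply, toC_apply]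
    push_cast
    field_simp
  · filter_upwards [hdet, hsa.continuousAt.eventually_ne hs0'] with z hz hsz
    rw [sub_Mz] at hz
    change (D z).det = 0 at hz
    have hMx : (R.Mz z).mulVec (x z) = R.u z • x z := by
      have : (D z).mulVec (x z) = 0 := by
        simp only [hx]
        rw [Matrix.mulVec_mulVec, Matrix.mul_adjugate, hz, zero_smul, Matrix.zero_mulVec]
      simp only [hD, Matrix.sub_mulVec, Matrix.smul_mulVec, Matrix.one_mulVec] at this
      exact (sub_eq_zero.1 this).symm
    have hyM : Matrix.vecMul (y z) (R.Mz z) = R.u z • y z := by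
      have : Matrix.vecMul (y z) (D z) = 0 := by
        simp only [hy]
        rw [Matrix.vecMul_vecMul, Matrix.adjugate_mul, hz, zero_smul, Matrix.vecMul_zero]
      simp only [hD, Matrix.vecMul_sub, Matrix.vecMul_smul, Matrix.vecMul_one] at this
      exact (sub_eq_zero.1 this).symm
    have hsz' : y z ⬝ᵥ x z = s z := rfl
    refine ⟨?_, ?_, ?_, ?_⟩
    · rw [smul_mul_assoc, mul_smul_comm, Matrix.vecMulVec_mul_vecMulVec, hsz', smul_smul]
      ext i j
      simp only [Matrix.smul_apply, Matrix.vecMulVec_apply, Pi.smul_apply, smul_eq_mul]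
      field_simp
    · rw [mul_smul_comm, Matrix.mul_vecMulVec, hMx, Matrix.smul_vecMulVec, smul_comm]
    · rw [smul_mul_assoc, Matrix.vecMulVec_mul, hyM, Matrix.vecMulVec_smul, smul_comm]
    · intro h0
      have htr : ((s z)⁻¹ • Matrix.vecMulVec (x z) (y z)).trace = 1 := by
        rw [Matrix.trace_smul, Matrix.trace_vecMulVec, dotProduct_comm, hsz', smul_eq_mul,
          inv_mul_cancel₀ hsz]
      rw [h0, Matrix.trace_zero] at htr
      exact zero_ne_one htr

end LinearRep
end

end RationalModel

/-! ### Matrix powers near the origin -/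

namespace RationalModel

noncomputable section

variable {ι : Type} [Fintype ι] [DecidableEq ι]

namespace LinearRep

variable {R : LinearRep ι} {l : ℝ} {v w : ι → ℝ}

/-- Near `z = 0` the powers of `A e^z + B` are a rank-one term plus a geometrically small
remainder. -/
theorem exists_pow_expansion (h : Perron R.M l v w) (hM : EventuallyPos R.M) :
    ∃ P : ℂ → Matrix ι ι ℂ, (∀ i j, AnalyticAt ℂ (fun z => P z i j) 0) ∧
      P 0 = toC (Matrix.vecMulVec v w) ∧ ∃ C ρ : ℝ, 0 < ρ ∧ ρ < 1 ∧
      ∀ᶠ z in 𝓝 (0 : ℂ), R.Mz z * P z = R.u z • P z ∧ P z ≠ 0 ∧ ∀ n i j,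
        ‖(R.Mz z ^ n) i j / (l : ℂ) ^ n - (R.u z / l) ^ n * P z i j‖ ≤ C * ρ ^ n := by
  have hne := h.nonempty
  obtain ⟨P, hPa, hP0, hP⟩ := exists_projection h hM
  obtain ⟨hu, hu0, -⟩ := isPerronBranch_u h hM
  rw [lam_eq h] at hu0
  have hl := h.l_pos
  obtain ⟨p, hp, hgap⟩ := h.gap hM
  set N : ℂ → Matrix ι ι ℂ := fun z => R.Mz z - R.u z • P z with hN
  have hNa : ∀ i j, AnalyticAt ℂ (fun z => N z i j) 0 := by
    intro i j
    simp only [hN, Matrix.sub_apply, Matrix.smul_apply, smul_eq_mul]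
    exact (R.analyticAt_Mz i j 0).fun_sub (hu.fun_mul (hPa i j))
  have hNpow : ∀ n i j, AnalyticAt ℂ (fun z => (N z ^ n) i j) 0 := by
    intro n
    induction n with
    | zero => intro i j; simp only [pow_zero]; exact analyticAt_const
    | succ n ih =>
      intro i j
      simp only [pow_succ, Matrix.mul_apply]
      exact Finset.analyticAt_fun_sum _ fun k _ => (ih i k).fun_mul (hNa k j)
  have hN0 : N 0 = toC (R.M - l • Matrix.vecMulVec v w) := by
    ext i j
    simp [hN, hu0, hP0, Mz_zero, Matrix.vecMulVec_apply]
  -- A strict bound on one fixed power persists near 0. It is used only for the powers 1 and p, so a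
  -- single neighbourhood serves all n.
  have hbd : ∀ n : ℕ, ∀ s t : ℝ, s < t → WBound v (N 0 ^ n) s →
      ∀ᶠ z in 𝓝 (0 : ℂ), WBound v (N z ^ n) t := by
    intro n s t hst hs
    unfold WBound
    rw [Filter.eventually_all]
    intro i
    have hcont : ContinuousAt (fun z => ∑ j, ‖(N z ^ n) i j‖ * v j) 0 :=
      tendsto_finsetSum _ fun j _ => ((hNpow n i j).continuousAt.norm).mul continuousAt_const
    have hlt : ∑ j, ‖(N 0 ^ n) i j‖ * v j < t * v i :=
      (hs i).trans_lt (mul_lt_mul_of_pos_right hst (h.v_pos i))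
    filter_upwards [hcont.eventually_lt_const hlt] with z hz using hz.le
  have hlp : 0 < l ^ p := pow_pos hl p
  have e1 := hbd p (l ^ p / 4) (l ^ p / 2) (by linarith) (by
    rw [hN0, ← toC_pow]; exact hgap.toC)
  obtain ⟨K₀, hK₀⟩ : ∃ K₀, WBound v (N 0 ^ 1) K₀ := by
    refine ⟨∑ i, (∑ j, ‖(N 0 ^ 1) i j‖ * v j) / v i, fun i => ?_⟩
    rw [← div_le_iff₀ (h.v_pos i)]
    exact Finset.single_le_sum (f := fun i => (∑ j, ‖(N 0 ^ 1) i j‖ * v j) / v i)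
      (fun k _ => div_nonneg (Finset.sum_nonneg fun j _ =>
        mul_nonneg (norm_nonneg _) (h.v_pos j).le) (h.v_pos k).le) (Finset.mem_univ i)
  have hK₀0 := hK₀.nonneg h.v_pos
  have e2 := hbd 1 K₀ (K₀ + 1) (by linarith) hK₀
  -- Chosen so that (l ρ)^p = l^p / 2, the bound that `e1` gives for N^p.
  set ρ : ℝ := (1 / 2 : ℝ) ^ ((p : ℝ)⁻¹) with hρ
  have hρp : ρ ^ p = 1 / 2 := Real.rpow_inv_natCast_pow (by norm_num) hp.ne'
  have hρ0 : 0 < ρ := by positivity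
  have hρ1 : ρ < 1 := by
    by_contra! hge
    have := one_le_pow₀ hge (n := p)
    rw [hρp] at this
    norm_num at this
  set K := (K₀ + 1) / (l * ρ) with hK
  set D := max 1 K ^ p with hD
  set V := ∑ i, ∑ j, v i / v j with hV
  have hVle : ∀ i j, v i / v j ≤ V := fun i j =>
    (Finset.single_le_sum (f := fun j => v i / v j)
      (fun k _ => (div_pos (h.v_pos i) (h.v_pos k)).le) (Finset.mem_univ j)).trans
    (Finset.single_le_sum (f := fun i => ∑ j, v i / v j)
      (fun k _ => Finset.sum_nonneg fun j _ => (div_pos (h.v_pos k) (h.v_pos j)).le)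
      (Finset.mem_univ i))
  have hD0 : 0 ≤ D := by positivity
  have hPbd : ∀ i j, ∀ᶠ z in 𝓝 (0 : ℂ), ‖P z i j‖ < ‖P 0 i j‖ + 1 := fun i j =>
    (hPa i j).continuousAt.norm.eventually_lt_const (by linarith)
  have hPbd' : ∀ᶠ z in 𝓝 (0 : ℂ), ∀ i j, ‖P z i j‖ < ‖P 0 i j‖ + 1 := by
    rw [Filter.eventually_all]; intro i
    rw [Filter.eventually_all]; exact hPbd i
  set B := ∑ i, ∑ j, (‖P 0 i j‖ + 1) with hB
  have hBle : ∀ i j, ‖P 0 i j‖ + 1 ≤ B := fun i j =>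
    (Finset.single_le_sum (f := fun j => ‖P 0 i j‖ + 1)
      (fun k _ => by positivity) (Finset.mem_univ j)).trans
    (Finset.single_le_sum (f := fun i => ∑ j, (‖P 0 i j‖ + 1))
      (fun k _ => by positivity) (Finset.mem_univ i))
  refine ⟨P, hPa, hP0, D * V + (1 + B), ρ, hρ0, hρ1, ?_⟩
  filter_upwards [hP, e1, e2, hPbd'] with z ⟨hz1, hz2, hz3, hz4⟩ hzp hzK hzB
  refine ⟨hz2, hz4, fun n i j => ?_⟩
  have hB0 : 0 ≤ B := le_trans (by positivity) (hBle i j)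
  have hV0 : 0 ≤ V := (div_pos (h.v_pos i) (h.v_pos j)).le.trans (hVle i j)
  -- At n = 0 the identity (M - u P)^n = M^n - u^n P is not available; the summand 1 + B of the
  -- constant covers this case.
  rcases Nat.eq_zero_or_pos n with rfl | hn
  · simp only [pow_zero, div_one, one_mul, mul_one]
    have h1 : ‖(1 : Matrix ι ι ℂ) i j‖ ≤ 1 := by
      by_cases hij : i = j
      · subst hij; simp
      · simp [Matrix.one_apply_ne hij]
    have h2 := (hzB i j).le.trans (hBle i j)
    have := norm_sub_le ((1 : Matrix ι ι ℂ) i j) (P z i j)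
    have := mul_nonneg hD0 hV0
    linarith
  · have hsub := sub_smul_pow hz1 hz2 hz3 hn
    have hw : WBound v (N z ^ n) (D * (l * ρ) ^ n) := by
      refine WBound.pow_le_of_pow h.v_pos hp (by positivity) (by positivity) ?_ ?_ n
      · rw [hK, div_mul_cancel₀ _ (by positivity)]
        rw [pow_one] at hzK
        exact hzK
      · rw [mul_pow, hρp]
        convert! hzp using 1
        ring
    have hij := hw.apply_le h.v_pos i j
    rw [hsub] at hij
    have hl' : (l : ℂ) ≠ 0 := by exact_mod_cast hl.ne'
    have e : (R.Mz z ^ n) i j / (l : ℂ) ^ n - (R.u z / l) ^ n * P z i j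
        = (R.Mz z ^ n - R.u z ^ n • P z) i j / (l : ℂ) ^ n := by
      simp only [Matrix.sub_apply, Matrix.smul_apply, smul_eq_mul, div_pow]
      field_simp
    rw [e, norm_div, norm_pow, Complex.norm_real, Real.norm_of_nonneg hl.le,
      div_le_iff₀ (pow_pos hl n)]
    calc _ ≤ D * (l * ρ) ^ n * (v i / v j) := hij
      _ ≤ D * (l * ρ) ^ n * V := mul_le_mul_of_nonneg_left (hVle i j) (by positivity)
      _ = (D * V) * ρ ^ n * l ^ n := by rw [mul_pow]; ring
      _ ≤ _ := by
        have : 0 ≤ (1 + B) * ρ ^ n * l ^ n := by positivity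
        linarith

end LinearRep
end

end RationalModel

/-! ### Polynomials with nonnegative coefficients, with a variable marking `a` -/

namespace RationalModel

noncomputable section

variable {ι : Type} [Fintype ι] [DecidableEq ι]

theorem exists_pos_le_of_finite {α : Type*} [Finite α] (f : α → ℝ) (hf : ∀ a, 0 < f a) :
    ∃ c > 0, ∀ a, c ≤ f a := by
  rcases isEmpty_or_nonempty α with he | hne
  · exact ⟨1, one_pos, fun a => he.elim a⟩
  · obtain ⟨a, ha⟩ := Finite.exists_min f
    exact ⟨f a, hf a, ha⟩

section Poly

open Polynomial

/-- All coefficients of `p` are nonnegative. -/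
def CoeffNonneg (p : ℝ[X]) : Prop := ∀ k, 0 ≤ p.coeff k

theorem CoeffNonneg.mul {p q : ℝ[X]} (hp : CoeffNonneg p) (hq : CoeffNonneg q) :
    CoeffNonneg (p * q) := fun k => by
  rw [coeff_mul]
  exact Finset.sum_nonneg fun x _ => mul_nonneg (hp _) (hq _)

theorem CoeffNonneg.sum {α : Type*} {s : Finset α} {f : α → ℝ[X]}
    (h : ∀ a ∈ s, CoeffNonneg (f a)) : CoeffNonneg (∑ a ∈ s, f a) := fun k => by
  rw [finsetSum_coeff]
  exact Finset.sum_nonneg fun a ha => h a ha k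

theorem CoeffNonneg.coeff_mul_pos {p q : ℝ[X]} (hp : CoeffNonneg p) (hq : CoeffNonneg q) {a b : ℕ}
    (ha : 0 < p.coeff a) (hb : 0 < q.coeff b) : 0 < (p * q).coeff (a + b) := by
  rw [coeff_mul]
  exact Finset.sum_pos' (fun x _ => mul_nonneg (hp _) (hq _))
    ⟨(a, b), by simp, mul_pos ha hb⟩

theorem CoeffNonneg.norm_eval₂_le {p : ℝ[X]} (hp : CoeffNonneg p) {t : ℂ} (ht : ‖t‖ = 1) :
    ‖p.eval₂ (algebraMap ℝ ℂ) t‖ ≤ p.eval 1 := by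
  rw [eval₂_eq_sum_range, eval_eq_sum_range]
  refine (norm_sum_le _ _).trans (Finset.sum_le_sum fun k _ => ?_)
  simp [ht, abs_of_nonneg (hp k)]

/-- Two positive coefficients of a polynomial with nonnegative coefficients force a strict
inequality on the unit circle. -/
theorem CoeffNonneg.norm_eval₂_lt {p : ℝ[X]} (hp : CoeffNonneg p) {a b : ℕ}
    (ha : 0 < p.coeff a) (hb : 0 < p.coeff b) :
    ∃ c > 0, ∀ t : ℂ, ‖t‖ = 1 →
      ‖p.eval₂ (algebraMap ℝ ℂ) t‖ ≤ p.eval 1 - c * ‖t ^ a - t ^ b‖ ^ 2 := by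
  by_cases hab : a = b
  · refine ⟨1, one_pos, fun t ht => ?_⟩
    simpa [hab] using hp.norm_eval₂_le ht
  set m := min (p.coeff a) (p.coeff b) with hm
  have hm0 : 0 < m := lt_min ha hb
  -- The two monomials are removed with the smaller of their coefficients, so the remainder keeps
  -- nonnegative coefficients.
  set q := p - (C m * X ^ a + C m * X ^ b) with hq
  have hqn : CoeffNonneg q := fun k => by
    simp only [hq, coeff_sub, coeff_add, coeff_C_mul, coeff_X_pow]
    by_cases h1 : k = a
    · subst h1
      simp only [if_true, if_neg hab]
      have := min_le_left (p.coeff k) (p.coeff b)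
      linarith
    · by_cases h2 : k = b
      · subst h2
        simp only [if_true, if_neg h1]
        have := min_le_right (p.coeff a) (p.coeff k)
        linarith
      · simpa [h1, h2] using hp k
  have hpq : p = q + (C m * X ^ a + C m * X ^ b) := by rw [hq]; ring
  refine ⟨m / 4, by positivity, fun t ht => ?_⟩
  -- With s the left side and d = ‖t^a - t^b‖, the parallelogram law gives s² = 4 - d², and 4s ≤ 4 +
  -- s². This is the source of the constant m / 4.
  have hpar : ‖t ^ a + t ^ b‖ ≤ 2 - ‖t ^ a - t ^ b‖ ^ 2 / 4 := by
    have h1 := parallelogram_law_with_norm ℝ (t ^ a) (t ^ b)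
    simp only [norm_pow, ht, one_pow] at h1
    have h0 := norm_nonneg (t ^ a + t ^ b)
    nlinarith [sq_nonneg (2 - ‖t ^ a + t ^ b‖)]
  have h1 := hqn.norm_eval₂_le ht
  have e1 : p.eval₂ (algebraMap ℝ ℂ) t = q.eval₂ (algebraMap ℝ ℂ) t + (m : ℂ) * (t ^ a + t ^ b) := by
    conv_lhs => rw [hpq]
    simp [eval₂_add]
    ring
  have e2 : p.eval 1 = q.eval 1 + 2 * m := by
    conv_lhs => rw [hpq]
    simp
    ring
  rw [e1, e2]
  refine (norm_add_le _ _).trans ?_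
  rw [norm_mul, Complex.norm_real, Real.norm_of_nonneg hm0.le]
  nlinarith

end Poly

namespace LinearRep

open Polynomial

/-- The matrix `A X + B` with polynomial entries, `X` marking the letter `a`. -/
def polyM (R : LinearRep ι) : Matrix ι ι ℝ[X] := fun i j => C (R.A i j) * X + C (R.B i j)

variable {R : LinearRep ι}

theorem polyM_coeffNonneg (n : ℕ) (i j : ι) : CoeffNonneg ((R.polyM ^ n) i j) := by
  induction n generalizing i j with
  | zero =>
    intro k
    by_cases hij : i = j
    · subst hij
      simp only [pow_zero, Matrix.one_apply_eq, coeff_one]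
      split_ifs <;> norm_num
    · simp [Matrix.one_apply_ne hij]
  | succ n ih =>
    rw [pow_succ, Matrix.mul_apply]
    refine CoeffNonneg.sum fun k _ => (ih i k).mul fun m => ?_
    simp only [polyM, coeff_add, coeff_C_mul, coeff_X, coeff_C]
    have := R.A_nonneg k j
    have := R.B_nonneg k j
    split_ifs <;> simp <;> linarith

theorem polyM_pow_map {S : Type*} [CommRing S] (f : ℝ[X] →+* S) (n : ℕ) (i j : ι) :
    f ((R.polyM ^ n) i j) = ((R.polyM.map f) ^ n) i j := by
  have : f.mapMatrix (R.polyM ^ n) = f.mapMatrix R.polyM ^ n := map_pow _ _ _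
  exact congrFun (congrFun this i) j

theorem polyM_eval_one (n : ℕ) (i j : ι) : ((R.polyM ^ n) i j).eval 1 = (R.M ^ n) i j := by
  have h := polyM_pow_map (R := R) (evalRingHom (1 : ℝ)) n i j
  have e : R.polyM.map (evalRingHom (1 : ℝ)) = R.M := by
    ext i j; simp [polyM, M]
  rw [e] at h
  exact h

theorem polyM_eval₂ (n : ℕ) (i j : ι) (z : ℂ) :
    ((R.polyM ^ n) i j).eval₂ (algebraMap ℝ ℂ) (Complex.exp z) = (R.Mz z ^ n) i j := by
  have h := polyM_pow_map (R := R) (eval₂RingHom (algebraMap ℝ ℂ) (Complex.exp z)) n i j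
  have e : R.polyM.map (eval₂RingHom (algebraMap ℝ ℂ) (Complex.exp z)) = R.Mz z := by
    ext i j; simp [polyM, Mz]; ring
  rw [e] at h
  exact h

theorem polyM_coeff_pos_add {m n a b : ℕ} {i j k : ι} (h₁ : 0 < ((R.polyM ^ m) i j).coeff a)
    (h₂ : 0 < ((R.polyM ^ n) j k).coeff b) : 0 < ((R.polyM ^ (m + n)) i k).coeff (a + b) := by
  rw [pow_add, Matrix.mul_apply, finsetSum_coeff]
  exact Finset.sum_pos' (fun x _ => ((polyM_coeffNonneg m i x).mul (polyM_coeffNonneg n x k)) _)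
    ⟨j, Finset.mem_univ j,
      (polyM_coeffNonneg m i j).coeff_mul_pos (polyM_coeffNonneg n j k) h₁ h₂⟩

/-- A labelled path contributes a positive monomial, and nonnegativity excludes cancellation; this
carries the graph condition over to polynomials. -/
theorem IsPath.polyM_coeff_pos {i j : ι} {x : List Letter} (h : R.IsPath i x j) :
    0 < ((R.polyM ^ x.length) i j).coeff (x.count Letter.a) := by
  induction h with
  | nil i => simp
  | @cons i j k x y hx _ ih =>
    have h1 : 0 < ((R.polyM ^ 1) i j).coeff ([x].count Letter.a) := by
      cases x
      · simpa [polyM, coeff_C] using (show 0 < R.A i j from hx)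
      · simpa [polyM, coeff_X] using (show 0 < R.B i j from hx)
    have := polyM_coeff_pos_add h1 ih
    rwa [← List.count_append, add_comm 1] at this

theorem exists_polyM_coeff_pos {n : ℕ} {i j : ι} (h : 0 < (R.M ^ n) i j) :
    ∃ k, 0 < ((R.polyM ^ n) i j).coeff k := by
  by_contra! hk
  rw [← polyM_eval_one, eval_eq_sum_range] at h
  have : ∑ k ∈ Finset.range (((R.polyM ^ n) i j).natDegree + 1),
      ((R.polyM ^ n) i j).coeff k * 1 ^ k ≤ 0 :=
    Finset.sum_nonpos fun k _ => by simpa using hk k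
  linarith

end LinearRep
end

end RationalModel

/-! ### Aperiodicity of the pair and Gaussian decay -/

namespace RationalModel

noncomputable section

variable {ι : Type} [Fintype ι] [DecidableEq ι]

/-- The character `θ ↦ exp (i θ d)`. -/
def chr (θ : ℝ) (d : ℤ) : ℂ := Complex.exp (θ * Complex.I * d)

theorem chr_add (θ : ℝ) (d e : ℤ) : chr θ (d + e) = chr θ d * chr θ e := by
  rw [chr, chr, chr, ← Complex.exp_add]; push_cast; ring_nf

theorem norm_chr (θ : ℝ) (d : ℤ) : ‖chr θ d‖ = 1 := by
  rw [chr, show (θ : ℂ) * Complex.I * d = ((θ * d : ℝ) : ℂ) * Complex.I by push_cast; ring]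
  exact Complex.norm_exp_ofReal_mul_I _

theorem chr_natCast (θ : ℝ) (n : ℕ) : chr θ n = Complex.exp (θ * Complex.I) ^ n := by
  rw [chr, ← Complex.exp_nat_mul]; push_cast; ring_nf

/-- Jordan's inequality for the half angle; it makes the loss at frequency 1 at least quadratic on
the whole period. -/
theorem norm_chr_one_sub_one {θ : ℝ} (hθ : |θ| ≤ Real.pi) :
    2 / Real.pi * |θ| ≤ ‖chr θ 1 - 1‖ := by
  have h1 : ‖chr θ 1 - 1‖ = 2 * |Real.sin (θ / 2)| := by
    have := Complex.norm_exp_I_mul_ofReal_sub_one θ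
    rw [chr, Int.cast_one, mul_one, mul_comm, this, Real.norm_eq_abs, abs_mul, abs_two]
  rw [h1]
  have h2 := Real.mul_le_sin (x := |θ| / 2) (by positivity) (by linarith)
  have h3 : Real.sin (|θ| / 2) ≤ |Real.sin (θ / 2)| := by
    rcases abs_cases θ with ⟨h, -⟩ | ⟨h, -⟩
    · rw [h]; exact le_abs_self _
    · rw [h, neg_div, Real.sin_neg]; exact neg_le_abs _
  calc 2 / Real.pi * |θ| = 2 * (2 / Real.pi * (|θ| / 2)) := by ring
    _ ≤ _ := by linarith

namespace LinearRep

variable {R : LinearRep ι} {l : ℝ} {v w : ι → ℝ}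

variable (R) in
/-- The entries of large powers of `A e^{iθ} + B` detect the frequency `d`. -/
def Detects (d : ℤ) : Prop :=
  ∃ p₀ : ℕ, ∀ p ≥ p₀, ∃ c > 0, ∀ (i j : ι) (θ : ℝ),
    ‖(R.Mz (θ * Complex.I) ^ p) i j‖ ≤ (R.M ^ p) i j - c * ‖chr θ d - 1‖ ^ 2

theorem norm_exp_mul_I (θ : ℝ) : ‖Complex.exp (θ * Complex.I)‖ = 1 :=
  Complex.norm_exp_ofReal_mul_I θ

theorem norm_Mz_pow_le (p : ℕ) (i j : ι) (θ : ℝ) :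
    ‖(R.Mz (θ * Complex.I) ^ p) i j‖ ≤ (R.M ^ p) i j := by
  rw [← polyM_eval₂, ← polyM_eval_one]
  exact (polyM_coeffNonneg p i j).norm_eval₂_le (norm_exp_mul_I θ)

/-- The subgroup of detected frequencies. -/
def detected (R : LinearRep ι) : AddSubgroup ℤ where
  carrier := {d | R.Detects d}
  zero_mem' := ⟨0, fun p _ => ⟨1, one_pos, fun i j θ => by
    simpa [chr] using norm_Mz_pow_le p i j θ⟩⟩
  neg_mem' := by
    rintro d ⟨p₀, h⟩
    refine ⟨p₀, fun p hp => ?_⟩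
    obtain ⟨c, hc, h⟩ := h p hp
    refine ⟨c, hc, fun i j θ => ?_⟩
    have : ‖chr θ (-d) - 1‖ = ‖chr θ d - 1‖ := by
      have h1 : chr θ (-d) * (chr θ d - 1) = 1 - chr θ (-d) := by
        rw [mul_sub, ← chr_add]; simp [chr]
      have h2 := congrArg norm h1
      rw [norm_mul, norm_chr, one_mul, norm_sub_rev 1] at h2
      exact h2.symm
    rw [this]
    exact h i j θ
  add_mem' := by
    rintro d e ⟨p₁, h₁⟩ ⟨p₂, h₂⟩
    refine ⟨max p₁ p₂, fun p hp => ?_⟩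
    obtain ⟨c₁, hc₁, h₁⟩ := h₁ p (le_trans (le_max_left _ _) hp)
    obtain ⟨c₂, hc₂, h₂⟩ := h₂ p (le_trans (le_max_right _ _) hp)
    -- One half comes from averaging the two bounds, the other from (x + y)² ≤ 2(x² + y²).
    refine ⟨min c₁ c₂ / 4, by positivity, fun i j θ => ?_⟩
    have h1 := h₁ i j θ
    have h2 := h₂ i j θ
    have h3 : ‖chr θ (d + e) - 1‖ ≤ ‖chr θ e - 1‖ + ‖chr θ d - 1‖ := by
      have : chr θ (d + e) - 1 = chr θ d * (chr θ e - 1) + (chr θ d - 1) := by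
        rw [chr_add]; ring
      rw [this]
      refine (norm_add_le _ _).trans ?_
      rw [norm_mul, norm_chr, one_mul]
    have h4 := norm_nonneg (chr θ (d + e) - 1)
    set x := ‖chr θ d - 1‖
    set y := ‖chr θ e - 1‖
    set z := ‖chr θ (d + e) - 1‖
    have h5 : z ^ 2 ≤ 2 * (x ^ 2 + y ^ 2) := by nlinarith [sq_nonneg (x - y)]
    have h6 : min c₁ c₂ * x ^ 2 ≤ c₁ * x ^ 2 :=
      mul_le_mul_of_nonneg_right (min_le_left _ _) (sq_nonneg _)
    have h7 : min c₁ c₂ * y ^ 2 ≤ c₂ * y ^ 2 :=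
      mul_le_mul_of_nonneg_right (min_le_right _ _) (sq_nonneg _)
    have hm : 0 < min c₁ c₂ := lt_min hc₁ hc₂
    have h8 : min c₁ c₂ / 4 * z ^ 2 ≤ min c₁ c₂ / 4 * (2 * (x ^ 2 + y ^ 2)) :=
      mul_le_mul_of_nonneg_left h5 (by positivity)
    linarith

/-- Differences of the numbers of `a` in labels of equally long cycles are detected. -/
theorem detects_of_isCycleLabel (hM : EventuallyPos R.M) {x y : List Letter}
    (hx : R.IsCycleLabel x) (hy : R.IsCycleLabel y) (hxy : x.length = y.length) :
    R.Detects ((x.count Letter.a : ℤ) - (y.count Letter.a : ℤ)) := by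
  obtain ⟨s₀, hs₀⟩ := hM
  obtain ⟨-, i₁, hx⟩ := hx
  obtain ⟨-, i₂, hy⟩ := hy
  have hx := hx.polyM_coeff_pos
  have hy := hy.polyM_coeff_pos
  refine ⟨s₀ + x.length + s₀ + s₀, fun p hp => ?_⟩
  have key : ∀ q : ι × ι, ∃ c > 0, ∀ θ : ℝ, ‖(R.Mz (θ * Complex.I) ^ p) q.1 q.2‖
      ≤ (R.M ^ p) q.1 q.2
        - c * ‖chr θ ((x.count Letter.a : ℤ) - (y.count Letter.a : ℤ)) - 1‖ ^ 2 := by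
    rintro ⟨i, j⟩
    -- Two walks i → i₁ → i₂ → j share all connecting pieces; one inserts the cycle x at i₁, the
    -- other the cycle y at i₂. They have the same length p, and their exponents differ exactly by
    -- the difference of the counts in x and y.
    obtain ⟨k₁, hk₁⟩ := exists_polyM_coeff_pos (hs₀ s₀ le_rfl i i₁)
    obtain ⟨k₂, hk₂⟩ := exists_polyM_coeff_pos (hs₀ s₀ le_rfl i₁ i₂)
    obtain ⟨k₃, hk₃⟩ := exists_polyM_coeff_pos
      (hs₀ (p - (s₀ + x.length + s₀)) (by omega) i₂ j)
    have h1 := polyM_coeff_pos_add (polyM_coeff_pos_add (polyM_coeff_pos_add hk₁ hx) hk₂) hk₃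
    have h2 := polyM_coeff_pos_add (polyM_coeff_pos_add (polyM_coeff_pos_add hk₁ hk₂) hy) hk₃
    rw [show s₀ + x.length + s₀ + (p - (s₀ + x.length + s₀)) = p by omega] at h1
    rw [show s₀ + s₀ + y.length + (p - (s₀ + x.length + s₀)) = p by omega] at h2
    obtain ⟨c, hc, h⟩ := (polyM_coeffNonneg p i j).norm_eval₂_lt h1 h2
    refine ⟨c, hc, fun θ => ?_⟩
    have := h _ (norm_exp_mul_I θ)
    rw [polyM_eval₂, polyM_eval_one, ← chr_natCast, ← chr_natCast] at this
    have e : chr θ (k₁ + x.count Letter.a + k₂ + k₃ : ℕ) - chr θ (k₁ + k₂ + y.count Letter.a + k₃ : ℕ)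
        = chr θ (k₁ + k₂ + y.count Letter.a + k₃ : ℕ) *
          (chr θ ((x.count Letter.a : ℤ) - (y.count Letter.a : ℤ)) - 1) := by
      rw [mul_sub, ← chr_add, mul_one]
      congr 2
      push_cast; ring
    rw [e, norm_mul, norm_chr, one_mul] at this
    exact this
  choose c hc h using key
  obtain ⟨c₀, hc₀, hle⟩ := exists_pos_le_of_finite c hc
  refine ⟨c₀, hc₀, fun i j θ => (h (i, j) θ).trans ?_⟩
  exact sub_le_sub_left (mul_le_mul_of_nonneg_right (hle _) (sq_nonneg _)) _

/-- The detected frequencies form a subgroup gℤ containing every cycle difference, so g divides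
their gcd, which is 1. -/
theorem detects_one (hM : EventuallyPos R.M) (ha : R.IsAperiodicPair) : R.Detects 1 := by
  obtain ⟨g, hg⟩ := Int.subgroup_cyclic R.detected
  have hmem : ∀ d : ℤ, d ∈ R.detected ↔ g ∣ d := by
    intro d
    rw [hg, ← AddSubgroup.zmultiples_eq_closure, Int.mem_zmultiples_iff]
  have h1 : g.natAbs ∣ R.cycleGCD := by
    rw [cycleGCD, Nat.dvd_setGcd_iff]
    rintro m ⟨x, y, hx, hy, hxy, rfl⟩
    rw [Int.natAbs_dvd_natAbs]
    exact (hmem _).1 (detects_of_isCycleLabel hM hx hy hxy)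
  rw [ha, Nat.dvd_one] at h1
  exact (hmem 1).2 (Int.isUnit_iff_natAbs_eq.2 h1).dvd

/-- Gaussian decay of the powers of `A e^{iθ} + B`. -/
theorem exists_decay (h : Perron R.M l v w) (hM : EventuallyPos R.M) (ha : R.IsAperiodicPair) :
    ∃ c > 0, ∃ K : ℝ, 0 ≤ K ∧ ∀ θ : ℝ, |θ| ≤ Real.pi → ∀ n : ℕ,
      WBound v (R.Mz (θ * Complex.I) ^ n) (K * (l * Real.exp (-c * θ ^ 2)) ^ n) := by
  have hne := h.nonempty
  obtain ⟨p₀, hp₀⟩ := detects_one hM ha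
  obtain ⟨c₁, hc₁, hdet⟩ := hp₀ (p₀ + 1) (by omega)
  set p := p₀ + 1 with hp
  have hl := h.l_pos
  have hpi := Real.pi_pos
  -- Small enough that the entrywise loss dominates c₂ θ² l^p times the Perron projection. The
  -- majorant then still has v as eigenvector, with eigenvalue l^p (1 - c₂ θ²).
  obtain ⟨c₂, hc₂, hle⟩ := exists_pos_le_of_finite
    (fun q : ι × ι => c₁ * (2 / Real.pi) ^ 2 / (l ^ p * (v q.1 * w q.2)))
    (fun q => by have := h.v_pos q.1; have := h.w_pos q.2; positivity)
  have hent : ∀ θ : ℝ, |θ| ≤ Real.pi → ∀ i j, ‖(R.Mz (θ * Complex.I) ^ p) i j‖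
      ≤ (R.M ^ p - (c₂ * θ ^ 2 * l ^ p) • Matrix.vecMulVec v w) i j := by
    intro θ hθ i j
    refine (hdet i j θ).trans ?_
    simp only [Matrix.sub_apply, Matrix.smul_apply, Matrix.vecMulVec_apply, smul_eq_mul]
    refine sub_le_sub_left ?_ _
    have h1 := hle (i, j)
    have hvw : 0 < l ^ p * (v i * w j) := mul_pos (pow_pos hl p) (mul_pos (h.v_pos i) (h.w_pos j))
    rw [le_div_iff₀ hvw] at h1
    have h2 := pow_le_pow_left₀ (by positivity) (norm_chr_one_sub_one hθ) 2
    rw [mul_pow, sq_abs] at h2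
    calc c₂ * θ ^ 2 * l ^ p * (v i * w j) = c₂ * (l ^ p * (v i * w j)) * θ ^ 2 := by ring
      _ ≤ c₁ * (2 / Real.pi) ^ 2 * θ ^ 2 := mul_le_mul_of_nonneg_right h1 (sq_nonneg θ)
      _ = c₁ * ((2 / Real.pi) ^ 2 * θ ^ 2) := by ring
      _ ≤ _ := mul_le_mul_of_nonneg_left h2 hc₁.le
  have hpb : ∀ θ : ℝ, |θ| ≤ Real.pi →
      WBound v (R.Mz (θ * Complex.I) ^ p) (l ^ p * Real.exp (-c₂ * θ ^ 2)) := by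
    intro θ hθ
    have h1 : WBound v (R.Mz (θ * Complex.I) ^ p) (l ^ p * (1 - c₂ * θ ^ 2)) := by
      refine WBound.of_le h.v_pos (hent θ hθ) ?_
      rw [Matrix.sub_mulVec, h.pow_mulVec, Matrix.smul_mulVec, Matrix.vecMulVec_mulVec, h.dot]
      ext i
      simp
      ring
    refine h1.mono h.v_pos (mul_le_mul_of_nonneg_left ?_ (pow_pos hl p).le)
    have := Real.add_one_le_exp (-c₂ * θ ^ 2)
    linarith
  have hp1 : (0 : ℝ) < p := by exact_mod_cast Nat.succ_pos p₀
  set c := c₂ / p with hc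
  -- A single factor is only known to have norm at most l; `K` offsets e^{-cθ²} for |θ| ≤ π.
  set K := Real.exp (c * Real.pi ^ 2) with hK
  refine ⟨c, by positivity, max 1 K ^ p, by positivity, fun θ hθ n => ?_⟩
  refine WBound.pow_le_of_pow h.v_pos (Nat.succ_pos p₀) (by positivity) (Real.exp_pos _).le ?_ ?_ n
  · refine (WBound.of_le (T := R.M) h.v_pos (fun i j => ?_) h.mulVec_v).mono h.v_pos ?_
    · simpa using norm_Mz_pow_le (R := R) 1 i j θ
    · have : K * (l * Real.exp (-c * θ ^ 2)) = l * Real.exp (c * (Real.pi ^ 2 - θ ^ 2)) := by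
        rw [hK, mul_left_comm, ← Real.exp_add]; ring_nf
      rw [this]
      have h2 : θ ^ 2 ≤ Real.pi ^ 2 := by rw [← sq_abs θ]; gcongr
      have hc0 : 0 ≤ c := by positivity
      exact le_mul_of_one_le_right hl.le (Real.one_le_exp (mul_nonneg hc0 (by linarith)))
  · have : (l * Real.exp (-c * θ ^ 2)) ^ p = l ^ p * Real.exp (-c₂ * θ ^ 2) := by
      rw [mul_pow, ← Real.exp_nat_mul, hc]
      congr 2
      field_simp
    rw [this]
    exact hpb θ hθ

end LinearRep
end

end RationalModel

/-! ### Gaussian approximation of one block and positivity of the variance -/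

namespace RationalModel

noncomputable section

variable {ι : Type} [Fintype ι] [DecidableEq ι]

theorem le_of_forall_pow_le {x y K : ℝ} (hy : 0 < y) (h : ∀ n : ℕ, x ^ n ≤ K * y ^ n) : x ≤ y := by
  by_contra! hlt
  obtain ⟨n, hn⟩ := pow_unbounded_of_one_lt K ((one_lt_div hy).2 hlt)
  rw [div_pow, lt_div_iff₀ (pow_pos hy n)] at hn
  exact absurd (h n) (not_le.2 hn)

/-- Telescoping; the factor E on the left avoids the exponent n - 1. -/
theorem norm_pow_sub_pow_mul_le {a b : ℂ} {E : ℝ} (ha : ‖a‖ ≤ E) (hb : ‖b‖ ≤ E) (n : ℕ) :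
    ‖a ^ n - b ^ n‖ * E ≤ n * ‖a - b‖ * E ^ n := by
  have hE : 0 ≤ E := (norm_nonneg a).trans ha
  induction n with
  | zero => simp
  | succ n ih =>
    have e : a ^ (n + 1) - b ^ (n + 1) = a ^ n * (a - b) + (a ^ n - b ^ n) * b := by ring
    have h1 : ‖a ^ n * (a - b)‖ ≤ E ^ n * ‖a - b‖ := by
      rw [norm_mul, norm_pow]
      exact mul_le_mul_of_nonneg_right (pow_le_pow_left₀ (norm_nonneg _) ha n) (norm_nonneg _)
    have h2 : ‖(a ^ n - b ^ n) * b‖ ≤ ‖a ^ n - b ^ n‖ * E := by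
      rw [norm_mul]
      exact mul_le_mul_of_nonneg_left hb (norm_nonneg _)
    have h3 : ‖a ^ (n + 1) - b ^ (n + 1)‖ ≤ E ^ n * ‖a - b‖ + n * ‖a - b‖ * E ^ n := by
      rw [e]
      exact (norm_add_le _ _).trans (add_le_add h1 (h2.trans ih))
    calc ‖a ^ (n + 1) - b ^ (n + 1)‖ * E ≤ (E ^ n * ‖a - b‖ + n * ‖a - b‖ * E ^ n) * E :=
          mul_le_mul_of_nonneg_right h3 hE
      _ = _ := by push_cast; ring

/-- Half of the Gaussian exponent absorbs nθ², by x ≤ e^x. This reduces n|θ|³ to |θ| uniformly in n.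
-/
theorem natCast_mul_sq_mul_exp_le {c : ℝ} (hc : 0 < c) (θ : ℝ) (n : ℕ) :
    n * θ ^ 2 * Real.exp (-(2 * c) * θ ^ 2) ^ n ≤ 1 / c * Real.exp (-c * θ ^ 2) ^ n := by
  have e : Real.exp (-(2 * c) * θ ^ 2) ^ n
      = Real.exp (-(c * n * θ ^ 2)) * Real.exp (-c * θ ^ 2) ^ n := by
    rw [← Real.exp_nat_mul, ← Real.exp_nat_mul, ← Real.exp_add]
    congr 1; ring
  rw [e, ← mul_assoc]
  refine mul_le_mul_of_nonneg_right ?_ (pow_nonneg (Real.exp_pos _).le _)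
  rw [Real.exp_neg, ← div_eq_mul_inv, div_le_iff₀ (Real.exp_pos _)]
  have := Real.add_one_le_exp (c * n * θ ^ 2)
  rw [div_mul_eq_mul_div, le_div_iff₀ hc]
  linarith

/-- The characteristic function of a normal law with mean `β` and variance `γ`. -/
def gaussChar (β γ θ : ℝ) : ℂ :=
  Complex.exp (β * (θ * Complex.I) + γ * (θ * Complex.I) ^ 2 / 2)

theorem norm_gaussChar (β γ θ : ℝ) : ‖gaussChar β γ θ‖ = Real.exp (-(γ / 2) * θ ^ 2) := by
  have : (β * (θ * Complex.I) + γ * (θ * Complex.I) ^ 2 / 2 : ℂ)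
      = ((-(γ / 2) * θ ^ 2 : ℝ) : ℂ) + ((β * θ : ℝ) : ℂ) * Complex.I := by
    rw [mul_pow, Complex.I_sq]; push_cast; ring
  rw [gaussChar, this, Complex.norm_exp, Complex.add_re, Complex.ofReal_re, Complex.re_ofReal_mul,
    Complex.I_re, mul_zero, add_zero]

namespace LinearRep

variable {R : LinearRep ι} {l : ℝ} {v w : ι → ℝ}

/-- Local estimates at `θ = 0` used for the comparison with the normal law. -/
theorem exists_local_estimates (h : Perron R.M l v w) (hM : EventuallyPos R.M) {c K : ℝ}
    (hdec : ∀ θ : ℝ, |θ| ≤ Real.pi → ∀ n : ℕ,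
      WBound v (R.Mz (θ * Complex.I) ^ n) (K * (l * Real.exp (-c * θ ^ 2)) ^ n)) :
    ∃ φ : ℝ → ℂ, ∃ P : ℝ → Matrix ι ι ℂ, ∃ C ρ δ : ℝ, 0 ≤ C ∧ 0 < ρ ∧ ρ < 1 ∧ 0 < δ ∧ δ ≤ 1 ∧
      ∀ θ : ℝ, |θ| < δ → ‖φ θ‖ ≤ Real.exp (-c * θ ^ 2) ∧
        ‖φ θ - gaussChar R.β R.γ θ‖ ≤ C * |θ| ^ 3 ∧
        ∀ i j, ‖P θ i j - (v i * w j : ℝ)‖ ≤ C * |θ| ∧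
          ∀ n : ℕ, ‖(R.Mz (θ * Complex.I) ^ n) i j / (l : ℂ) ^ n - φ θ ^ n * P θ i j‖
            ≤ C * ρ ^ n := by
  have hl := h.l_pos
  obtain ⟨P, hPa, hP0, C₀, ρ, hρ0, hρ1, hexp⟩ := exists_pow_expansion h hM
  obtain ⟨C₁, hC₁⟩ := (u_expansion h hM).bound
  have hPO : ∀ q : ι × ι, ∃ C, ∀ᶠ z in 𝓝 (0 : ℂ),
      ‖P z q.1 q.2 - P 0 q.1 q.2‖ ≤ C * ‖z - 0‖ := fun q =>
    ((hPa q.1 q.2).differentiableAt.isBigO_sub).bound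
  choose C₂ hC₂ using hPO
  have hC₂' := Filter.eventually_all.2 hC₂
  set C := |C₀| + |C₁| + ∑ q, |C₂ q| with hC
  have hsum0 : 0 ≤ ∑ q, |C₂ q| := Finset.sum_nonneg fun q _ => abs_nonneg _
  have hC₂le : ∀ q, C₂ q ≤ C := fun q => by
    have h1 : |C₂ q| ≤ ∑ q, |C₂ q| :=
      Finset.single_le_sum (f := fun q => |C₂ q|) (fun q _ => abs_nonneg _) (Finset.mem_univ q)
    have := le_abs_self (C₂ q)
    have := abs_nonneg C₀
    have := abs_nonneg C₁
    linarith
  have hC₀le : C₀ ≤ C := by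
    have := le_abs_self C₀
    have := abs_nonneg C₁
    linarith
  have hC₁le : C₁ ≤ C := by
    have := le_abs_self C₁
    have := abs_nonneg C₀
    linarith
  have hC0 : 0 ≤ C := by positivity
  have ht : Filter.Tendsto (fun θ : ℝ => (θ : ℂ) * Complex.I) (𝓝 0) (𝓝 0) := by
    have : Continuous fun θ : ℝ => (θ : ℂ) * Complex.I := by fun_prop
    simpa using this.tendsto 0
  obtain ⟨δ, hδ, hball⟩ := Metric.eventually_nhds_iff.1
    (ht.eventually (hexp.and (hC₁.and hC₂')))
  refine ⟨fun θ => R.u (θ * Complex.I) / l, fun θ => P (θ * Complex.I), C, ρ, min δ 1, hC0, hρ0,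
    hρ1, by positivity, min_le_right _ _, fun θ hθ => ?_⟩
  have hθ1 : |θ| < 1 := hθ.trans_le (min_le_right _ _)
  have hθpi : |θ| ≤ Real.pi := by linarith [Real.pi_gt_three]
  obtain ⟨⟨hMP, hPne, hpow⟩, hu, hP⟩ := hball (y := θ) (by
    rw [Real.dist_eq, sub_zero]; exact hθ.trans_le (min_le_left _ _))
  have hnz : ‖(θ : ℂ) * Complex.I‖ = |θ| := by simp
  refine ⟨?_, ?_, fun i j => ⟨?_, fun n => ?_⟩⟩
  · obtain ⟨j, hj⟩ : ∃ j, (fun i => P (θ * Complex.I) i j) ≠ 0 := by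
      by_contra! hall
      exact hPne (by ext i j; exact congrFun (hall j) i)
    have heig : ∀ n, (R.Mz (θ * Complex.I) ^ n).mulVec (fun i => P (θ * Complex.I) i j)
        = R.u (θ * Complex.I) ^ n • fun i => P (θ * Complex.I) i j := by
      have h1 : (R.Mz (θ * Complex.I)).mulVec (fun i => P (θ * Complex.I) i j)
          = R.u (θ * Complex.I) • fun i => P (θ * Complex.I) i j := by
        ext i
        exact congrFun (congrFun hMP i) j
      intro n
      induction n with
      | zero => simp
      | succ n ih => rw [pow_succ, ← Matrix.mulVec_mulVec, h1, Matrix.mulVec_smul, ih, smul_smul,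
          pow_succ']
    -- The columns of P are eigenvectors of every power; letting the power grow removes the constant
    -- `K` from the decay bound.
    have h2 : ‖R.u (θ * Complex.I)‖ ≤ l * Real.exp (-c * θ ^ 2) := by
      refine le_of_forall_pow_le (K := K) (by positivity) fun n => ?_
      rw [← norm_pow]
      exact (hdec θ hθpi n).eigenvalue_le h.v_pos hj (heig n)
    rw [norm_div, Complex.norm_real, Real.norm_of_nonneg hl.le, div_le_iff₀ hl, mul_comm _ l]
    exact h2
  · rw [norm_pow, hnz] at hu
    exact hu.trans (mul_le_mul_of_nonneg_right hC₁le (by positivity))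
  · have := hP (i, j)
    rw [hP0, sub_zero, hnz] at this
    exact this.trans (mul_le_mul_of_nonneg_right (hC₂le _) (abs_nonneg _))
  · exact (hpow n i j).trans (mul_le_mul_of_nonneg_right hC₀le (by positivity))

/-- Near 0 the normalized eigenvalue has modulus at most e^{-cθ²} and lies within C|θ|³ of a number
of modulus e^{-γθ²/2}. If γ ≤ 0, the latter is at least 1, and a cubic error cannot bridge a
quadratic gap. -/
theorem γ_pos (h : Perron R.M l v w) (hM : EventuallyPos R.M) (ha : R.IsAperiodicPair) :
    0 < R.γ := by
  obtain ⟨c, hc, K, -, hdec⟩ := exists_decay h hM ha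
  obtain ⟨φ, P, C, ρ, δ, hC, -, -, hδ, hδ1, hloc⟩ := exists_local_estimates h hM hdec
  by_contra! hγ
  -- Makes the cubic term at most half of cθ²; C + 1 keeps the denominator positive when C = 0.
  set θ := min (δ / 2) (c / (2 * ((C + 1) * (1 + c)))) with hθ
  have hθ0 : 0 < θ := lt_min (by positivity) (by positivity)
  have hθδ : θ < δ := (min_le_left _ _).trans_lt (by linarith)
  have hθ2 : θ * ((C + 1) * (1 + c)) ≤ c / 2 := by
    have h1 : θ ≤ c / (2 * ((C + 1) * (1 + c))) := min_le_right _ _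
    rw [le_div_iff₀ (by positivity)] at h1
    linarith
  obtain ⟨h1, h2, -⟩ := hloc θ (by rwa [abs_of_pos hθ0])
  rw [abs_of_pos hθ0] at h2
  have h3 : 1 ≤ ‖gaussChar R.β R.γ θ‖ := by
    rw [norm_gaussChar]
    exact Real.one_le_exp (mul_nonneg (by linarith) (sq_nonneg θ))
  have h4 : ‖gaussChar R.β R.γ θ‖ ≤ ‖φ θ‖ + ‖φ θ - gaussChar R.β R.γ θ‖ := by
    have := norm_sub_le (φ θ) (φ θ - gaussChar R.β R.γ θ)
    rwa [sub_sub_cancel] at this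
  have h5 : Real.exp (-c * θ ^ 2) * (1 + c * θ ^ 2) ≤ 1 := by
    have := Real.add_one_le_exp (c * θ ^ 2)
    calc Real.exp (-c * θ ^ 2) * (1 + c * θ ^ 2)
        ≤ Real.exp (-c * θ ^ 2) * Real.exp (c * θ ^ 2) :=
          mul_le_mul_of_nonneg_left (by linarith) (Real.exp_pos _).le
      _ = 1 := by rw [← Real.exp_add]; simp
  have h6 : 1 + c * θ ^ 2 ≤ 1 + C * θ ^ 3 * (1 + c * θ ^ 2) := by
    have h7 : 1 ≤ Real.exp (-c * θ ^ 2) + C * θ ^ 3 := by linarith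
    have := mul_le_mul_of_nonneg_right h7 (show 0 ≤ 1 + c * θ ^ 2 by positivity)
    linarith
  have h8 : θ ^ 2 ≤ 1 := pow_le_one₀ hθ0.le (by linarith)
  have h9 : C * θ ^ 3 * (1 + c * θ ^ 2) ≤ (C + 1) * θ ^ 3 * (1 + c) := by
    have : c * θ ^ 2 ≤ c := by nlinarith
    gcongr
    linarith
  have h10 : (C + 1) * θ ^ 3 * (1 + c) = θ ^ 2 * (θ * ((C + 1) * (1 + c))) := by ring
  have h11 : θ ^ 2 * (θ * ((C + 1) * (1 + c))) ≤ θ ^ 2 * (c / 2) :=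
    mul_le_mul_of_nonneg_left hθ2 (sq_nonneg θ)
  have : 0 < c * θ ^ 2 := by positivity
  linarith

/-- Comparison of the powers of `A e^{iθ} + B` with those of a normal characteristic function. -/
theorem exists_gaussian_estimate (h : Perron R.M l v w) (hM : EventuallyPos R.M)
    (ha : R.IsAperiodicPair) :
    ∃ C c ρ : ℝ, 0 ≤ C ∧ 0 < c ∧ 0 < ρ ∧ ρ < 1 ∧ c ≤ R.γ / 2 ∧
      ∀ θ : ℝ, |θ| ≤ Real.pi → ∀ (n : ℕ) (i j : ι),
        ‖(R.Mz (θ * Complex.I) ^ n) i j / (l : ℂ) ^ n‖ ≤ C * Real.exp (-c * θ ^ 2) ^ n ∧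
        ‖(R.Mz (θ * Complex.I) ^ n) i j / (l : ℂ) ^ n
            - gaussChar R.β R.γ θ ^ n * (v i * w j : ℝ)‖
          ≤ C * (|θ| * Real.exp (-c * θ ^ 2) ^ n + ρ ^ n) := by
  have hne := h.nonempty
  have hl := h.l_pos
  have hγ := γ_pos h hM ha
  obtain ⟨c₀, hc₀, K, hK, hdec⟩ := exists_decay h hM ha
  obtain ⟨φ, P, C₀, ρ, δ, hC₀, hρ0, hρ1, hδ, hδ1, hloc⟩ := exists_local_estimates h hM hdec
  -- Both the eigenvalue and ψ decay at rate 2c; one c is kept in the result and the other is spent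
  -- on nθ².
  set c := min c₀ (R.γ / 2) / 2 with hc
  have hc0 : 0 < c := by positivity
  have hcc₀ : 2 * c ≤ c₀ := by rw [hc]; linarith [min_le_left c₀ (R.γ / 2)]
  have hcγ : 2 * c ≤ R.γ / 2 := by rw [hc]; linarith [min_le_right c₀ (R.γ / 2)]
  have hmono : ∀ (a b : ℝ), a ≤ b → ∀ θ : ℝ, Real.exp (-b * θ ^ 2) ≤ Real.exp (-a * θ ^ 2) := by
    intro a b hab θ
    exact Real.exp_le_exp.2 (mul_le_mul_of_nonneg_right (by linarith) (sq_nonneg θ))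
  obtain ⟨V, hV⟩ := Finite.exists_max (fun q : ι × ι => v q.1 / v q.2)
  obtain ⟨W, hW⟩ := Finite.exists_max (fun q : ι × ι => v q.1 * w q.2)
  set V₀ := v V.1 / v V.2 with hV₀
  set W₀ := v W.1 * w W.2 with hW₀
  have hV0 : 0 < V₀ := div_pos (h.v_pos _) (h.v_pos _)
  have hW0 : 0 < W₀ := mul_pos (h.v_pos _) (h.w_pos _)
  set G := Real.exp (2 * c) with hG
  have hX : ∀ θ : ℝ, |θ| ≤ Real.pi → ∀ (n : ℕ) (i j : ι),
      ‖(R.Mz (θ * Complex.I) ^ n) i j / (l : ℂ) ^ n‖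
        ≤ (K * V₀) * Real.exp (-c * θ ^ 2) ^ n := by
    intro θ hθ n i j
    rw [norm_div, norm_pow, Complex.norm_real, Real.norm_of_nonneg hl.le,
      div_le_iff₀ (pow_pos hl n)]
    refine ((hdec θ hθ n).apply_le h.v_pos i j).trans ?_
    calc K * (l * Real.exp (-c₀ * θ ^ 2)) ^ n * (v i / v j)
        ≤ K * (l * Real.exp (-c * θ ^ 2)) ^ n * V₀ := by
          gcongr
          · exact (div_pos (h.v_pos _) (h.v_pos _)).le
          · linarith
          · exact hV (i, j)
      _ = _ := by rw [mul_pow]; ring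
  have hψ : ∀ θ : ℝ, ‖gaussChar R.β R.γ θ‖ ≤ Real.exp (-(2 * c) * θ ^ 2) := by
    intro θ
    rw [norm_gaussChar]
    exact hmono _ _ hcγ θ
  have hvw : ∀ i j, ‖((v i * w j : ℝ) : ℂ)‖ ≤ W₀ := fun i j => by
    rw [Complex.norm_real, Real.norm_of_nonneg (mul_pos (h.v_pos i) (h.w_pos j)).le]
    exact hW (i, j)
  -- For |θ| ≥ δ both compared quantities are simply bounded, and |θ| / δ ≥ 1 supplies the factor
  -- |θ|.
  set C₁ := (K * V₀ + W₀) / δ with hC₁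
  set C₂ := C₀ + G * C₀ * (1 / c) * W₀ with hC₂
  have hG0 : 0 < G := Real.exp_pos _
  have hC₁0 : 0 ≤ C₁ := by positivity
  have hC₂0 : 0 ≤ C₂ := by positivity
  refine ⟨K * V₀ + C₁ + C₂ + C₀, c, ρ, by positivity, hc0, hρ0, hρ1, by linarith,
    fun θ hθ n i j => ⟨?_, ?_⟩⟩
  · refine (hX θ hθ n i j).trans (mul_le_mul_of_nonneg_right ?_ (by positivity))
    linarith
  set E := Real.exp (-c * θ ^ 2) with hE
  set E₂ := Real.exp (-(2 * c) * θ ^ 2) with hE₂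
  have hE0 : 0 < E := Real.exp_pos _
  have hE₂0 : 0 < E₂ := Real.exp_pos _
  have hE₂E : E₂ ≤ E := hmono _ _ (by linarith) θ
  have hEn : 0 < E ^ n := pow_pos hE0 n
  have hρn : 0 < ρ ^ n := pow_pos hρ0 n
  have hKV : 0 ≤ K * V₀ := by positivity
  rcases lt_or_ge |θ| δ with hθδ | hθδ
  · obtain ⟨h1, h2, h3⟩ := hloc θ hθδ
    obtain ⟨h3, h4⟩ := h3 i j
    have h4 := h4 n
    have h1' : ‖φ θ‖ ≤ E₂ := h1.trans (hmono _ _ hcc₀ θ)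
    have hdiff : ‖φ θ ^ n - gaussChar R.β R.γ θ ^ n‖ ≤ G * C₀ * (1 / c) * (|θ| * E ^ n) := by
      have h5 := norm_pow_sub_pow_mul_le h1' (hψ θ) n
      have h6 : 1 ≤ G * E₂ := by
        rw [hG, hE₂, ← Real.exp_add]
        refine Real.one_le_exp ?_
        have : θ ^ 2 ≤ 1 := by
          rw [← sq_abs]; exact pow_le_one₀ (abs_nonneg _) (by linarith)
        nlinarith
      have h7 := natCast_mul_sq_mul_exp_le hc0 θ n
      calc ‖φ θ ^ n - gaussChar R.β R.γ θ ^ n‖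
          ≤ ‖φ θ ^ n - gaussChar R.β R.γ θ ^ n‖ * (G * E₂) :=
            le_mul_of_one_le_right (norm_nonneg _) h6
        _ = G * (‖φ θ ^ n - gaussChar R.β R.γ θ ^ n‖ * E₂) := by ring
        _ ≤ G * (n * ‖φ θ - gaussChar R.β R.γ θ‖ * E₂ ^ n) :=
            mul_le_mul_of_nonneg_left h5 hG0.le
        _ ≤ G * (n * (C₀ * |θ| ^ 3) * E₂ ^ n) := by gcongr
        _ = G * C₀ * |θ| * (n * θ ^ 2 * E₂ ^ n) := by rw [← sq_abs θ]; ring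
        _ ≤ G * C₀ * |θ| * (1 / c * E ^ n) := mul_le_mul_of_nonneg_left h7 (by positivity)
        _ = _ := by ring
    -- Three errors: the geometric remainder, the variation of the projection, and the eigenvalue
    -- against ψ.
    have e : (R.Mz (θ * Complex.I) ^ n) i j / (l : ℂ) ^ n
          - gaussChar R.β R.γ θ ^ n * (v i * w j : ℝ)
        = ((R.Mz (θ * Complex.I) ^ n) i j / (l : ℂ) ^ n - φ θ ^ n * P θ i j)
          + φ θ ^ n * (P θ i j - (v i * w j : ℝ))
          + (φ θ ^ n - gaussChar R.β R.γ θ ^ n) * (v i * w j : ℝ) := by ring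
    rw [e]
    have h8 : ‖φ θ ^ n * (P θ i j - (v i * w j : ℝ))‖ ≤ E ^ n * (C₀ * |θ|) := by
      rw [norm_mul, norm_pow]
      gcongr
      exact h1'.trans hE₂E
    have h9 : ‖(φ θ ^ n - gaussChar R.β R.γ θ ^ n) * ((v i * w j : ℝ) : ℂ)‖
        ≤ G * C₀ * (1 / c) * (|θ| * E ^ n) * W₀ := by
      rw [norm_mul]
      exact mul_le_mul hdiff (hvw i j) (norm_nonneg _) (by positivity)
    have h10 : ‖((R.Mz (θ * Complex.I) ^ n) i j / (l : ℂ) ^ n - φ θ ^ n * P θ i j)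
          + φ θ ^ n * (P θ i j - (v i * w j : ℝ))
          + (φ θ ^ n - gaussChar R.β R.γ θ ^ n) * (v i * w j : ℝ)‖
        ≤ C₀ * ρ ^ n + E ^ n * (C₀ * |θ|) + G * C₀ * (1 / c) * (|θ| * E ^ n) * W₀ :=
      (norm_add_le _ _).trans (add_le_add ((norm_add_le _ _).trans (add_le_add h4 h8)) h9)
    refine h10.trans ?_
    have e2 : C₀ * ρ ^ n + E ^ n * (C₀ * |θ|) + G * C₀ * (1 / c) * (|θ| * E ^ n) * W₀
        = C₂ * (|θ| * E ^ n) + C₀ * ρ ^ n := by rw [hC₂]; ring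
    rw [e2]
    have p1 : 0 ≤ |θ| * E ^ n := by positivity
    have q1 := mul_nonneg hKV p1
    have q2 := mul_nonneg hC₁0 p1
    have q3 := mul_nonneg hC₀ p1
    have q4 := mul_nonneg hKV hρn.le
    have q5 := mul_nonneg hC₁0 hρn.le
    have q6 := mul_nonneg hC₂0 hρn.le
    linarith
  · have h1 := hX θ hθ n i j
    have h2 : ‖gaussChar R.β R.γ θ ^ n * ((v i * w j : ℝ) : ℂ)‖ ≤ E ^ n * W₀ := by
      rw [norm_mul, norm_pow]
      exact mul_le_mul (pow_le_pow_left₀ (norm_nonneg _) ((hψ θ).trans hE₂E) n) (hvw i j)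
        (norm_nonneg _) (by positivity)
    refine ((norm_sub_le _ _).trans (add_le_add h1 h2)).trans ?_
    have h3 : K * V₀ * E ^ n + E ^ n * W₀ ≤ C₁ * (|θ| * E ^ n) := by
      have : C₁ * (|θ| * E ^ n) = (K * V₀ + W₀) * E ^ n * (|θ| / δ) := by rw [hC₁]; ring
      rw [this]
      have h4 : 1 ≤ |θ| / δ := (one_le_div hδ).2 hθδ
      have := le_mul_of_one_le_right (show 0 ≤ (K * V₀ + W₀) * E ^ n by positivity) h4
      linarith
    have p1 : 0 ≤ |θ| * E ^ n := by positivity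
    have q1 := mul_nonneg hKV p1
    have q2 := mul_nonneg hC₂0 p1
    have q3 := mul_nonneg hC₀ p1
    have q4 : 0 ≤ (K * V₀ + C₁ + C₂ + C₀) * ρ ^ n := by positivity
    linarith

end LinearRep
end

end RationalModel

/-! ### Convolution of two sequences with the same Gaussian -/

namespace RationalModel

noncomputable section

/-- `x θ n` is close to `ψ(θ)^n a` for the Gaussian characteristic function `ψ`. -/
def PowEst (β γ : ℝ) (x : ℝ → ℕ → ℂ) (a C c ρ : ℝ) : Prop :=
  ∀ θ : ℝ, |θ| ≤ Real.pi → ∀ n : ℕ, ‖x θ n‖ ≤ C * Real.exp (-c * θ ^ 2) ^ n ∧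
    ‖x θ n - gaussChar β γ θ ^ n * a‖ ≤ C * (|θ| * Real.exp (-c * θ ^ 2) ^ n + ρ ^ n)

/-- `s θ n` is close to `n ψ(θ)^(n-1) a` for the Gaussian characteristic function `ψ`. -/
def ConvEst (β γ : ℝ) (s : ℝ → ℕ → ℂ) (a D c : ℝ) : Prop :=
  ∀ θ : ℝ, |θ| ≤ Real.pi → ∀ n : ℕ, ‖s θ (n + 1) - (n + 1) * gaussChar β γ θ ^ n * a‖
    ≤ D * ((n + 1) * |θ| * Real.exp (-c * θ ^ 2) ^ n + 1)

variable {β γ : ℝ}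

theorem PowEst.mono {x : ℝ → ℕ → ℂ} {a C C' c c' ρ ρ' : ℝ} (h : PowEst β γ x a C c ρ)
    (hC0 : 0 ≤ C) (hC : C ≤ C') (hc : c' ≤ c) (hρ0 : 0 ≤ ρ) (hρ : ρ ≤ ρ') :
    PowEst β γ x a C' c' ρ' := by
  intro θ hθ n
  obtain ⟨h1, h2⟩ := h θ hθ n
  have h3 : Real.exp (-c * θ ^ 2) ≤ Real.exp (-c' * θ ^ 2) :=
    Real.exp_le_exp.2 (mul_le_mul_of_nonneg_right (by linarith) (sq_nonneg θ))
  have hC'0 := hC0.trans hC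
  exact ⟨h1.trans (by gcongr), h2.trans (by gcongr)⟩

theorem PowEst.sum {α : Type*} [Fintype α] {x : α → ℝ → ℕ → ℂ} {a t : α → ℝ} {C c ρ : ℝ}
    (h : ∀ k, PowEst β γ (x k) (a k) C c ρ) :
    PowEst β γ (fun θ n => ∑ k, (t k : ℂ) * x k θ n) (∑ k, t k * a k) ((∑ k, |t k|) * C) c ρ := by
  intro θ hθ n
  constructor
  · refine (norm_sum_le _ _).trans ?_
    rw [Finset.sum_mul, Finset.sum_mul]
    refine Finset.sum_le_sum fun k _ => ?_
    rw [norm_mul, Complex.norm_real, Real.norm_eq_abs, mul_assoc]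
    exact mul_le_mul_of_nonneg_left (h k θ hθ n).1 (abs_nonneg _)
  · have e : ∑ k, (t k : ℂ) * x k θ n - gaussChar β γ θ ^ n * ((∑ k, t k * a k : ℝ) : ℂ)
        = ∑ k, (t k : ℂ) * (x k θ n - gaussChar β γ θ ^ n * a k) := by
      push_cast
      rw [Finset.mul_sum, ← Finset.sum_sub_distrib]
      exact Finset.sum_congr rfl fun k _ => by ring
    rw [e]
    refine (norm_sum_le _ _).trans ?_
    rw [Finset.sum_mul, Finset.sum_mul]
    refine Finset.sum_le_sum fun k _ => ?_
    rw [norm_mul, Complex.norm_real, Real.norm_eq_abs, mul_assoc]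
    exact mul_le_mul_of_nonneg_left (h k θ hθ n).2 (abs_nonneg _)

theorem ConvEst.congr {s t : ℝ → ℕ → ℂ} {a D c : ℝ} (h : ConvEst β γ s a D c)
    (e : ∀ θ n, t θ (n + 1) = s θ (n + 1)) : ConvEst β γ t a D c := fun θ hθ n => by
  rw [e]
  exact h θ hθ n

theorem ConvEst.sum {α : Type*} [Fintype α] {s : α → ℝ → ℕ → ℂ} {a D : α → ℝ} {c : ℝ}
    (h : ∀ k, ConvEst β γ (s k) (a k) (D k) c) :
    ConvEst β γ (fun θ n => ∑ k, s k θ n) (∑ k, a k) (∑ k, D k) c := by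
  intro θ hθ n
  have e : ∑ k, s k θ (n + 1) - (n + 1) * gaussChar β γ θ ^ n * ((∑ k, a k : ℝ) : ℂ)
      = ∑ k, (s k θ (n + 1) - (n + 1) * gaussChar β γ θ ^ n * a k) := by
    push_cast
    rw [Finset.mul_sum, ← Finset.sum_sub_distrib]
  rw [e, Finset.sum_mul]
  exact (norm_sum_le _ _).trans (Finset.sum_le_sum fun k _ => h k θ hθ n)

/-- Meant for the words that stay inside one block, which weigh one order of n less than the
convolution. -/
theorem ConvEst.add_bounded {s r : ℝ → ℕ → ℂ} {a D c B : ℝ} (h : ConvEst β γ s a D c) (hB : 0 ≤ B)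
    (hr : ∀ θ : ℝ, |θ| ≤ Real.pi → ∀ n, ‖r θ (n + 1)‖ ≤ B) :
    ConvEst β γ (fun θ n => s θ n + r θ n) a (D + B) c := by
  intro θ hθ n
  rw [add_sub_right_comm]
  refine (norm_add_le _ _).trans ((add_le_add (h θ hθ n) (hr θ hθ n)).trans ?_)
  rw [add_mul D B, add_le_add_iff_left]
  refine le_mul_of_one_le_right hB ?_
  have : 0 ≤ ((n : ℝ) + 1) * |θ| * Real.exp (-c * θ ^ 2) ^ n := by positivity
  linarith

theorem exp_neg_mul_sq_le_one {c : ℝ} (hc : 0 ≤ c) (θ : ℝ) : Real.exp (-c * θ ^ 2) ≤ 1 :=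
  Real.exp_le_one_iff.2 (by nlinarith [sq_nonneg θ, mul_nonneg hc (sq_nonneg θ)])

theorem norm_gaussChar_le {c : ℝ} (hc : c ≤ γ / 2) (θ : ℝ) :
    ‖gaussChar β γ θ‖ ≤ Real.exp (-c * θ ^ 2) := by
  rw [norm_gaussChar]
  exact Real.exp_le_exp.2 (mul_le_mul_of_nonneg_right (by linarith) (sq_nonneg θ))

/-- This is where equality of β and of γ is used: ψ^i ψ^j depends only on i + j, so all terms have
the same main part. The errors |θ| E^{i+j} add up to n of them, and ρ^i + ρ^j sums to a constant. -/
theorem PowEst.conv {x z : ℝ → ℕ → ℂ} {y : ℝ → ℂ} {p q y₀ C c ρ Y : ℝ}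
    (hx : PowEst β γ x p C c ρ) (hz : PowEst β γ z q C c ρ) (hC : 0 ≤ C) (hc : 0 ≤ c)
    (hcγ : c ≤ γ / 2) (hρ0 : 0 < ρ) (hρ1 : ρ < 1) (hy : ∀ θ, ‖y θ‖ ≤ Y)
    (hy' : ∀ θ, ‖y θ - y₀‖ ≤ Y * |θ|) :
    ∃ D, ConvEst β γ (fun θ n => ∑ i ∈ Finset.range n, x θ i * y θ * z θ (n - 1 - i))
      (p * y₀ * q) D c := by
  have hY : 0 ≤ Y := (norm_nonneg _).trans (hy 0)
  have hy₀ : |y₀| ≤ Y := by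
    have h1 := hy' 0
    rw [abs_zero, mul_zero, norm_le_zero_iff, sub_eq_zero] at h1
    have h2 := hy 0
    rwa [h1, Complex.norm_real] at h2
  set D₁ := C * Y * C + |p| * Y * C + |p| * Y * C with hD₁
  have hD₁0 : 0 ≤ D₁ := by positivity
  have key : ∀ θ : ℝ, |θ| ≤ Real.pi → ∀ i j : ℕ,
      ‖x θ i * y θ * z θ j - gaussChar β γ θ ^ (i + j) * (p * y₀ * q : ℝ)‖
        ≤ D₁ * (|θ| * Real.exp (-c * θ ^ 2) ^ (i + j) + (ρ ^ i + ρ ^ j)) := by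
    intro θ hθ i j
    obtain ⟨hx1, hx2⟩ := hx θ hθ i
    obtain ⟨hz1, hz2⟩ := hz θ hθ j
    set E := Real.exp (-c * θ ^ 2) with hE
    have hE0 : 0 < E := Real.exp_pos _
    have hE1 : E ≤ 1 := exp_neg_mul_sq_le_one hc θ
    set ψ := gaussChar β γ θ with hψ
    have hψE : ‖ψ‖ ≤ E := norm_gaussChar_le hcγ θ
    -- One factor is replaced at a time by its main part.
    have e : x θ i * y θ * z θ j - ψ ^ (i + j) * (p * y₀ * q : ℝ)
        = (x θ i - ψ ^ i * p) * y θ * z θ j + (ψ ^ i * p) * (y θ - y₀) * z θ j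
          + (ψ ^ i * p) * y₀ * (z θ j - ψ ^ j * q) := by
      push_cast; ring
    have hψp : ‖ψ ^ i * (p : ℂ)‖ ≤ |p| * E ^ i := by
      rw [norm_mul, norm_pow, Complex.norm_real, Real.norm_eq_abs, mul_comm]
      gcongr
    have hEi : E ^ i ≤ 1 := pow_le_one₀ hE0.le hE1
    have hEj : E ^ j ≤ 1 := pow_le_one₀ hE0.le hE1
    have t1 : ‖(x θ i - ψ ^ i * p) * y θ * z θ j‖
        ≤ C * (|θ| * E ^ i + ρ ^ i) * Y * (C * E ^ j) := by
      rw [norm_mul, norm_mul]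
      gcongr
      exact hy θ
    have t2 : ‖(ψ ^ i * p) * (y θ - y₀) * z θ j‖ ≤ (|p| * E ^ i) * (Y * |θ|) * (C * E ^ j) := by
      rw [norm_mul, norm_mul]
      gcongr
      exact hy' θ
    have t3 : ‖(ψ ^ i * p) * y₀ * (z θ j - ψ ^ j * q)‖
        ≤ (|p| * E ^ i) * Y * (C * (|θ| * E ^ j + ρ ^ j)) := by
      rw [norm_mul, norm_mul, Complex.norm_real]
      gcongr
      exact hy₀
    rw [e]
    refine (norm_add_le _ _).trans ((add_le_add ((norm_add_le _ _).trans (add_le_add t1 t2))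
      t3).trans ?_)
    have s1 : C * (|θ| * E ^ i + ρ ^ i) * Y * (C * E ^ j)
        ≤ C * Y * C * (|θ| * E ^ (i + j) + (ρ ^ i + ρ ^ j)) := by
      have : C * (|θ| * E ^ i + ρ ^ i) * Y * (C * E ^ j)
        = C * Y * C * (|θ| * E ^ (i + j) + ρ ^ i * E ^ j) := by rw [pow_add]; ring
      rw [this]
      have h1 : ρ ^ i * E ^ j ≤ ρ ^ i := mul_le_of_le_one_right (pow_pos hρ0 i).le hEj
      have h2 := pow_pos hρ0 j
      gcongr
      linarith
    have s2 : (|p| * E ^ i) * (Y * |θ|) * (C * E ^ j)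
        ≤ |p| * Y * C * (|θ| * E ^ (i + j) + (ρ ^ i + ρ ^ j)) := by
      have : (|p| * E ^ i) * (Y * |θ|) * (C * E ^ j) = |p| * Y * C * (|θ| * E ^ (i + j)) := by
        rw [pow_add]; ring
      rw [this]
      have h1 := pow_pos hρ0 i
      have h2 := pow_pos hρ0 j
      gcongr
      linarith
    have s3 : (|p| * E ^ i) * Y * (C * (|θ| * E ^ j + ρ ^ j))
        ≤ |p| * Y * C * (|θ| * E ^ (i + j) + (ρ ^ i + ρ ^ j)) := by
      have : (|p| * E ^ i) * Y * (C * (|θ| * E ^ j + ρ ^ j))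
          = |p| * Y * C * (|θ| * E ^ (i + j) + E ^ i * ρ ^ j) := by
        rw [pow_add]; ring
      rw [this]
      have h1 : E ^ i * ρ ^ j ≤ ρ ^ j := mul_le_of_le_one_left (pow_pos hρ0 j).le hEi
      have h2 := pow_pos hρ0 i
      gcongr
      linarith
    rw [hD₁]
    linarith
  have hgeom : ∀ n : ℕ, ∑ i ∈ Finset.range n, ρ ^ i ≤ (1 - ρ)⁻¹ := fun n =>
    (summable_geometric_of_lt_one hρ0.le hρ1).sum_le_tsum _ (fun i _ => (pow_pos hρ0 i).le)
      |>.trans (tsum_geometric_of_lt_one hρ0.le hρ1).le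
  have hr : 0 < (1 - ρ)⁻¹ := inv_pos.2 (by linarith)
  refine ⟨D₁ * (1 + 2 * (1 - ρ)⁻¹), fun θ hθ n => ?_⟩
  set E := Real.exp (-c * θ ^ 2) with hE
  have hE0 : 0 < E := Real.exp_pos _
  have e : ∑ i ∈ Finset.range (n + 1), x θ i * y θ * z θ (n + 1 - 1 - i)
        - (n + 1) * gaussChar β γ θ ^ n * ((p * y₀ * q : ℝ) : ℂ)
      = ∑ i ∈ Finset.range (n + 1), (x θ i * y θ * z θ (n - i)
        - gaussChar β γ θ ^ (i + (n - i)) * ((p * y₀ * q : ℝ) : ℂ)) := by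
    rw [Finset.sum_sub_distrib, Nat.add_sub_cancel]
    congr 1
    rw [Finset.sum_congr rfl (g := fun _ => gaussChar β γ θ ^ n * ((p * y₀ * q : ℝ) : ℂ))]
    · rw [Finset.sum_const, Finset.card_range, nsmul_eq_mul]
      push_cast; ring
    · intro i hi
      rw [Nat.add_sub_cancel' (Nat.lt_succ_iff.1 (Finset.mem_range.1 hi))]
  rw [e]
  have hrefl : ∑ i ∈ Finset.range (n + 1), ρ ^ (n - i) = ∑ i ∈ Finset.range (n + 1), ρ ^ i :=
    Finset.sum_range_reflect (fun i => ρ ^ i) (n + 1)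
  calc _ ≤ ∑ i ∈ Finset.range (n + 1), D₁ * (|θ| * E ^ n + (ρ ^ i + ρ ^ (n - i))) := by
        refine (norm_sum_le _ _).trans (Finset.sum_le_sum fun i hi => ?_)
        have := key θ hθ i (n - i)
        rw [Nat.add_sub_cancel' (Nat.lt_succ_iff.1 (Finset.mem_range.1 hi))] at this ⊢
        exact this
    _ = D₁ * ((n + 1) * |θ| * E ^ n + (∑ i ∈ Finset.range (n + 1), ρ ^ i
          + ∑ i ∈ Finset.range (n + 1), ρ ^ i)) := by
        rw [← Finset.mul_sum, Finset.sum_add_distrib, Finset.sum_add_distrib, hrefl,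
          Finset.sum_const, Finset.card_range, nsmul_eq_mul]
        push_cast; ring
    _ ≤ D₁ * ((n + 1) * |θ| * E ^ n + ((1 - ρ)⁻¹ + (1 - ρ)⁻¹)) := by
        gcongr <;> exact hgeom _
    _ ≤ _ := by
        rw [mul_assoc D₁]
        refine mul_le_mul_of_nonneg_left ?_ hD₁0
        have : 0 ≤ ((n : ℝ) + 1) * |θ| * E ^ n := by positivity
        nlinarith

/-- Modulus and phase are compared with 1 separately. The bound pays for the change from ψ^n to
ψ^(n+1) in the normalization. -/
theorem norm_gaussChar_sub_one_le (hγ : 0 ≤ γ) {θ : ℝ} (hθ : |θ| ≤ Real.pi) :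
    ‖gaussChar β γ θ - 1‖ ≤ (|β| + γ * Real.pi / 2) * |θ| := by
  set x := γ / 2 * θ ^ 2 with hx
  have hx0 : 0 ≤ x := by positivity
  have e : gaussChar β γ θ - 1 = (Real.exp (-x) : ℂ) * (Complex.exp (Complex.I * (β * θ : ℝ)) - 1)
      + ((Real.exp (-x) - 1 : ℝ) : ℂ) := by
    have : gaussChar β γ θ = (Real.exp (-x) : ℂ) * Complex.exp (Complex.I * (β * θ : ℝ)) := by
      rw [gaussChar, Complex.ofReal_exp, ← Complex.exp_add, mul_pow, Complex.I_sq, hx]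
      congr 1; push_cast; ring
    rw [this]; push_cast; ring
  rw [e]
  have h1 : ‖(Real.exp (-x) : ℂ) * (Complex.exp (Complex.I * (β * θ : ℝ)) - 1)‖ ≤ |β| * |θ| := by
    rw [norm_mul, Complex.norm_real, Real.norm_of_nonneg (Real.exp_pos _).le]
    have h2 := Real.norm_exp_I_mul_ofReal_sub_one_le (x := β * θ)
    rw [Real.norm_eq_abs, abs_mul] at h2
    have h3 : Real.exp (-x) ≤ 1 := Real.exp_le_one_iff.2 (by linarith)
    exact (mul_le_of_le_one_left (norm_nonneg _) h3).trans h2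
  have h2 : ‖((Real.exp (-x) - 1 : ℝ) : ℂ)‖ ≤ x := by
    rw [Complex.norm_real, Real.norm_eq_abs, abs_le]
    have h3 := Real.add_one_le_exp (-x)
    have h4 : Real.exp (-x) ≤ 1 := Real.exp_le_one_iff.2 (by linarith)
    constructor <;> linarith
  have h3 : x ≤ γ * Real.pi / 2 * |θ| := by
    rw [hx, ← sq_abs θ]
    have : γ / 2 * |θ| ^ 2 = γ / 2 * (|θ| * |θ|) := by ring
    rw [this]
    have := mul_le_mul_of_nonneg_right hθ (abs_nonneg θ)
    have := mul_le_mul_of_nonneg_left this (show 0 ≤ γ / 2 by linarith)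
    linarith
  refine (norm_add_le _ _).trans ((add_le_add h1 (h2.trans h3)).trans ?_)
  linarith

/-- The normalized transform is close to the Gaussian characteristic function. -/
theorem ConvEst.normalized {s : ℝ → ℕ → ℂ} {a D c : ℝ} (h : ConvEst β γ s a D c) (ha : 0 < a)
    (hc : 0 ≤ c) (hcγ : c ≤ γ / 2) (hγ : 0 ≤ γ) :
    ∃ C : ℝ, 0 ≤ C ∧ ∃ N : ℕ, ∀ n ≥ N, s 0 n ≠ 0 ∧ ∀ θ : ℝ, |θ| ≤ Real.pi →
      ‖s θ n / s 0 n - gaussChar β γ θ ^ n‖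
        ≤ C * (|θ| * Real.exp (-c * θ ^ 2) ^ n + 1 / n) := by
  have hpi := Real.pi_pos
  have hD : 0 ≤ D := by
    have h1 := (norm_nonneg _).trans (h 0 (by rw [abs_zero]; exact hpi.le) 0)
    simpa using h1
  -- From here on the error `D` is at most half of the main term a (n + 1), so the denominator stays
  -- above a (n + 1) / 2.
  obtain ⟨N, hN⟩ := exists_nat_ge (2 * D / a)
  set B := |β| + γ * Real.pi / 2 with hB
  have hB0 : 0 ≤ B := by positivity
  set G := Real.exp (c * Real.pi ^ 2) with hG
  have hG0 : 0 < G := Real.exp_pos _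
  refine ⟨2 / a * ((D + a * B) * G + 2 * D), by positivity, N + 1, fun m hm => ?_⟩
  obtain ⟨n, rfl⟩ : ∃ n, m = n + 1 := ⟨m - 1, by omega⟩
  have hnN : (N : ℝ) ≤ n := by exact_mod_cast (by omega : N ≤ n)
  have h0 := h 0 (by rw [abs_zero]; exact hpi.le) n
  have hψ0 : gaussChar β γ 0 = 1 := by simp [gaussChar]
  rw [hψ0, one_pow, abs_zero, mul_zero, zero_mul, zero_add, mul_one, mul_one] at h0
  have hDa : 2 * D ≤ a * (n + 1) := by
    have := hN.trans hnN
    rw [div_le_iff₀ ha] at this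
    linarith
  have hs0 : a * (n + 1) / 2 ≤ ‖s 0 (n + 1)‖ := by
    have h1 := norm_sub_norm_le ((n + 1 : ℂ) * a) (s 0 (n + 1))
    rw [norm_sub_rev] at h1
    have h2 : ‖(n + 1 : ℂ) * a‖ = (n + 1) * a := by
      rw [norm_mul, Complex.norm_real, Real.norm_of_nonneg ha.le]
      congr 1
      exact_mod_cast Complex.norm_natCast (n + 1)
    rw [h2] at h1
    linarith
  have hn1 : (0 : ℝ) < n + 1 := by positivity
  have hpos : 0 < a * (n + 1) / 2 := by positivity
  have hs0' : s 0 (n + 1) ≠ 0 := norm_pos_iff.1 (hpos.trans_le hs0)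
  refine ⟨hs0', fun θ hθ => ?_⟩
  have hθn := h θ hθ n
  set ψ := gaussChar β γ θ with hψ
  set E := Real.exp (-c * θ ^ 2) with hE
  have hE0 : 0 < E := Real.exp_pos _
  have hE1 : E ≤ 1 := exp_neg_mul_sq_le_one hc θ
  have hψE : ‖ψ‖ ≤ E := norm_gaussChar_le hcγ θ
  have hψ1 : ‖1 - ψ‖ ≤ B * |θ| := by
    rw [norm_sub_rev]; exact norm_gaussChar_sub_one_le hγ hθ
  have hGE : 1 ≤ G * E := by
    rw [hG, hE, ← Real.exp_add]
    refine Real.one_le_exp ?_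
    have h2 : θ ^ 2 ≤ Real.pi ^ 2 := by rw [← sq_abs θ]; gcongr
    nlinarith
  -- The numerator collects the convolution error at θ, the shift of the exponent by one, and the
  -- error of the normalizer.
  have e : s θ (n + 1) / s 0 (n + 1) - ψ ^ (n + 1)
      = ((s θ (n + 1) - (n + 1) * ψ ^ n * a) + (n + 1) * a * (ψ ^ n * (1 - ψ))
          - ψ ^ (n + 1) * (s 0 (n + 1) - (n + 1) * a)) / s 0 (n + 1) := by
    field_simp; ring
  rw [e, norm_div, div_le_iff₀ (hpos.trans_le hs0)]
  have t2 : ‖(n + 1 : ℂ) * a * (ψ ^ n * (1 - ψ))‖ ≤ (n + 1) * a * (E ^ n * (B * |θ|)) := by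
    rw [norm_mul, norm_mul, norm_mul, norm_pow, Complex.norm_real, Real.norm_of_nonneg ha.le]
    have : ‖(n + 1 : ℂ)‖ = n + 1 := by exact_mod_cast Complex.norm_natCast (n + 1)
    rw [this]
    gcongr
  have t3 : ‖ψ ^ (n + 1) * (s 0 (n + 1) - (n + 1) * a)‖ ≤ D := by
    rw [norm_mul, norm_pow]
    have : ‖ψ‖ ^ (n + 1) ≤ 1 := pow_le_one₀ (norm_nonneg _) (hψE.trans hE1)
    exact (mul_le_of_le_one_left (norm_nonneg _) this).trans h0
  have hEn : E ^ n ≤ G * E ^ (n + 1) := by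
    calc E ^ n ≤ E ^ n * (G * E) := le_mul_of_one_le_right (pow_pos hE0 n).le hGE
      _ = _ := by ring
  calc _ ≤ D * ((n + 1) * |θ| * E ^ n + 1) + (n + 1) * a * (E ^ n * (B * |θ|)) + D :=
        (norm_sub_le _ _).trans (add_le_add ((norm_add_le _ _).trans (add_le_add hθn t2)) t3)
    _ = (n + 1) * ((D + a * B) * |θ|) * E ^ n + 2 * D := by ring
    _ ≤ (n + 1) * ((D + a * B) * |θ|) * (G * E ^ (n + 1)) + 2 * D := by gcongr
    _ = (2 / a * ((D + a * B) * G * (|θ| * E ^ (n + 1)) + 2 * D * (1 / (n + 1))))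
          * (a * (n + 1) / 2) := by field_simp
    _ ≤ (2 / a * ((D + a * B) * G + 2 * D) * (|θ| * E ^ (n + 1) + 1 / ((n + 1 : ℕ) : ℝ)))
          * (a * (n + 1) / 2) := by
        refine mul_le_mul_of_nonneg_right ?_ hpos.le
        rw [mul_assoc (2 / a)]
        refine mul_le_mul_of_nonneg_left ?_ (by positivity)
        push_cast
        have p1 : 0 ≤ (D + a * B) * G * (1 / ((n : ℝ) + 1)) := by positivity
        have p2 : 0 ≤ 2 * D * (|θ| * E ^ (n + 1)) := by positivity
        linarith
    _ ≤ _ := by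
        refine mul_le_mul_of_nonneg_left hs0 (by positivity)

end

end RationalModel

/-! ### Generating polynomials of words and powers of block-triangular matrices -/

namespace RationalModel

noncomputable section

section Words

open Polynomial

variable {ι : Type} [Fintype ι] [DecidableEq ι]

/-- A word of length `n + 1` is a letter followed by a word of length `n`. -/
def consEquiv (n : ℕ) : Letter × List.Vector Letter n ≃ List.Vector Letter (n + 1) where
  toFun q := List.Vector.cons q.1 q.2
  invFun x := (x.head, x.tail)
  left_inv q := by simp
  right_inv x := by simp

theorem sum_letter {α : Type*} [AddCommMonoid α] (f : Letter → α) :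
    ∑ x, f x = f Letter.a + f Letter.b := by
  have : (Finset.univ : Finset Letter) = {Letter.a, Letter.b} := rfl
  rw [this, Finset.sum_pair (by decide)]

namespace LinearRep

variable (R : LinearRep ι)

theorem polyM_pow_eq_sum (n : ℕ) (i j : ι) : (R.polyM ^ n) i j
    = ∑ x : List.Vector Letter n, C (R.μ (FreeMonoid.ofList x.toList) i j)
        * X ^ (x.toList.count Letter.a) := by
  induction n generalizing i j with
  | zero =>
    rw [Fintype.sum_eq_single List.Vector.nil fun x hx => (hx x.eq_nil).elim,
      List.Vector.toList_nil]
    by_cases hij : i = j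
    · subst hij; simp
    · simp [Matrix.one_apply_ne hij]
  | succ n ih =>
    rw [← (consEquiv n).sum_comp, Fintype.sum_prod_type, sum_letter, pow_succ', Matrix.mul_apply,
      ← Finset.sum_add_distrib]
    simp_rw [ih, Finset.mul_sum]
    rw [Finset.sum_comm]
    refine Finset.sum_congr rfl fun x _ => ?_
    have hμ : ∀ y : Letter, R.μ (FreeMonoid.ofList (consEquiv n (y, x)).toList) i j
        = ∑ k, R.letterMatrix y i k * R.μ (FreeMonoid.ofList x.toList) k j := by
      intro y
      have e : FreeMonoid.ofList (consEquiv n (y, x)).toList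
          = FreeMonoid.of y * FreeMonoid.ofList x.toList := by
        simp [consEquiv, FreeMonoid.ofList_cons]
      rw [e, map_mul, Matrix.mul_apply]
      simp [μ]
    have ha : (consEquiv n (Letter.a, x)).toList.count Letter.a
        = x.toList.count Letter.a + 1 := by
      simp [consEquiv]
    have hb : (consEquiv n (Letter.b, x)).toList.count Letter.a = x.toList.count Letter.a := by
      simp [consEquiv]
    rw [hμ, hμ, ha, hb, map_sum, map_sum, Finset.sum_mul, Finset.sum_mul,
      ← Finset.sum_add_distrib]
    refine Finset.sum_congr rfl fun k _ => ?_
    simp only [polyM, letterMatrix, C_mul]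
    ring

/-- The generating polynomial of the weights of the words of length `n`. -/
def genPoly (n : ℕ) : ℝ[X] := ∑ i, ∑ j, C (R.ξ i * R.η j) * (R.polyM ^ n) i j

theorem genPoly_eq_sum (n : ℕ) : R.genPoly n
    = ∑ x : List.Vector Letter n, C (R.series (FreeMonoid.ofList x.toList))
        * X ^ (x.toList.count Letter.a) := by
  unfold genPoly
  simp_rw [polyM_pow_eq_sum, Finset.mul_sum]
  rw [Finset.sum_congr rfl (fun i _ => Finset.sum_comm), Finset.sum_comm]
  refine Finset.sum_congr rfl fun x _ => ?_
  simp only [series, dotProduct, Matrix.mulVec, Finset.mul_sum, map_sum, Finset.sum_mul]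
  refine Finset.sum_congr rfl fun i _ => Finset.sum_congr rfl fun j _ => ?_
  rw [← mul_assoc, ← C_mul]
  congr 2
  ring

/-- Puts the probability in the form of a coefficient, which Fourier inversion recovers from the
unit circle. -/
theorem prob_eq (n k : ℕ) : R.prob n k = (R.genPoly n).coeff k / (R.genPoly n).eval 1 := by
  have h1 : (R.genPoly n).coeff k = ∑ x : List.Vector Letter n with
      x.toList.count Letter.a = k, R.series (FreeMonoid.ofList x.toList) := by
    rw [genPoly_eq_sum, finsetSum_coeff, Finset.sum_filter]
    refine Finset.sum_congr rfl fun x _ => ?_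
    rw [coeff_C_mul, coeff_X_pow]
    by_cases h : x.toList.count Letter.a = k
    · simp [h]
    · simp [h, Ne.symm h]
  have h2 : (R.genPoly n).eval 1
      = ∑ x : List.Vector Letter n, R.series (FreeMonoid.ofList x.toList) := by
    rw [genPoly_eq_sum, eval_finsetSum]
    simp
  rw [h1, h2, prob, Finset.sum_div]
  rfl

/-- The transform `∑ (r, w) e^{z |w|_a}` over the words of length `n`. -/
def transform (n : ℕ) (z : ℂ) : ℂ := (R.genPoly n).eval₂ (algebraMap ℝ ℂ) (Complex.exp z)

theorem transform_eq (n : ℕ) (z : ℂ) :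
    R.transform n z = ∑ i, ∑ j, (R.ξ i : ℂ) * (R.Mz z ^ n) i j * R.η j := by
  simp only [transform, genPoly, eval₂_finsetSum, eval₂_mul, eval₂_C, polyM_eval₂]
  refine Finset.sum_congr rfl fun i _ => Finset.sum_congr rfl fun j _ => ?_
  simp only [Complex.coe_algebraMap]
  push_cast; ring

theorem transform_zero (n : ℕ) : R.transform n 0 = ((R.genPoly n).eval 1 : ℝ) := by
  rw [transform, Complex.exp_zero, ← Complex.ofReal_one]
  exact eval₂_at_apply (algebraMap ℝ ℂ) 1

end LinearRep

end Words

namespace BlockRep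

variable {ι₁ ι₂ : Type} [Fintype ι₁] [DecidableEq ι₁] [Fintype ι₂] [DecidableEq ι₂]
  (R : BlockRep ι₁ ι₂)

/-- The off-diagonal block `A₀ e^z + B₀`. -/
def M₀z (z : ℂ) : Matrix ι₁ ι₂ ℂ := fun i j => Complex.exp z * R.A₀ i j + R.B₀ i j

omit [Fintype ι₁] [DecidableEq ι₁] [Fintype ι₂] [DecidableEq ι₂] in
theorem toLinearRep_Mz (z : ℂ) : R.toLinearRep.Mz z
    = Matrix.fromBlocks (R.R₁.Mz z) (R.M₀z z) 0 (R.R₂.Mz z) := by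
  ext (i | i) (j | j) <;> simp [LinearRep.Mz, toLinearRep, M₀z]

omit [DecidableEq ι₁] [DecidableEq ι₂] in
theorem dotProduct_mulVec_eq_sum (x : ι₁ → ℂ) (Y : Matrix ι₁ ι₂ ℂ) (z : ι₂ → ℂ) :
    x ⬝ᵥ Y.mulVec z = ∑ i, ∑ j, x i * Y i j * z j := by
  simp only [dotProduct, Matrix.mulVec, Finset.mul_sum, mul_assoc]

/-- A path joining the two blocks crosses exactly once, and i is the crossing time. The truncated
subtraction is harmless since i < n. -/
theorem fromBlocks_upper_pow (X : Matrix ι₁ ι₁ ℂ) (Y : Matrix ι₁ ι₂ ℂ) (Z : Matrix ι₂ ι₂ ℂ)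
    (n : ℕ) : Matrix.fromBlocks X Y 0 Z ^ n = Matrix.fromBlocks (X ^ n)
      (∑ i ∈ Finset.range n, X ^ i * Y * Z ^ (n - 1 - i)) 0 (Z ^ n) := by
  induction n with
  | zero => simp [Matrix.fromBlocks_one]
  | succ n ih =>
    rw [pow_succ, ih, Matrix.fromBlocks_multiply]
    congr 1
    · simp [pow_succ]
    · rw [Finset.sum_range_succ, Matrix.sum_mul, add_comm]
      congr 1
      · refine Finset.sum_congr rfl fun i hi => ?_
        have hi := Finset.mem_range.1 hi
        rw [Matrix.mul_assoc, ← pow_succ, show n - 1 - i + 1 = n + 1 - 1 - i by omega]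
      · simp
    · simp
    · simp [pow_succ]

/-- The crossing term is split over entries (i, j) of the off-diagonal block, so that each piece is
a scalar convolution as in `PowEst.conv`. -/
theorem transform_block (n : ℕ) (z : ℂ) : R.toLinearRep.transform n z
    = (∑ i, ∑ j, ∑ k ∈ Finset.range n,
        Matrix.vecMul (vecC R.R₁.ξ) (R.R₁.Mz z ^ k) i * R.M₀z z i j
          * (R.R₂.Mz z ^ (n - 1 - k)).mulVec (vecC R.R₂.η) j)
      + (R.R₁.transform n z + R.R₂.transform n z) := by
  have key : ∀ k, ∑ i, ∑ j, Matrix.vecMul (vecC R.R₁.ξ) (R.R₁.Mz z ^ k) i * R.M₀z z i j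
          * (R.R₂.Mz z ^ (n - 1 - k)).mulVec (vecC R.R₂.η) j
      = ∑ i, ∑ j, (R.R₁.ξ i : ℂ)
          * (R.R₁.Mz z ^ k * R.M₀z z * R.R₂.Mz z ^ (n - 1 - k)) i j * R.R₂.η j := by
    intro k
    have h1 : Matrix.vecMul (vecC R.R₁.ξ) (R.R₁.Mz z ^ k)
          ⬝ᵥ (R.M₀z z).mulVec ((R.R₂.Mz z ^ (n - 1 - k)).mulVec (vecC R.R₂.η))
        = vecC R.R₁.ξ ⬝ᵥ (R.R₁.Mz z ^ k * R.M₀z z * R.R₂.Mz z ^ (n - 1 - k)).mulVec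
          (vecC R.R₂.η) := by
      rw [← Matrix.dotProduct_mulVec, Matrix.mulVec_mulVec, Matrix.mulVec_mulVec]
    rw [dotProduct_mulVec_eq_sum, dotProduct_mulVec_eq_sum] at h1
    exact h1
  simp only [LinearRep.transform_eq, toLinearRep_Mz, fromBlocks_upper_pow, Fintype.sum_sum_type]
  have e : ∑ i, ∑ j, ∑ k ∈ Finset.range n,
        Matrix.vecMul (vecC R.R₁.ξ) (R.R₁.Mz z ^ k) i * R.M₀z z i j
          * (R.R₂.Mz z ^ (n - 1 - k)).mulVec (vecC R.R₂.η) j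
      = ∑ i, ∑ j, (R.R₁.ξ i : ℂ) * (∑ k ∈ Finset.range n,
          R.R₁.Mz z ^ k * R.M₀z z * R.R₂.Mz z ^ (n - 1 - k)) i j * R.R₂.η j := by
    rw [Finset.sum_congr rfl (fun i _ => Finset.sum_comm), Finset.sum_comm]
    rw [Finset.sum_congr rfl (fun k _ => key k), Finset.sum_comm]
    refine Finset.sum_congr rfl fun i _ => ?_
    rw [Finset.sum_comm]
    refine Finset.sum_congr rfl fun j _ => ?_
    rw [Matrix.sum_apply, Finset.mul_sum, Finset.sum_mul]
  rw [e]
  simp only [toLinearRep, Sum.elim_inl, Sum.elim_inr, Matrix.fromBlocks_apply₁₁,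
    Matrix.fromBlocks_apply₁₂, Matrix.fromBlocks_apply₂₁, Matrix.fromBlocks_apply₂₂,
    Matrix.zero_apply, mul_zero, zero_mul, Finset.sum_const_zero, zero_add,
    Finset.sum_add_distrib]
  ring

end BlockRep

end

end RationalModel

/-! ### Estimates for each block and for the whole model -/

namespace RationalModel

noncomputable section

namespace LinearRep

variable {ι : Type} [Fintype ι] [DecidableEq ι] {R : LinearRep ι} {l : ℝ} {v w : ι → ℝ}

/-- Entrywise estimates are contracted with ξ or η. The last bound pairs index n + 1 with l^n
because the crossing term of length n + 1 contains only n factors from the diagonal blocks. -/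
theorem exists_pow_estimates (h : Perron R.M l v w) (hM : EventuallyPos R.M)
    (ha : R.IsAperiodicPair) :
    ∃ C c ρ : ℝ, 0 ≤ C ∧ 0 < c ∧ 0 < ρ ∧ ρ < 1 ∧ c ≤ R.γ / 2 ∧
      (∀ i, PowEst R.β R.γ
        (fun θ n => Matrix.vecMul (vecC R.ξ) (R.Mz (θ * Complex.I) ^ n) i / (l : ℂ) ^ n)
        (∑ k, R.ξ k * (v k * w i)) C c ρ) ∧
      (∀ i, PowEst R.β R.γ
        (fun θ n => (R.Mz (θ * Complex.I) ^ n).mulVec (vecC R.η) i / (l : ℂ) ^ n)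
        (∑ k, R.η k * (v i * w k)) C c ρ) ∧
      ∀ θ : ℝ, |θ| ≤ Real.pi → ∀ n,
        ‖R.transform (n + 1) (θ * Complex.I) / (l : ℂ) ^ n‖ ≤ C := by
  have hl := h.l_pos
  have hl' : (l : ℂ) ≠ 0 := by exact_mod_cast hl.ne'
  obtain ⟨C, c, ρ, hC, hc, hρ0, hρ1, hcγ, hest⟩ := exists_gaussian_estimate h hM ha
  have hP : ∀ i j, PowEst R.β R.γ (fun θ n => (R.Mz (θ * Complex.I) ^ n) i j / (l : ℂ) ^ n)
      (v i * w j) C c ρ := fun i j θ hθ n => hest θ hθ n i j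
  set S₁ := ∑ k, |R.ξ k| with hS₁
  set S₂ := ∑ k, |R.η k| with hS₂
  have hS₁0 : 0 ≤ S₁ := Finset.sum_nonneg fun k _ => abs_nonneg _
  have hS₂0 : 0 ≤ S₂ := Finset.sum_nonneg fun k _ => abs_nonneg _
  have p1 : 0 ≤ S₁ * C := by positivity
  have p2 : 0 ≤ S₂ * C := by positivity
  have p3 : 0 ≤ l * (S₁ * C * S₂) := by positivity
  have hrow : ∀ i, PowEst R.β R.γ
      (fun θ n => Matrix.vecMul (vecC R.ξ) (R.Mz (θ * Complex.I) ^ n) i / (l : ℂ) ^ n)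
      (∑ k, R.ξ k * (v k * w i)) (S₁ * C) c ρ := by
    intro i
    have := PowEst.sum (t := R.ξ) (fun k => hP k i)
    convert! this using 3
    simp [Matrix.vecMul, dotProduct, Finset.sum_div, mul_div_assoc]
  have hcol : ∀ i, PowEst R.β R.γ
      (fun θ n => (R.Mz (θ * Complex.I) ^ n).mulVec (vecC R.η) i / (l : ℂ) ^ n)
      (∑ k, R.η k * (v i * w k)) (S₂ * C) c ρ := by
    intro i
    have := PowEst.sum (t := R.η) (fun k => hP i k)
    convert! this using 3
    simp only [Matrix.mulVec, dotProduct, Finset.sum_div, vecC_apply]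
    exact Finset.sum_congr rfl fun k _ => by ring
  set D := S₁ * C + S₂ * C + l * (S₁ * C * S₂) with hD
  refine ⟨D, c, ρ, by positivity, hc, hρ0, hρ1, hcγ,
    fun i => (hrow i).mono p1 (by linarith) le_rfl hρ0.le le_rfl,
    fun i => (hcol i).mono p2 (by linarith) le_rfl hρ0.le le_rfl, fun θ hθ n => ?_⟩
  have e : R.transform (n + 1) (θ * Complex.I) / (l : ℂ) ^ n
      = l * ∑ j, (Matrix.vecMul (vecC R.ξ) (R.Mz (θ * Complex.I) ^ (n + 1)) j
        / (l : ℂ) ^ (n + 1)) * R.η j := by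
    rw [transform_eq, Finset.sum_comm, Finset.sum_div, Finset.mul_sum]
    refine Finset.sum_congr rfl fun j _ => ?_
    rw [← Finset.sum_mul]
    simp only [Matrix.vecMul, dotProduct, vecC_apply]
    rw [pow_succ (l : ℂ)]
    field_simp
  rw [e, norm_mul, Complex.norm_real, Real.norm_of_nonneg hl.le]
  have h1 : ‖∑ j, (Matrix.vecMul (vecC R.ξ) (R.Mz (θ * Complex.I) ^ (n + 1)) j
        / (l : ℂ) ^ (n + 1)) * R.η j‖ ≤ S₁ * C * S₂ := by
    rw [hS₂, Finset.mul_sum]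
    refine (norm_sum_le _ _).trans (Finset.sum_le_sum fun j _ => ?_)
    rw [norm_mul, Complex.norm_real, Real.norm_eq_abs]
    refine mul_le_mul_of_nonneg_right (((hrow j) θ hθ (n + 1)).1.trans ?_) (abs_nonneg _)
    exact mul_le_of_le_one_right p1
      (pow_le_one₀ (Real.exp_pos _).le (exp_neg_mul_sq_le_one hc.le θ))
  have := mul_le_mul_of_nonneg_left h1 hl.le
  linarith

end LinearRep

namespace BlockRep

variable {ι₁ ι₂ : Type} [Fintype ι₁] [DecidableEq ι₁] [Fintype ι₂] [DecidableEq ι₂]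
  {R : BlockRep ι₁ ι₂} {l : ℝ} {v₁ w₁ : ι₁ → ℝ} {v₂ w₂ : ι₂ → ℝ}

omit [Fintype ι₁] [DecidableEq ι₁] [Fintype ι₂] [DecidableEq ι₂] in
theorem norm_M₀z_le (i : ι₁) (j : ι₂) (θ : ℝ) :
    ‖R.M₀z (θ * Complex.I) i j‖ ≤ R.A₀ i j + R.B₀ i j := by
  refine (norm_add_le _ _).trans ?_
  rw [norm_mul, LinearRep.norm_exp_mul_I, one_mul, Complex.norm_real, Complex.norm_real,
    Real.norm_of_nonneg (R.A₀_nonneg i j), Real.norm_of_nonneg (R.B₀_nonneg i j)]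

omit [Fintype ι₁] [DecidableEq ι₁] [Fintype ι₂] [DecidableEq ι₂] in
theorem norm_M₀z_sub_le (i : ι₁) (j : ι₂) (θ : ℝ) :
    ‖R.M₀z (θ * Complex.I) i j - ((R.A₀ i j + R.B₀ i j : ℝ) : ℂ)‖
      ≤ (R.A₀ i j + R.B₀ i j) * |θ| := by
  have e : R.M₀z (θ * Complex.I) i j - ((R.A₀ i j + R.B₀ i j : ℝ) : ℂ)
      = (Complex.exp (Complex.I * θ) - 1) * R.A₀ i j := by
    rw [M₀z, mul_comm (θ : ℂ)]; push_cast; ring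
  rw [e, norm_mul, Complex.norm_real, Real.norm_of_nonneg (R.A₀_nonneg i j), mul_comm]
  have h1 := Real.norm_exp_I_mul_ofReal_sub_one_le (x := θ)
  rw [Real.norm_eq_abs] at h1
  have h2 := R.B₀_nonneg i j
  exact mul_le_mul (by linarith) h1 (norm_nonneg _) (add_nonneg (R.A₀_nonneg i j) h2)

/-- The constant a is (ξ₁ · v₁)(w₁' M₀ v₂)(w₂ · η₂) with M₀ = A₀ + B₀. It is positive since ξ₁, M₀
and η₂ are nonnegative and nonzero and the Perron vectors are strictly positive. -/
theorem exists_convEst (h₁ : Perron R.R₁.M l v₁ w₁) (h₂ : Perron R.R₂.M l v₂ w₂)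
    (hM₁ : EventuallyPos R.R₁.M) (hM₂ : EventuallyPos R.R₂.M)
    (ha₁ : R.R₁.IsAperiodicPair) (ha₂ : R.R₂.IsAperiodicPair)
    {β γ : ℝ} (hβ₁ : R.R₁.β = β) (hβ₂ : R.R₂.β = β) (hγ₁ : R.R₁.γ = γ) (hγ₂ : R.R₂.γ = γ)
    (hξ : R.R₁.ξ ≠ 0) (hη : R.R₂.η ≠ 0) (h₀ : R.A₀ + R.B₀ ≠ 0) :
    ∃ a D c : ℝ, 0 < a ∧ 0 < c ∧ c ≤ γ / 2 ∧ ConvEst β γ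
      (fun θ n => R.toLinearRep.transform n (θ * Complex.I) / (l : ℂ) ^ (n - 1)) a D c := by
  have hl' : (l : ℂ) ≠ 0 := by exact_mod_cast h₁.l_pos.ne'
  obtain ⟨C₁, c₁, ρ₁, hC₁, hc₁, hρ₁, hρ₁', hcγ₁, hrow, -, htr₁⟩ :=
    LinearRep.exists_pow_estimates h₁ hM₁ ha₁
  obtain ⟨C₂, c₂, ρ₂, hC₂, hc₂, hρ₂, hρ₂', hcγ₂, -, hcol, htr₂⟩ :=
    LinearRep.exists_pow_estimates h₂ hM₂ ha₂
  rw [hβ₁, hγ₁] at hrow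
  rw [hβ₂, hγ₂] at hcol
  rw [hγ₁] at hcγ₁
  set C := max C₁ C₂
  set c := min c₁ c₂
  set ρ := max ρ₁ ρ₂
  have hc : 0 < c := lt_min hc₁ hc₂
  have hcγ : c ≤ γ / 2 := (min_le_left _ _).trans hcγ₁
  have hρ0 : 0 < ρ := lt_max_of_lt_left hρ₁
  have hρ1 : ρ < 1 := max_lt hρ₁' hρ₂'
  have hC : 0 ≤ C := hC₁.trans (le_max_left _ _)
  have hrow' := fun i => (hrow i).mono hC₁ (le_max_left C₁ C₂) (min_le_left c₁ c₂) hρ₁.le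
    (le_max_left ρ₁ ρ₂)
  have hcol' := fun i => (hcol i).mono hC₂ (le_max_right C₁ C₂) (min_le_right c₁ c₂) hρ₂.le
    (le_max_right ρ₁ ρ₂)
  have hconv := fun q : ι₁ × ι₂ => (hrow' q.1).conv (hcol' q.2)
    (y := fun θ => R.M₀z (θ * Complex.I) q.1 q.2) hC hc.le hcγ hρ0 hρ1
    (norm_M₀z_le q.1 q.2) (norm_M₀z_sub_le q.1 q.2)
  choose D hD using hconv
  have hsum := (ConvEst.sum hD).add_bounded
    (r := fun θ n => (R.R₁.transform n (θ * Complex.I) + R.R₂.transform n (θ * Complex.I))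
      / (l : ℂ) ^ (n - 1)) (B := C₁ + C₂) (by positivity) (fun θ hθ n => by
        rw [Nat.add_sub_cancel, add_div]
        exact (norm_add_le _ _).trans (add_le_add (htr₁ θ hθ n) (htr₂ θ hθ n)))
  refine ⟨_, _, c, ?_, hc, hcγ, hsum.congr fun θ n => ?_⟩
  · have hrow0 : ∀ i, 0 < ∑ k, R.R₁.ξ k * (v₁ k * w₁ i) := by
      intro i
      obtain ⟨k, hk⟩ := Function.ne_iff.1 hξ
      have hvw : ∀ k, 0 < v₁ k * w₁ i := fun k => mul_pos (h₁.v_pos k) (h₁.w_pos i)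
      exact Finset.sum_pos' (fun k _ => mul_nonneg (R.R₁.ξ_nonneg k) (hvw k).le)
        ⟨k, Finset.mem_univ k, mul_pos (lt_of_le_of_ne (R.R₁.ξ_nonneg k) (Ne.symm hk)) (hvw k)⟩
    have hcol0 : ∀ j, 0 < ∑ k, R.R₂.η k * (v₂ j * w₂ k) := by
      intro j
      obtain ⟨k, hk⟩ := Function.ne_iff.1 hη
      have hvw : ∀ k, 0 < v₂ j * w₂ k := fun k => mul_pos (h₂.v_pos j) (h₂.w_pos k)
      exact Finset.sum_pos' (fun k _ => mul_nonneg (R.R₂.η_nonneg k) (hvw k).le)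
        ⟨k, Finset.mem_univ k, mul_pos (lt_of_le_of_ne (R.R₂.η_nonneg k) (Ne.symm hk)) (hvw k)⟩
    have hm : ∀ i j, 0 ≤ R.A₀ i j + R.B₀ i j := fun i j =>
      add_nonneg (R.A₀_nonneg i j) (R.B₀_nonneg i j)
    obtain ⟨i, hi⟩ := Function.ne_iff.1 h₀
    obtain ⟨j, hj⟩ := Function.ne_iff.1 hi
    have hij : 0 < R.A₀ i j + R.B₀ i j := lt_of_le_of_ne (hm i j) (Ne.symm hj)
    exact Finset.sum_pos' (fun q _ => mul_nonneg (mul_nonneg (hrow0 q.1).le (hm q.1 q.2))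
        (hcol0 q.2).le)
      ⟨(i, j), Finset.mem_univ _, mul_pos (mul_pos (hrow0 i) hij) (hcol0 j)⟩
  · rw [transform_block, add_div, Fintype.sum_prod_type, Finset.sum_div]
    congr 1
    refine Finset.sum_congr rfl fun i _ => ?_
    rw [Finset.sum_div]
    refine Finset.sum_congr rfl fun j _ => ?_
    rw [Finset.sum_div]
    refine Finset.sum_congr rfl fun k hk => ?_
    have hk' : k + (n + 1 - 1 - k) = n + 1 - 1 := by
      have := Finset.mem_range.1 hk; omega
    have hp : (l : ℂ) ^ (n + 1 - 1) = (l : ℂ) ^ k * (l : ℂ) ^ (n + 1 - 1 - k) := by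
      rw [← pow_add, hk']
    rw [hp]
    field_simp

end BlockRep

end

end RationalModel

/-! ### Fourier inversion and the local limit estimate -/

namespace RationalModel

noncomputable section

open MeasureTheory Polynomial

theorem integral_exp_int_mul_I (d : ℤ) :
    ∫ θ in (-Real.pi)..Real.pi, Complex.exp (d * Complex.I * θ)
      = if d = 0 then (2 * Real.pi : ℂ) else 0 := by
  split_ifs with hd
  · subst hd
    simp
    ring
  · have hd' : (d : ℂ) * Complex.I ≠ 0 :=
      mul_ne_zero (by exact_mod_cast hd) Complex.I_ne_zero
    rw [integral_exp_mul_complex hd', div_eq_zero_iff]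
    left
    rw [sub_eq_zero, Complex.exp_eq_exp_iff_exists_int]
    exact ⟨d, by push_cast; ring⟩

/-- Coefficients of a polynomial from its values on the unit circle. -/
theorem integral_eval₂_circle (p : ℝ[X]) (k : ℕ) :
    ∫ θ in (-Real.pi)..Real.pi, Complex.exp (-(k * Complex.I * θ))
        * p.eval₂ (algebraMap ℝ ℂ) (Complex.exp (θ * Complex.I))
      = 2 * Real.pi * p.coeff k := by
  have e : ∀ θ : ℝ, Complex.exp (-(k * Complex.I * θ))
        * p.eval₂ (algebraMap ℝ ℂ) (Complex.exp (θ * Complex.I))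
      = ∑ m ∈ Finset.range (p.natDegree + 1),
          (p.coeff m : ℂ) * Complex.exp (((m - k : ℤ) : ℂ) * Complex.I * θ) := by
    intro θ
    rw [eval₂_eq_sum_range, Finset.mul_sum]
    refine Finset.sum_congr rfl fun m _ => ?_
    rw [← Complex.exp_nat_mul, mul_left_comm, ← Complex.exp_add]
    simp only [Complex.coe_algebraMap]
    congr 2
    push_cast; ring
  simp_rw [e]
  rw [intervalIntegral.integral_finsetSum fun m _ => Continuous.intervalIntegrable
    (by fun_prop) _ _]
  simp_rw [intervalIntegral.integral_const_mul, integral_exp_int_mul_I]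
  have h2 : ∀ m : ℕ, (p.coeff m : ℂ) * (if (m - k : ℤ) = 0 then (2 * Real.pi : ℂ) else 0)
      = if m = k then 2 * Real.pi * (p.coeff k : ℂ) else 0 := by
    intro m
    by_cases hm : m = k
    · subst hm; simp; ring
    · have : (m - k : ℤ) ≠ 0 := by omega
      simp [hm, this]
  simp_rw [h2]
  rw [Finset.sum_ite_eq']
  split_ifs with hk
  · rfl
  · rw [Finset.mem_range, not_lt] at hk
    rw [coeff_eq_zero_of_natDegree_lt (by omega)]
    simp

/-- With b = c n this integral is the source of the order 1/n, both inside [-π, π] and in the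
Gaussian tail. -/
theorem integral_abs_mul_exp {b : ℝ} (hb : 0 < b) :
    Integrable (fun x : ℝ => |x| * Real.exp (-b * x ^ 2)) ∧
      ∫ x : ℝ, |x| * Real.exp (-b * x ^ 2) = 1 / b := by
  constructor
  · have := (integrable_mul_exp_neg_mul_sq hb).norm
    simpa [Real.norm_eq_abs, abs_mul, abs_of_pos (Real.exp_pos _)] using this
  · have h1 : ∫ x : ℝ in Set.Ioi 0, x * Real.exp (-b * x ^ 2) = (2 * b)⁻¹ := by
      have := integral_mul_cexp_neg_mul_sq (b := (b : ℂ)) (by simpa using hb)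
      have e : ∀ r : ℝ, (r : ℂ) * Complex.exp (-(b : ℂ) * (r : ℂ) ^ 2)
          = ((r * Real.exp (-b * r ^ 2) : ℝ) : ℂ) := by
        intro r; push_cast; rfl
      simp_rw [e] at this
      rw [integral_complex_ofReal] at this
      exact_mod_cast this
    have h2 := integral_comp_abs (f := fun x : ℝ => x * Real.exp (-b * x ^ 2))
    simp only [sq_abs] at h2
    rw [h2, h1]
    field_simp

/-- Fourier inversion for the powers of the Gaussian characteristic function. -/
theorem integral_gaussChar {β γ : ℝ} (hγ : 0 < γ) {n : ℕ} (hn : 0 < n) (k : ℕ) :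
    Integrable (fun θ : ℝ => Complex.exp (-(k * Complex.I * θ)) * gaussChar β γ θ ^ n) ∧
    ∫ θ : ℝ, Complex.exp (-(k * Complex.I * θ)) * gaussChar β γ θ ^ n
      = ((2 * Real.pi / √n * (Real.exp (-(((k : ℝ) - β * n) ^ 2 / (2 * γ * n)))
          / √(2 * Real.pi * γ)) : ℝ) : ℂ) := by
  have hn' : (0 : ℝ) < n := by exact_mod_cast hn
  have hpi := Real.pi_pos
  set b : ℝ := n * γ / 2 with hb
  have hb0 : 0 < b := by positivity
  have hbre : 0 < (b : ℂ).re := by simpa using hb0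
  have e : ∀ θ : ℝ, Complex.exp (-(k * Complex.I * θ)) * gaussChar β γ θ ^ n
      = Complex.exp (Complex.I * ((β * n - k : ℝ) : ℂ) * θ) * Complex.exp (-(b : ℂ) * θ ^ 2) := by
    intro θ
    rw [gaussChar, ← Complex.exp_nat_mul, ← Complex.exp_add, ← Complex.exp_add]
    congr 1
    rw [mul_pow, Complex.I_sq, hb]
    push_cast; ring
  simp_rw [e]
  refine ⟨?_, ?_⟩
  · have h1 := integrable_cexp_quadratic hbre (Complex.I * ((β * n - k : ℝ) : ℂ)) 0
    refine h1.congr (Filter.Eventually.of_forall fun θ => ?_)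
    simp only
    rw [← Complex.exp_add]
    congr 1; ring
  · rw [fourierIntegral_gaussian hbre]
    have h1 : ((Real.pi : ℂ) / b) ^ (1 / 2 : ℂ) = ((√(Real.pi / b) : ℝ) : ℂ) := by
      rw [Real.sqrt_eq_rpow, Complex.ofReal_cpow (by positivity)]
      push_cast; rfl
    rw [h1]
    have h2 : -((β * n - k : ℝ) : ℂ) ^ 2 / (4 * b)
        = ((-(((k : ℝ) - β * n) ^ 2 / (2 * γ * n)) : ℝ) : ℂ) := by
      rw [hb]; push_cast; field_simp; ring
    rw [h2, ← Complex.ofReal_exp, ← Complex.ofReal_mul]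
    congr 1
    have h3 : √(Real.pi / b) = 2 * Real.pi / √n / √(2 * Real.pi * γ) := by
      rw [Real.sqrt_eq_iff_mul_self_eq (by positivity) (by positivity)]
      have s1 : √(n : ℝ) * √n = n := Real.mul_self_sqrt hn'.le
      have s2 : √(2 * Real.pi * γ) * √(2 * Real.pi * γ) = 2 * Real.pi * γ :=
        Real.mul_self_sqrt (by positivity)
      have : 2 * Real.pi / √n / √(2 * Real.pi * γ) * (2 * Real.pi / √n / √(2 * Real.pi * γ))
          = (2 * Real.pi) ^ 2 / ((√(n : ℝ) * √n) * (√(2 * Real.pi * γ) * √(2 * Real.pi * γ))) := by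
        field_simp
      rw [this, s1, s2, hb]
      field_simp
    rw [h3]; ring

/-- Closeness of the characteristic functions implies a local limit estimate. -/
theorem local_limit_of_charFun {β γ C c : ℝ} (hC : 0 ≤ C) (hc : 0 < c) (hcγ : c ≤ γ / 2) {n : ℕ}
    (hn : 0 < n) {p : ℝ[X]} (hp : p.eval 1 ≠ 0)
    (h : ∀ θ : ℝ, |θ| ≤ Real.pi →
      ‖p.eval₂ (algebraMap ℝ ℂ) (Complex.exp (θ * Complex.I)) / (p.eval 1 : ℝ)
        - gaussChar β γ θ ^ n‖ ≤ C * (|θ| * Real.exp (-c * θ ^ 2) ^ n + 1 / n)) (k : ℕ) :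
    |√(n : ℝ) * (p.coeff k / p.eval 1)
        - Real.exp (-(((k : ℝ) - β * n) ^ 2 / (2 * γ * n))) / √(2 * Real.pi * γ)|
      ≤ (C * (1 / c + 2 * Real.pi) + 1 / c) * (n : ℝ) ^ (-(1 / 2) : ℝ) := by
  have hn' : (0 : ℝ) < n := by exact_mod_cast hn
  have hpi := Real.pi_pos
  have hpi3 := Real.pi_gt_three
  have hγ : 0 < γ := by linarith
  set g := Real.exp (-(((k : ℝ) - β * n) ^ 2 / (2 * γ * n))) / √(2 * Real.pi * γ) with hg
  set ch : ℝ → ℂ := fun θ => Complex.exp (-(k * Complex.I * θ)) with hch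
  have hch1 : ∀ θ, ‖ch θ‖ = 1 := by
    intro θ
    have : -(k * Complex.I * θ) = ((-(k * θ) : ℝ) : ℂ) * Complex.I := by push_cast; ring
    simp only [hch]
    rw [this]
    exact Complex.norm_exp_ofReal_mul_I _
  obtain ⟨hint, hval⟩ := integral_gaussChar (β := β) hγ hn k
  obtain ⟨hai, hav⟩ := integral_abs_mul_exp (b := c * n) (by positivity)
  have hE : ∀ θ : ℝ, Real.exp (-c * θ ^ 2) ^ n = Real.exp (-(c * n) * θ ^ 2) := by
    intro θ; rw [← Real.exp_nat_mul]; congr 1; ring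
  set q : ℝ → ℂ := fun θ => p.eval₂ (algebraMap ℝ ℂ) (Complex.exp (θ * Complex.I)) /
    (p.eval 1 : ℝ) with hq
  have hqc : Continuous q := by
    simp only [hq, eval₂_eq_sum_range]
    fun_prop
  have hqI : ∫ θ in (-Real.pi)..Real.pi, ch θ * q θ = 2 * Real.pi * (p.coeff k / p.eval 1 : ℝ) := by
    have := integral_eval₂_circle p k
    simp only [hq, ← mul_div_assoc]
    rw [intervalIntegral.integral_div, this]
    push_cast; ring
  set S := Set.Ioc (-Real.pi) Real.pi with hS
  have hSm : MeasurableSet S := measurableSet_Ioc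
  rw [intervalIntegral.integral_of_le (by linarith)] at hqI
  have hchc : Continuous ch := by simp only [hch]; fun_prop
  have hqS : IntegrableOn (fun θ => ch θ * q θ) S := by
    have : Continuous fun θ => ch θ * q θ := hchc.mul hqc
    exact (this.intervalIntegrable _ _).1
  -- The Gaussian side is an integral over the whole line: on `S` it is compared with the
  -- characteristic function, outside `S` it is small by itself.
  have hsplit := integral_add_compl hSm hint
  have hdiff : ∫ θ in S, ch θ * (q θ - gaussChar β γ θ ^ n)
      = (∫ θ in S, ch θ * q θ) - ∫ θ in S, ch θ * gaussChar β γ θ ^ n := by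
    rw [← integral_sub hqS hint.integrableOn]
    simp_rw [mul_sub]
    rfl
  have hb1 : ‖∫ θ in S, ch θ * (q θ - gaussChar β γ θ ^ n)‖
      ≤ C * (1 / (c * n) + 2 * Real.pi / n) := by
    have hI1 : IntegrableOn (fun θ : ℝ => |θ| * Real.exp (-(c * n) * θ ^ 2)) S := hai.integrableOn
    have hI2 : IntegrableOn (fun _ : ℝ => 1 / (n : ℝ)) S := by
      refine integrableOn_const ?_
      simp [hS]
    have hI : IntegrableOn (fun θ : ℝ => C * (|θ| * Real.exp (-(c * n) * θ ^ 2) + 1 / n)) S :=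
      (hI1.add hI2).const_mul C
    refine (norm_integral_le_of_norm_le hI ?_).trans ?_
    · refine (ae_restrict_iff' hSm).2 (Filter.Eventually.of_forall fun θ hθ => ?_)
      rw [norm_mul, hch1, one_mul]
      have := h θ (abs_le.2 ⟨hθ.1.le, hθ.2⟩)
      rwa [hE] at this
    · rw [integral_const_mul, integral_add hI1 hI2]
      refine mul_le_mul_of_nonneg_left (add_le_add ?_ ?_) hC
      · rw [← hav]
        exact setIntegral_le_integral hai
          (Filter.Eventually.of_forall fun θ => by positivity)
      · rw [setIntegral_const]
        have : volume.real S = 2 * Real.pi := by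
          rw [hS, Real.volume_real_Ioc_of_le (by linarith)]; ring
        rw [this, smul_eq_mul]
        exact le_of_eq (by ring)
  have hb2 : ‖∫ θ in Sᶜ, ch θ * gaussChar β γ θ ^ n‖ ≤ 1 / (c * n) := by
    refine (norm_integral_le_of_norm_le hai.integrableOn ?_).trans ?_
    · refine (ae_restrict_iff' hSm.compl).2 (Filter.Eventually.of_forall fun θ hθ => ?_)
      rw [norm_mul, hch1, one_mul, norm_pow, ← hE]
      -- Outside `S` a factor |θ| may be inserted, so the tail is bounded by the same integral as
      -- the main error.
      have h1 : 1 ≤ |θ| := by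
        by_contra! hlt
        have := abs_lt.1 hlt
        exact hθ ⟨by linarith, by linarith⟩
      have h2 : ‖gaussChar β γ θ‖ ^ n ≤ Real.exp (-c * θ ^ 2) ^ n :=
        pow_le_pow_left₀ (norm_nonneg _) (norm_gaussChar_le hcγ θ) n
      exact h2.trans (le_mul_of_one_le_left (by positivity) h1)
    · rw [← hav]
      exact setIntegral_le_integral hai (Filter.Eventually.of_forall fun θ => by positivity)
  have hkey : ((2 * Real.pi * (p.coeff k / p.eval 1) - 2 * Real.pi / √n * g : ℝ) : ℂ)
      = (∫ θ in S, ch θ * (q θ - gaussChar β γ θ ^ n))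
        - ∫ θ in Sᶜ, ch θ * gaussChar β γ θ ^ n := by
    have hq' : ∫ θ in S, ch θ * q θ = ((2 * Real.pi * (p.coeff k / p.eval 1) : ℝ) : ℂ) := by
      rw [hqI]; push_cast; ring
    rw [hdiff, hq', Complex.ofReal_sub, ← hval, ← hsplit]
    ring
  have hn1 := norm_sub_le (∫ θ in S, ch θ * (q θ - gaussChar β γ θ ^ n))
    (∫ θ in Sᶜ, ch θ * gaussChar β γ θ ^ n)
  rw [← hkey, Complex.norm_real, Real.norm_eq_abs] at hn1
  have hs : 0 < √(n : ℝ) := Real.sqrt_pos.2 hn'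
  have hfin : 2 * Real.pi * (p.coeff k / p.eval 1) - 2 * Real.pi / √n * g
      = 2 * Real.pi / √n * (√n * (p.coeff k / p.eval 1) - g) := by
    field_simp
  rw [hfin, abs_mul, abs_of_pos (by positivity)] at hn1
  have hss : √(n : ℝ) * √n = n := Real.mul_self_sqrt hn'.le
  have hrp : (n : ℝ) ^ (-(1 / 2) : ℝ) = 1 / √n := by
    rw [Real.rpow_neg hn'.le, ← Real.sqrt_eq_rpow, one_div]
  rw [hrp]
  set T := |√(n : ℝ) * (p.coeff k / p.eval 1) - g| with hT
  set K := C * (1 / c + 2 * Real.pi) + 1 / c with hK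
  have hK0 : 0 ≤ K := by positivity
  -- Before rescaling the error is K / n; multiplying by √n gives the stated rate, and the factor 2π
  -- is discarded at the end.
  have h5 : 2 * Real.pi / √n * T ≤ K / (√n * √n) := by
    rw [hss]
    refine hn1.trans ((add_le_add hb1 hb2).trans (le_of_eq ?_))
    rw [hK]; field_simp
  rw [div_mul_eq_mul_div, div_le_div_iff₀ hs (by positivity)] at h5
  have h6 : 2 * Real.pi * T * √n ≤ K := by
    have : (2 * Real.pi * T * √n) * √(n : ℝ) ≤ K * √n := by linarith
    exact le_of_mul_le_mul_right this hs
  rw [mul_one_div, le_div_iff₀ hs]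
  have h7 : 0 ≤ T * √n := mul_nonneg (abs_nonneg _) hs.le
  nlinarith

end

end RationalModel

/-! ### The local limit theorem for the bicomponent model -/

theorem mainTheorem5 (m₁ m₂ : ℕ) (R : RationalModel.BlockRep (Fin m₁) (Fin m₂))
    (hR : R.IsEquipotentCommunicating)
    (β γ : ℝ)
    (hβ₁ : R.R₁.β = β) (hβ₂ : R.R₂.β = β)
    (hγ₁ : R.R₁.γ = γ) (hγ₂ : R.R₂.γ = γ)
    (hap₁ : R.R₁.IsAperiodicPair) (hap₂ : R.R₂.IsAperiodicPair) :
    0 < γ ∧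
      ∃ C : ℝ, ∃ N : ℕ, ∀ n : ℕ, N ≤ n → ∀ k : ℕ, k ≤ n →
        |√(n : ℝ) * R.toLinearRep.prob n k
            - Real.exp (-(((k : ℝ) - β * n) ^ 2 / (2 * γ * n))) / √(2 * Real.pi * γ)|
          ≤ C * (n : ℝ) ^ (-(1 / 2) : ℝ) := by
  open RationalModel in
  have hM₁ := eventuallyPos_of_irreducible hR.irreducible₁ hR.aperiodic₁
  have hM₂ := eventuallyPos_of_irreducible hR.irreducible₂ hR.aperiodic₂
  have hne₁ : Nonempty (Fin m₁) := (Function.ne_iff.1 hR.ξ₁_ne_zero).nonempty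
  have hne₂ : Nonempty (Fin m₂) := (Function.ne_iff.1 hR.η₂_ne_zero).nonempty
  obtain ⟨l, v₁, w₁, h₁⟩ := exists_perron hM₁
  obtain ⟨l₂, v₂, w₂, h₂⟩ := exists_perron hM₂
  have hl : l₂ = l := by
    rw [← LinearRep.lam_eq h₁, ← LinearRep.lam_eq h₂, hR.equipotent]
  subst hl
  refine ⟨hγ₁ ▸ LinearRep.γ_pos h₁ hM₁ hap₁, ?_⟩
  obtain ⟨a, D, c, ha, hc, hcγ, hconv⟩ := BlockRep.exists_convEst h₁ h₂ hM₁ hM₂ hap₁ hap₂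
    hβ₁ hβ₂ hγ₁ hγ₂ hR.ξ₁_ne_zero hR.η₂_ne_zero hR.M₀_ne_zero
  obtain ⟨C, hC, N, hN⟩ := hconv.normalized ha hc.le hcγ (by linarith)
  -- The shift to N + 1 ensures n > 0, which Fourier inversion requires.
  refine ⟨C * (1 / c + 2 * Real.pi) + 1 / c, N + 1, fun n hn k _ => ?_⟩
  obtain ⟨h0, hest⟩ := hN n (by omega)
  have hz : R.toLinearRep.transform n ((0 : ℝ) * Complex.I)
      = ((R.toLinearRep.genPoly n).eval 1 : ℝ) := by
    rw [Complex.ofReal_zero, zero_mul, LinearRep.transform_zero]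
  rw [hz] at h0
  have hp : (R.toLinearRep.genPoly n).eval 1 ≠ 0 := fun h => h0 (by rw [h]; simp)
  rw [LinearRep.prob_eq]
  refine local_limit_of_charFun hC hc hcγ (by omega) hp (fun θ hθ => ?_) k
  have := hest θ hθ
  -- The normalizing power l^(n-1) cancels between the transform at θ and at 0.
  rwa [hz, div_div_div_cancel_right₀ (fun h => h0 (by rw [h, div_zero]))] at this
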